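/- **Theorem (Completeness of HOPSU).** *Setting.* Terms are the simply typed $\lambda$-terms over typed constants and typed variables (infinitely many variables of each type) modulo $\alpha\beta\eta$, represented by their $\eta$-long $\beta$-normal forms $\lambda x_1,\dots,x_n.h(t_1,\dots,t_m)$. A *(higher-order) pattern* is a term in which every free variable is applied to a list of pairwise distinct ($\eta$-long forms of) bound variables. A *substitution* is a type-preserving map from variables to terms that moves only finitely many variables; $\mathrm{Dom}(\sigma)$ is the set of variables moved by $\sigma$, $\varepsilon$ is the identity, and $t\sigma$ is the result of applying $\sigma$ to $t$ and normalizing. Let $\mathcal R$ be a similarity relation on the alphabet: a map into $[0,1]$ with $\mathcal R(a,a)=1$, $\mathcal R(a,b)=\mathcal R(b,a)$, $\mathcal R(a,c)\ge\min(\mathcal R(a,b),\mathcal R(b,c))$, which is $0$ on two distinct variables, on two constants of different types, and on a variable and a constant. It extends to terms: $\mathcal R(h(t_1,\dots,t_m),k(s_1,\dots,s_m))=\min(\mathcal R(h,k),\mathcal R(t_1,s_1),\dots,\mathcal R(t_m,s_m))$, $\mathcal R(\lambda x.t,\lambda x.s)=\mathcal R(t,s)$ (bound variables being renamed apart, with degree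 $1$ if equal and $0$ if distinct), and $\mathcal R(t,s)=0$ if $t$ and $s$ have different shape. Let $0<\mu\le 1$. A substitution $\sigma$ is an *$(\mathcal R,\mu)$-unifier of $t,s$ with degree $d$* if $\mathcal R(t\sigma,s\sigma)=d\ge\mu$; $\sigma$ is *$(\mathcal R,\mu)$-more general than $\tau$ on $V$* if there is a substitution $\psi$ with $\mathcal R(X\sigma\psi,X\tau)\ge\mu$ for all $X\in V$; $\sigma$ is a *most general* $(\mathcal R,\mu)$-unifier of $t,s$ if it is an $(\mathcal R,\mu)$-unifier of them and is $(\mathcal R,\mu)$-more general than each of their $(\mathcal R,\mu)$-unifiers on $\mathrm{fv}(t)\cup\mathrm{fv}(s)$. *The algorithm.* HOPSU works on configurations $P;\sigma;d$ ($P$ a finite set of equations). It starts with $\{t\simeq^? s\};\varepsilon;1$ and repeatedly selects an arbitrary equation and applies one of the following rules to it, where $P$ is the rest of the problem. Capital letters are free variables; $\bar x=x_1,\dots,x_n$ and $\bar y$ are lists of distinct bound variables. - Abs: $\{\lambda x.t\simeq^?\lambda x.s\}\uplus P;\sigma;d\leadsto\{t\simeq^? s\}\cup P;\sigma;d$. -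 Dec: $\{f(t_1,\dots,t_n)\simeq^? g(s_1,\dots,s_n)\}\uplus P;\sigma;d\leadsto\{t_i\simeq^? s_i\mid 1\le i\le n\}\cup P;\sigma;\min(d,\mathcal R(f,g))$, if $f,g$ are constants or bound variables and $\min(d,\mathcal R(f,g))\ge\mu$. - SV: $\{F(\bar x)\simeq^? F(y_1,\dots,y_n)\}\uplus P;\sigma;d\leadsto P\vartheta;\sigma\vartheta;d$ with $\vartheta=\{F\mapsto\lambda\bar x.H(\bar z)\}$, where $\bar z$ enumerates $\{x_i\mid x_i=y_i\}$ and $H$ is fresh. - Ori: $\{a(\bar s)\simeq^? F(\bar x)\}\uplus P;\sigma;d\leadsto\{F(\bar x)\simeq^? a(\bar s)\}\cup P;\sigma;d$, if $a$ is a constant or $a\in\{\bar x\}$. - LF: $\{F(\bar x)\simeq^? a(\bar s)\}\uplus P;\sigma;d\leadsto P\vartheta;\sigma\vartheta;d$, if $F\notin\mathrm{fv}(a(\bar s))$, $a$ is a constant, a free variable or in $\{\bar x\}$, VarElim returns $\varphi$ on $F(\bar x)\simeq^? a(\bar s)$, and $\vartheta$ is the restriction of $\varphi$ to $\{F\}\cup\mathrm{fv}(a(\bar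 s))$. - Fail: $\leadsto\bot$, if no other rule applies to the selected equation. VarElim starts with $\{F(\bar x)\simeq^? a(\bar s)\};\varepsilon$, applies the following rules as long as possible, and returns $\varphi$ if it ends with $\emptyset;\varphi$. - VE1: $\{F(\bar x)\simeq^? a(s_1,\dots,s_m)\}\uplus P;\sigma\leadsto\{H_i(\bar x)\simeq^? s_i\mid 1\le i\le m\}\cup P;\sigma\vartheta$ with $\vartheta=\{F\mapsto\lambda\bar x.a(H_1(\bar x),\dots,H_m(\bar x))\}$, if $a$ is a constant or $a\in\{\bar x\}$; the $H_i$ are fresh and distinct, and the $H_i(\bar x)$ are $\eta$-expanded. - VE2: $\{F(\bar x)\simeq^? G(\bar y)\}\uplus P;\sigma\leadsto P\vartheta;\sigma\vartheta$ with $F\ne G$ and $\vartheta=\{F\mapsto\lambda\bar x.H(\bar z),\,G\mapsto\lambda\bar y.H(\bar z)\}$, where $\bar z$ enumerates $\{\bar x\}\cap\{\bar y\}$ and $H$ is fresh. - Removal of binders: $\{\lambda x.t\simeq^?\lambda x.s\}\uplus P;\sigma\leadsto\{t\simeq^? s\}\cup P;\sigma$. "Fresh" means: of the appropriate type, not used before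 in the run, and not in a given finite set $W\supseteq\mathrm{fv}(t)\cup\mathrm{fv}(s)$ of variables. A run that ends with $\emptyset;\sigma;d$ *succeeds* with the computed answer $(\sigma,d)$; a run that ends with $\bot$ *fails*. *Statement.* Let $t$ and $s$ be higher-order patterns and suppose that they have an $(\mathcal R,\mu)$-unifier $\tau$ with degree $d_\tau\ge\mu$. Then, whichever equations are selected and whichever fresh variables are chosen, every run of HOPSU on $t,s$ (including its calls of VarElim) terminates and none fails, so that HOPSU succeeds. For every computed answer $(\sigma,d)$: 1. $\sigma$ is $(\mathcal R,\mu)$-more general than $\tau$ on $\mathrm{Dom}(\tau)$, provided that the fresh variables are chosen outside $\mathrm{Dom}(\tau)$, i.e. $\mathrm{Dom}(\tau)\subseteq W$; 2. $d\ge d_\tau$; 3. $\sigma$ maps variables to patterns and is an $(\mathcal R,\mu)$-unifier of $t$ and $s$ with degree exactly $d$; it is a most general $(\mathcal R,\mu)$-unifier of $t$ and $s$, and $d$ is the maximum of the degrees of all their $(\mathcal R,\mu)$-unifiers. In particular, the problem is unitary, and the computed mgu has the maximal degree. -/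

import Mathlib

universe u v w

set_option linter.checkUnivs false

namespace HOPU

/-- Simple types over a set `B` of basic types. -/
inductive Ty (B : Type u) : Type u
  | base : B → Ty B
  | arr : Ty B → Ty B → Ty B

/-- `arrs [A₁, …, Aₙ] B` is the type `A₁ → ⋯ → Aₙ → B`. -/
def arrs {B : Type u} (As : List (Ty B)) (T : Ty B) : Ty B :=
  As.foldr Ty.arr T

/-- The alphabet: typed constants and typed (free) variables. There are infinitely many variables
of each type, so that fresh variables are always available. -/
structure Lang where
  Base : Type u
  Con : Type v
  Var : Type w
  conTy : Con → Ty Base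
  varTy : Var → Ty Base
  infinite_var : ∀ A : Ty Base, {X : Var | varTy X = A}.Infinite

/-- Symbols that can stand at the head of a term: constants, bound variables (de Bruijn indices)
and free variables. -/
inductive Head (L : Lang.{u, v, w}) : Type (max u v w)
  | con : L.Con → Head L
  | bvar : ℕ → Head L
  | fvar : L.Var → Head L

/-- Terms in β-normal form, written `λ x₁ … xₙ. h(t₁, …, tₘ)`. Bound variables are de Bruijn
indices, so α-equivalent terms are equal. Together with the judgement `HasTy` below (which admits
η-long forms only) these are the simply typed λ-terms modulo αβη: every class has exactly one
η-long β-normal representative. -/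
inductive Tm (L : Lang.{u, v, w}) : Type (max u v w)
  | lam : Ty L.Base → Tm L → Tm L
  | app : Head L → List (Tm L) → Tm L

variable {L : Lang.{u, v, w}}

/-- Contexts: the types of the bound variables in scope, index `0` first. -/
abbrev Ctx (L : Lang.{u, v, w}) := List (Ty L.Base)

/-- The type of a symbol. -/
def headTy (Γ : Ctx L) : Head L → Option (Ty L.Base)
  | .con c => some (L.conTy c)
  | .bvar i => Γ[i]?
  | .fvar X => some (L.varTy X)

mutual
/-- `HasTy Γ t A`: `t` is a term of type `A` in η-long β-normal form. -/
inductive HasTy : Ctx L → Tm L → Ty L.Base → Prop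
  | lam {Γ : Ctx L} {A B : Ty L.Base} {t : Tm L} :
      HasTy (A :: Γ) t B → HasTy Γ (.lam A t) (.arr A B)
  | app {Γ : Ctx L} {h : Head L} {ts : List (Tm L)} {As : List (Ty L.Base)} {b : L.Base} :
      headTy Γ h = some (arrs As (.base b)) → HasTys Γ ts As → HasTy Γ (.app h ts) (.base b)
/-- Typing of argument lists. -/
inductive HasTys : Ctx L → List (Tm L) → List (Ty L.Base) → Prop
  | nil {Γ : Ctx L} : HasTys Γ [] []
  | cons {Γ : Ctx L} {t : Tm L} {ts : List (Tm L)} {A : Ty L.Base} {As : List (Ty L.Base)} :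
      HasTy Γ t A → HasTys Γ ts As → HasTys Γ (t :: ts) (A :: As)
end

/-! ### Renaming of bound variables, η-expansion -/

/-- Lifting of a renaming under a binder. -/
def upRen (ρ : ℕ → ℕ) : ℕ → ℕ
  | 0 => 0
  | i + 1 => ρ i + 1

/-- Renaming of the bound variables in a head. -/
def Head.ren (ρ : ℕ → ℕ) : Head L → Head L
  | .bvar i => .bvar (ρ i)
  | .con c => .con c
  | .fvar X => .fvar X

mutual
/-- Renaming of the bound variables that are loose in a term. -/
def Tm.ren (ρ : ℕ → ℕ) : Tm L → Tm L
  | .lam A t => .lam A (Tm.ren (upRen ρ) t)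
  | .app h ts => .app (h.ren ρ) (Tm.renList ρ ts)
/-- Renaming in argument lists. -/
def Tm.renList (ρ : ℕ → ℕ) : List (Tm L) → List (Tm L)
  | [] => []
  | t :: ts => Tm.ren ρ t :: Tm.renList ρ ts
end

/-- `etaExp A h ts` is the η-long form of `h(ts)`, where `h(ts)` has type `A` and the `ts` are
η-long. -/
def etaExp : Ty L.Base → Head L → List (Tm L) → Tm L
  | .base _, h, ts => .app h ts
  | .arr A B, h, ts =>
      .lam A (etaExp B (h.ren Nat.succ) (Tm.renList Nat.succ ts ++ [etaExp A (.bvar 0) []]))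

/-- The η-long form of a free variable. -/
def etaVar (X : L.Var) : Tm L := etaExp (L.varTy X) (.fvar X) []

/-- `λ x₁ : A₁. … λ xₙ : Aₙ. t`. -/
def lams (As : List (Ty L.Base)) (t : Tm L) : Tm L := As.foldr Tm.lam t

/-- `λ x₁, …, xₙ. t` for a term `t` in which only the distinct bound variables `xs = [x₁, …, xₙ]`,
of types `As = [A₁, …, Aₙ]`, are loose; the result has no loose bound variable. -/
def absVars (As : List (Ty L.Base)) (xs : List ℕ) (t : Tm L) : Tm L :=
  lams As (t.ren fun x => As.length - 1 - xs.idxOf x)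

/-- `us` is the list of the η-long forms of the bound variables `xs`. -/
def IsBVars (Γ : Ctx L) (xs : List ℕ) (us : List (Tm L)) : Prop :=
  List.Forall₂ (fun x u => ∃ A, Γ[x]? = some A ∧ u = etaExp A (.bvar x) []) xs us

/-! ### Substitutions -/

mutual
/-- Capture-avoiding replacement of the bound variable `k` by `v`; at the places where `k` is the
head of a subterm `k(ts)`, the application of `v` to the arguments is computed by `ap`. -/
def Tm.instWith (ap : Tm L → List (Tm L) → Tm L) (k : ℕ) (v : Tm L) : Tm L → Tm L
  | .lam A t => .lam A (Tm.instWith ap (k + 1) (v.ren Nat.succ) t)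
  | .app (.bvar i) ts =>
      if i = k then ap v (Tm.instListWith ap k v ts)
      else .app (.bvar (if k < i then i - 1 else i)) (Tm.instListWith ap k v ts)
  | .app (.con c) ts => .app (.con c) (Tm.instListWith ap k v ts)
  | .app (.fvar X) ts => .app (.fvar X) (Tm.instListWith ap k v ts)
/-- The same for argument lists. -/
def Tm.instListWith (ap : Tm L → List (Tm L) → Tm L) (k : ℕ) (v : Tm L) :
    List (Tm L) → List (Tm L)
  | [] => []
  | t :: ts => Tm.instWith ap k v t :: Tm.instListWith ap k v ts
end

/-- `happ A t us` is the β-normal form of `(t u₁ ⋯ uₙ)`, where `t` is a normal term of type `A` and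
`us` are normal (hereditary substitution, by recursion on the type): contracting
`(λ x. b) u₁` creates new redexes only with functions of the type of `u₁`. -/
def happ : Ty L.Base → Tm L → List (Tm L) → Tm L
  | .arr A B, .lam _ b, u :: us => happ B (Tm.instWith (happ A) 0 u b) us
  | _, t, _ => t

mutual
/-- Application of a substitution of free variables to a term, the result being β-normalized.
(The values of substitutions have no loose bound variables, so nothing can be captured.) -/
def Tm.subst (σ : L.Var → Tm L) : Tm L → Tm L
  | .lam A t => .lam A (Tm.subst σ t)
  | .app (.fvar X) ts => happ (L.varTy X) (σ X) (Tm.substList σ ts)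
  | .app (.con c) ts => .app (.con c) (Tm.substList σ ts)
  | .app (.bvar i) ts => .app (.bvar i) (Tm.substList σ ts)
/-- The same for argument lists. -/
def Tm.substList (σ : L.Var → Tm L) : List (Tm L) → List (Tm L)
  | [] => []
  | t :: ts => Tm.subst σ t :: Tm.substList σ ts
end

/-- The domain of a substitution: the variables that it moves (modulo αβη). -/
def dom (σ : L.Var → Tm L) : Set L.Var := {X | σ X ≠ etaVar X}

/-- Substitutions: type preserving maps from variables to terms that move only finitely many
variables. -/
def IsSubst (σ : L.Var → Tm L) : Prop :=
  (∀ X, HasTy [] (σ X) (L.varTy X)) ∧ (dom σ).Finite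

/-- The composition `σϑ`: first `σ`, then `ϑ`. -/
def comp (σ ϑ : L.Var → Tm L) : L.Var → Tm L := fun X => (σ X).subst ϑ

open Classical in
/-- The restriction `φ|_V`. -/
noncomputable def restrict (φ : L.Var → Tm L) (V : Set L.Var) : L.Var → Tm L :=
  fun X => if X ∈ V then φ X else etaVar X

open Classical in
/-- The substitution `{F ↦ t}`. -/
noncomputable def single (F : L.Var) (t : Tm L) : L.Var → Tm L := Function.update etaVar F t

open Classical in
/-- The substitution `{F ↦ t, G ↦ s}`. -/
noncomputable def pair (F : L.Var) (t : Tm L) (G : L.Var) (s : Tm L) : L.Var → Tm L :=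
  Function.update (single F t) G s

/-- The free variables of a head. -/
def Head.fv : Head L → Set L.Var
  | .fvar X => {X}
  | .con _ => ∅
  | .bvar _ => ∅

mutual
/-- The free variables of a term. -/
def Tm.fv : Tm L → Set L.Var
  | .lam _ t => Tm.fv t
  | .app h ts => h.fv ∪ Tm.fvList ts
/-- The free variables of an argument list. -/
def Tm.fvList : List (Tm L) → Set L.Var
  | [] => ∅
  | t :: ts => Tm.fv t ∪ Tm.fvList ts
end

mutual
/-- Higher-order patterns: every free variable is applied to a list of (η-long forms of) pairwise
distinct bound variables. -/
def IsPattern : Ctx L → Tm L → Prop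
  | Γ, .lam A t => IsPattern (A :: Γ) t
  | Γ, .app (.fvar _) ts => ∃ xs : List ℕ, xs.Nodup ∧ IsBVars Γ xs ts
  | Γ, .app (.con _) ts => IsPatternList Γ ts
  | Γ, .app (.bvar _) ts => IsPatternList Γ ts
/-- Every member of the list is a pattern. -/
def IsPatternList : Ctx L → List (Tm L) → Prop
  | _, [] => True
  | Γ, t :: ts => IsPattern Γ t ∧ IsPatternList Γ ts
end

/-! ### Similarity relations -/

/-- Similarity relations for the minimum T-norm. -/
structure IsSimilarity {S : Type*} (R : S → S → ℝ) : Prop where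
  nonneg : ∀ a b, 0 ≤ R a b
  le_one : ∀ a b, R a b ≤ 1
  refl : ∀ a, R a a = 1
  symm : ∀ a b, R a b = R b a
  trans : ∀ a b c, min (R a b) (R b c) ≤ R a c

/-- Similarity relations on the alphabet: distinct variables, constants of different types, and
a variable and a constant have degree `0`. -/
structure IsAlphabetSimilarity (R : L.Con ⊕ L.Var → L.Con ⊕ L.Var → ℝ) : Prop where
  similarity : IsSimilarity R
  var_var : ∀ X Y : L.Var, X ≠ Y → R (.inr X) (.inr Y) = 0
  con_con : ∀ f g : L.Con, L.conTy f ≠ L.conTy g → R (.inl f) (.inl g) = 0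
  var_con : ∀ (X : L.Var) (f : L.Con), R (.inr X) (.inl f) = 0
  con_var : ∀ (f : L.Con) (X : L.Var), R (.inl f) (.inr X) = 0

/-- The degree of two head symbols. Bound variables count as variables, so that two of them have
degree `1` if they are equal and `0` otherwise. -/
def headSim (R : L.Con ⊕ L.Var → L.Con ⊕ L.Var → ℝ) : Head L → Head L → ℝ
  | .con f, .con g => R (.inl f) (.inl g)
  | .fvar X, .fvar Y => R (.inr X) (.inr Y)
  | .con f, .fvar Y => R (.inl f) (.inr Y)
  | .fvar X, .con g => R (.inr X) (.inl g)
  | .bvar i, .bvar j => if i = j then 1 else 0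
  | _, _ => 0

open Classical in
mutual
/-- The extension of a fuzzy relation from the alphabet to terms. -/
noncomputable def sim (R : L.Con ⊕ L.Var → L.Con ⊕ L.Var → ℝ) : Tm L → Tm L → ℝ
  | .lam A t, .lam B s => if A = B then sim R t s else 0
  | .app h ts, .app k ss => min (headSim R h k) (simList R ts ss)
  | _, _ => 0
/-- The minimum of the degrees of the arguments; `0` if their numbers differ. -/
noncomputable def simList (R : L.Con ⊕ L.Var → L.Con ⊕ L.Var → ℝ) :
    List (Tm L) → List (Tm L) → ℝ
  | [], [] => 1
  | t :: ts, s :: ss => min (sim R t s) (simList R ts ss)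
  | _, _ => 0
end

/-- `σ` is `(R, μ)`-more general than `τ` with variable restriction `V`. -/
def MoreGeneral (R : L.Con ⊕ L.Var → L.Con ⊕ L.Var → ℝ) (μ : ℝ) (V : Set L.Var)
    (σ τ : L.Var → Tm L) : Prop :=
  ∃ ψ : L.Var → Tm L, IsSubst ψ ∧ ∀ X ∈ V, μ ≤ sim R ((σ X).subst ψ) (τ X)

/-- `σ` is an `(R, μ)`-unifier of `t` and `s` with degree `d`. -/
def IsUnifier (R : L.Con ⊕ L.Var → L.Con ⊕ L.Var → ℝ) (μ : ℝ) (t s : Tm L)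
    (σ : L.Var → Tm L) (d : ℝ) : Prop :=
  IsSubst σ ∧ sim R (t.subst σ) (s.subst σ) = d ∧ μ ≤ d

/-- `σ` is a most general `(R, μ)`-unifier of `t` and `s`. -/
def IsMGU (R : L.Con ⊕ L.Var → L.Con ⊕ L.Var → ℝ) (μ : ℝ) (t s : Tm L)
    (σ : L.Var → Tm L) : Prop :=
  (∃ d, IsUnifier R μ t s σ d) ∧
    ∀ ϑ e, IsUnifier R μ t s ϑ e → MoreGeneral R μ (t.fv ∪ s.fv) σ ϑ

/-! ### The unification algorithm -/

/-- A unification equation `lhs ≃? rhs`. The context lists the bound variables whose binders have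
been removed by abstraction steps. -/
structure Eqn (L : Lang.{u, v, w}) where
  ctx : Ctx L
  lhs : Tm L
  rhs : Tm L

/-- Application of a substitution to both sides of an equation. -/
def Eqn.subst (σ : L.Var → Tm L) (e : Eqn L) : Eqn L := ⟨e.ctx, e.lhs.subst σ, e.rhs.subst σ⟩

open Classical in
/-- Application of a substitution to a problem. -/
noncomputable def substProblem (σ : L.Var → Tm L) (P : Finset (Eqn L)) : Finset (Eqn L) :=
  P.image (Eqn.subst σ)

open Classical in
/-- The set of the equations `tᵢ ≃? sᵢ`. -/
noncomputable def zipEqns (Γ : Ctx L) (ts ss : List (Tm L)) : Finset (Eqn L) :=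
  (List.zipWith (fun t s => (⟨Γ, t, s⟩ : Eqn L)) ts ss).toFinset

/-- The head is a constant or one of the bound variables `xs`. -/
def ConOrMem (xs : List ℕ) : Head L → Prop
  | .con _ => True
  | .bvar i => i ∈ xs
  | .fvar _ => False

/-- The head is a free variable. -/
def Head.IsFree : Head L → Prop
  | .fvar _ => True
  | .con _ => False
  | .bvar _ => False

/-- Configurations of the variable elimination procedure: a problem, the substitution computed so
far, and the variables used so far; "fresh" means "not used so far". -/
structure VCfg (L : Lang.{u, v, w}) where
  prob : Finset (Eqn L)
  sub : L.Var → Tm L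
  used : Set L.Var

open Classical in
/-- `VRule P σ U e C`: the selected equation `e`, together with the remaining problem `P`, the
substitution `σ` and the used variables `U`, is transformed into the configuration `C`. -/
inductive VRule (P : Finset (Eqn L)) (σ : L.Var → Tm L) (U : Set L.Var) :
    Eqn L → VCfg L → Prop
  /-- Both sides are abstractions (an argument `sᵢ` of function type in `ve1` gives such an
  equation, since `Hᵢ(x₁, …, xₙ)` is η-expanded): remove the binders. -/
  | abs {Γ : Ctx L} {A : Ty L.Base} {t s : Tm L} :
      VRule P σ U ⟨Γ, .lam A t, .lam A s⟩ ⟨insert ⟨A :: Γ, t, s⟩ P, σ, U⟩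
  /-- `F(x₁, …, xₙ) ≃? a(s₁, …, sₘ)` with `a` a constant or among the `xᵢ`. -/
  | ve1 {Γ : Ctx L} {F : L.Var} {xs : List ℕ} {us : List (Tm L)} {a : Head L}
      {ss : List (Tm L)} {As Bs : List (Ty L.Base)} {b : L.Base} {Hs : List L.Var}
      (hxs : xs.Nodup) (hus : IsBVars Γ xs us) (ha : ConOrMem xs a)
      (hF : L.varTy F = arrs As (.base b)) (haT : headTy Γ a = some (arrs Bs (.base b)))
      (hHs : List.Forall₂ (fun H B => L.varTy H = arrs As B) Hs Bs)
      (hnodup : Hs.Nodup) (hfresh : ∀ H ∈ Hs, H ∉ U) :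
      VRule P σ U ⟨Γ, .app (.fvar F) us, .app a ss⟩
        ⟨zipEqns Γ (List.zipWith (fun H B => etaExp B (.fvar H) us) Hs Bs) ss ∪ P,
          comp σ (single F (absVars As xs
            (.app a (List.zipWith (fun H B => etaExp B (.fvar H) us) Hs Bs)))),
          U ∪ {H | H ∈ Hs}⟩
  /-- `F(x₁, …, xₙ) ≃? G(y₁, …, yₘ)`. -/
  | ve2 {Γ : Ctx L} {F G : L.Var} {xs ys zs : List ℕ} {us vs ws : List (Tm L)}
      {As Bs Cs : List (Ty L.Base)} {b : L.Base} {H : L.Var}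
      (hFG : F ≠ G) (hxs : xs.Nodup) (hus : IsBVars Γ xs us)
      (hys : ys.Nodup) (hvs : IsBVars Γ ys vs)
      (hzs : zs.Nodup) (hws : IsBVars Γ zs ws) (hz : ∀ z, z ∈ zs ↔ z ∈ xs ∧ z ∈ ys)
      (hF : L.varTy F = arrs As (.base b)) (hG : L.varTy G = arrs Bs (.base b))
      (hCs : List.Forall₂ (fun z C => Γ[z]? = some C) zs Cs)
      (hH : L.varTy H = arrs Cs (.base b)) (hfresh : H ∉ U) :
      VRule P σ U ⟨Γ, .app (.fvar F) us, .app (.fvar G) vs⟩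
        ⟨substProblem (pair F (absVars As xs (.app (.fvar H) ws))
            G (absVars Bs ys (.app (.fvar H) ws))) P,
          comp σ (pair F (absVars As xs (.app (.fvar H) ws))
            G (absVars Bs ys (.app (.fvar H) ws))),
          insert H U⟩

open Classical in
/-- One step of variable elimination, on an arbitrarily selected equation. -/
def VStep (C C' : VCfg L) : Prop :=
  ∃ e ∈ C.prob, VRule (C.prob.erase e) C.sub C.used e C'

/-- The initial configuration of a call of variable elimination. -/
def vInit (e : Eqn L) (U : Set L.Var) : VCfg L := ⟨{e}, etaVar, U⟩

/-- `VarElim e U φ U'`: variable elimination, called for the equation `e` when the variables in `U`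
are used, returns `φ`; the variables in `U'` are used afterwards. -/
def VarElim (e : Eqn L) (U : Set L.Var) (φ : L.Var → Tm L) (U' : Set L.Var) : Prop :=
  Relation.ReflTransGen VStep (vInit e U) ⟨∅, φ, U'⟩

/-- The equations `F(x₁, …, xₙ) ≃? a(s₁, …, sₘ)` for which the left-flex rule calls variable
elimination: `F` does not occur on the right, and `a` is a constant, a free variable or among the
`xᵢ`. -/
def CallsVarElim (Γ : Ctx L) (F : L.Var) (us : List (Tm L)) (a : Head L) (ss : List (Tm L)) :
    Prop :=
  ∃ xs : List ℕ, xs.Nodup ∧ IsBVars Γ xs us ∧ F ∉ (Tm.app a ss).fv ∧ (ConOrMem xs a ∨ a.IsFree)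

/-- Configurations of the unification algorithm: a problem, the substitution and the degree
computed so far, and the variables used so far; or failure. -/
inductive Cfg (L : Lang.{u, v, w})
  | run (P : Finset (Eqn L)) (σ : L.Var → Tm L) (d : ℝ) (U : Set L.Var) : Cfg L
  | bot : Cfg L

open Classical in
/-- The rules of the algorithm other than failure. `Rule R μ P σ d U e C`: the selected equation
`e`, with remaining problem `P`, is transformed. -/
inductive Rule (R : L.Con ⊕ L.Var → L.Con ⊕ L.Var → ℝ) (μ : ℝ) (P : Finset (Eqn L))
    (σ : L.Var → Tm L) (d : ℝ) (U : Set L.Var) : Eqn L → Cfg L → Prop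
  /-- Abstraction. -/
  | abs {Γ : Ctx L} {A : Ty L.Base} {t s : Tm L} :
      Rule R μ P σ d U ⟨Γ, .lam A t, .lam A s⟩ (.run (insert ⟨A :: Γ, t, s⟩ P) σ d U)
  /-- Decomposition of `f(t₁, …, tₙ) ≃? g(s₁, …, sₙ)`, where `f`, `g` are constants or bound
  variables. -/
  | dec {Γ : Ctx L} {f g : Head L} {ts ss : List (Tm L)}
      (hf : ¬ f.IsFree) (hg : ¬ g.IsFree) (hlen : ts.length = ss.length)
      (hd : μ ≤ min d (headSim R f g)) :
      Rule R μ P σ d U ⟨Γ, .app f ts, .app g ss⟩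
        (.run (zipEqns Γ ts ss ∪ P) σ (min d (headSim R f g)) U)
  /-- Same variables: `F(x₁, …, xₙ) ≃? F(y₁, …, yₙ)`. -/
  | sv {Γ : Ctx L} {F : L.Var} {xs ys zs : List ℕ} {us vs ws : List (Tm L)}
      {As Cs : List (Ty L.Base)} {b : L.Base} {H : L.Var}
      (hxs : xs.Nodup) (hus : IsBVars Γ xs us) (hys : ys.Nodup) (hvs : IsBVars Γ ys vs)
      (hlen : xs.length = ys.length)
      (hzs : zs.Nodup) (hws : IsBVars Γ zs ws)
      (hz : ∀ z, z ∈ zs ↔ ∃ i : ℕ, xs[i]? = some z ∧ ys[i]? = some z)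
      (hF : L.varTy F = arrs As (.base b))
      (hCs : List.Forall₂ (fun z C => Γ[z]? = some C) zs Cs)
      (hH : L.varTy H = arrs Cs (.base b)) (hfresh : H ∉ U) :
      Rule R μ P σ d U ⟨Γ, .app (.fvar F) us, .app (.fvar F) vs⟩
        (.run (substProblem (single F (absVars As xs (.app (.fvar H) ws))) P)
          (comp σ (single F (absVars As xs (.app (.fvar H) ws)))) d (insert H U))
  /-- Orientation of `a(s₁, …, sₘ) ≃? F(x₁, …, xₙ)`. -/
  | ori {Γ : Ctx L} {F : L.Var} {xs : List ℕ} {us : List (Tm L)} {a : Head L}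
      {ss : List (Tm L)} (hxs : xs.Nodup) (hus : IsBVars Γ xs us) (ha : ConOrMem xs a) :
      Rule R μ P σ d U ⟨Γ, .app a ss, .app (.fvar F) us⟩
        (.run (insert ⟨Γ, .app (.fvar F) us, .app a ss⟩ P) σ d U)
  /-- Left-flex. -/
  | lf {Γ : Ctx L} {F : L.Var} {us : List (Tm L)} {a : Head L} {ss : List (Tm L)}
      {φ : L.Var → Tm L} {U' : Set L.Var}
      (hcall : CallsVarElim Γ F us a ss)
      (hφ : VarElim ⟨Γ, .app (.fvar F) us, .app a ss⟩ U φ U') :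
      Rule R μ P σ d U ⟨Γ, .app (.fvar F) us, .app a ss⟩
        (.run (substProblem (restrict φ ({F} ∪ (Tm.app a ss).fv)) P)
          (comp σ (restrict φ ({F} ∪ (Tm.app a ss).fv))) d U')

open Classical in
/-- One step of the algorithm, on an arbitrarily selected equation: one of the rules, or failure
if none of them applies to the selected equation. -/
inductive Step (R : L.Con ⊕ L.Var → L.Con ⊕ L.Var → ℝ) (μ : ℝ) : Cfg L → Cfg L → Prop
  | rule {P : Finset (Eqn L)} {σ : L.Var → Tm L} {d : ℝ} {U : Set L.Var} {e : Eqn L}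
      {C : Cfg L} (he : e ∈ P) (h : Rule R μ (P.erase e) σ d U e C) :
      Step R μ (.run P σ d U) C
  | fail {P : Finset (Eqn L)} {σ : L.Var → Tm L} {d : ℝ} {U : Set L.Var} {e : Eqn L}
      (he : e ∈ P) (h : ∀ C, ¬ Rule R μ (P.erase e) σ d U e C) :
      Step R μ (.run P σ d U) .bot

/-- The initial configuration for `t` and `s`. The variables in `W` are not available as fresh
variables. -/
def initCfg (W : Set L.Var) (t s : Tm L) : Cfg L := .run {⟨[], t, s⟩} etaVar 1 W

/-- `C` occurs in some run of the algorithm on `t` and `s`. -/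
def Reaches (R : L.Con ⊕ L.Var → L.Con ⊕ L.Var → ℝ) (μ : ℝ) (W : Set L.Var) (t s : Tm L)
    (C : Cfg L) : Prop :=
  Relation.ReflTransGen (Step R μ) (initCfg W t s) C

/-- All runs of the algorithm on `t` and `s` are finite, including the calls of variable
elimination made in them. -/
def Terminates (R : L.Con ⊕ L.Var → L.Con ⊕ L.Var → ℝ) (μ : ℝ) (W : Set L.Var) (t s : Tm L) :
    Prop :=
  Acc (fun C' C => Step R μ C C') (initCfg W t s) ∧
    ∀ P σ d U, Reaches R μ W t s (.run P σ d U) →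
      ∀ Γ F us a ss, (⟨Γ, .app (.fvar F) us, .app a ss⟩ : Eqn L) ∈ P → CallsVarElim Γ F us a ss →
        Acc (fun C' C => VStep C C') (vInit ⟨Γ, .app (.fvar F) us, .app a ss⟩ U)

/-- Some run on `t` and `s` fails. -/
def CanFail (R : L.Con ⊕ L.Var → L.Con ⊕ L.Var → ℝ) (μ : ℝ) (W : Set L.Var) (t s : Tm L) :
    Prop :=
  Reaches R μ W t s .bot

/-- Some run on `t` and `s` succeeds with the computed answer `(σ, d)`. -/
def Computes (R : L.Con ⊕ L.Var → L.Con ⊕ L.Var → ℝ) (μ : ℝ) (W : Set L.Var) (t s : Tm L)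
    (σ : L.Var → Tm L) (d : ℝ) : Prop :=
  ∃ U, Reaches R μ W t s (.run ∅ σ d U)

end HOPU

open HOPU

namespace HOPU

variable {L : Lang.{u, v, w}} {E : L.Con → L.Con → Prop}

/-! ### Lists of terms and induction principles -/

-- Fix a level `l` with `0 < l ≤ 1`. Because `R` is transitive for the minimum, its cut at `l` is a
-- type-respecting equivalence on the constants, and two terms have degree at least `l` exactly when
-- they agree up to exchanging equivalent constants (`conEquiv_cut`, `le_sim_iff`). Graded
-- unification is thus a family of crisp problems, unification modulo an equivalence `E` of
-- constants, and a run of the algorithm is analysed at all levels at once.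
--
-- Patterns keep the crisp problems first-order in spirit. If `F` is applied to distinct bound
-- variables and `σ F = λ… s`, then the normal form of the instance is `s` with its indices renamed
-- (`Tm.subst_flex`). The only fact needed about hereditary substitution is that inserting an
-- η-expanded bound variable is a renaming (`happEta_and_instBVar`). Closure of patterns under
-- pattern substitutions, the composition law `Pat.subst_comp` and the exact description of free
-- variables of instances all follow by looking at the flexible leaves.
--
-- A step is described by two statements. `Tr`: every unifier of the old problem factors, up to `E`
-- on the used variables, through the substitution of the step and a unifier of the new problem.
-- `Snd`: conversely, unifiers of the new problem give unifiers of the old one. Both are proved for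
-- one equation and extended to a whole problem by the frame lemmas. For flexible pairs the unifier
-- itself tells which bound variables its values can contain, and this determines the value of the
-- fresh variable; for a flexible-rigid pair the arguments of the unifier's value are the values of
-- the fresh variables.
--
-- The invariant `RunOk` asserts `Tr` at every level, `Snd` at the levels up to the current degree
-- `d`, and that each level at which the input is unifiable is at most `d`. At the empty problem
-- `Snd` at level `d` shows that the answer unifies with degree at least `d`; the bound on levels,
-- applied to the answer itself, makes the degree exactly `d`, and applied to other unifiers makes
-- it maximal. `Tr` at the degree of a given unifier shows that the answer is more general than it.
--
-- No run fails, since the unifier `τ` is carried along to each reachable problem, and a typed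
-- unifiable pair of patterns always admits a rule (`RunOk.progress`): the occurs check holds by
-- size, the head condition by comparing loose bound variables, and the degree condition because `τ`
-- unifies at a level at least `μ`. Termination uses the lexicographic pair of the number of
-- variables and a weight (`LocalStep.lexWt_lt`). A successful call of variable elimination lowers
-- the number of variables; the other rules do not raise it and lower the weight. Inside variable
-- elimination the weight of the right-hand sides decreases.

theorem Tm.renList_eq_map (ρ : ℕ → ℕ) (ts : List (Tm L)) :
    Tm.renList ρ ts = ts.map (Tm.ren ρ) := by
  induction ts with
  | nil => rfl
  | cons t ts ih => simp [Tm.renList, ih]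

theorem Tm.substList_eq_map (σ : L.Var → Tm L) (ts : List (Tm L)) :
    Tm.substList σ ts = ts.map (Tm.subst σ) := by
  induction ts with
  | nil => rfl
  | cons t ts ih => simp [Tm.substList, ih]

theorem Tm.instListWith_eq_map (ap : Tm L → List (Tm L) → Tm L) (k : ℕ) (v : Tm L)
    (ts : List (Tm L)) : Tm.instListWith ap k v ts = ts.map (Tm.instWith ap k v) := by
  induction ts with
  | nil => rfl
  | cons t ts ih => simp [Tm.instListWith, ih]

theorem Tm.mem_fvList {X : L.Var} {ts : List (Tm L)} :
    X ∈ Tm.fvList ts ↔ ∃ t ∈ ts, X ∈ t.fv := by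
  induction ts with
  | nil => simp [Tm.fvList]
  | cons t ts ih => simp [Tm.fvList, ih]

@[simp] theorem Tm.ren_lam (ρ : ℕ → ℕ) (A : Ty L.Base) (t : Tm L) :
    (Tm.lam A t).ren ρ = .lam A (t.ren (upRen ρ)) := by simp [Tm.ren]

@[simp] theorem Tm.ren_app (ρ : ℕ → ℕ) (h : Head L) (ts : List (Tm L)) :
    (Tm.app h ts).ren ρ = .app (h.ren ρ) (ts.map (Tm.ren ρ)) := by
  simp [Tm.ren, Tm.renList_eq_map]

theorem Tm.induct {P : Tm L → Prop} (lam : ∀ A t, P t → P (.lam A t))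
    (app : ∀ h ts, (∀ t ∈ ts, P t) → P (.app h ts)) (t : Tm L) : P t :=
  Tm.rec (motive_1 := P) (motive_2 := fun ts => ∀ t ∈ ts, P t) lam app (by simp)
    (fun t ts h1 h2 => by simpa using ⟨h1, h2⟩) t

theorem HasTys.forall₂ {Γ : Ctx L} : ∀ {ts : List (Tm L)} {As : List (Ty L.Base)},
    HasTys Γ ts As → List.Forall₂ (HasTy Γ) ts As
  | _, _, .nil => .nil
  | _, _, .cons h hs => .cons h hs.forall₂

theorem HasTys.of_forall₂ {Γ : Ctx L} {ts : List (Tm L)} {As : List (Ty L.Base)}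
    (h : List.Forall₂ (HasTy Γ) ts As) : HasTys Γ ts As := by
  induction h with
  | nil => exact .nil
  | cons h _ ih => exact .cons h ih

/-- Choosing the motive for argument lists to be a `Forall₂` that stores each typing proof with its
induction hypothesis turns the mutual recursor into a principle with a single motive. -/
theorem HasTy.induct {P : ∀ (Γ : Ctx L) (t : Tm L) (A : Ty L.Base), HasTy Γ t A → Prop}
    (lam : ∀ Γ A B t (h : HasTy (A :: Γ) t B), P (A :: Γ) t B h → P Γ (.lam A t) (.arr A B) (.lam h))
    (app : ∀ Γ h ts As b (hh : headTy Γ h = some (arrs As (.base b)))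
      (hs : HasTys Γ ts As), List.Forall₂ (fun t A => ∃ h, P Γ t A h) ts As →
      P Γ (.app h ts) (.base b) (.app hh hs))
    {Γ : Ctx L} {t : Tm L} {A : Ty L.Base} (h : HasTy Γ t A) : P Γ t A h :=
  HasTy.rec (motive_1 := P)
    (motive_2 := fun Γ ts As _ => List.Forall₂ (fun t A => ∃ h, P Γ t A h) ts As)
    (fun h ih => lam _ _ _ _ h ih) (fun h hs ih => app _ _ _ _ _ h hs ih)
    .nil (fun h _ h1 h2 => .cons ⟨h, h1⟩ h2) h

/-! ### Types -/

@[simp] theorem arrs_nil (T : Ty L.Base) : arrs [] T = T := rfl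
@[simp] theorem arrs_cons (A : Ty L.Base) (As : List (Ty L.Base)) (T : Ty L.Base) :
    arrs (A :: As) T = .arr A (arrs As T) := rfl
theorem arrs_append (As Bs : List (Ty L.Base)) (T : Ty L.Base) :
    arrs (As ++ Bs) T = arrs As (arrs Bs T) := by simp [arrs]
@[simp] theorem lams_nil (t : Tm L) : lams [] t = t := rfl
@[simp] theorem lams_cons (A : Ty L.Base) (As : List (Ty L.Base)) (t : Tm L) :
    lams (A :: As) t = .lam A (lams As t) := rfl
theorem lams_append (As Bs : List (Ty L.Base)) (t : Tm L) :
    lams (As ++ Bs) t = lams As (lams Bs t) := by simp [lams]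

theorem arrs_base_inj {As Bs : List (Ty L.Base)} {a b : L.Base}
    (h : arrs As (.base a) = arrs Bs (.base b)) : As = Bs ∧ a = b := by
  induction As generalizing Bs with
  | nil => cases Bs with
    | nil => simpa using h
    | cons B Bs => simp at h
  | cons A As ih => cases Bs with
    | nil => simp at h
    | cons B Bs =>
      simp only [arrs_cons, Ty.arr.injEq] at h
      obtain ⟨rfl, h⟩ := h
      obtain ⟨rfl, rfl⟩ := ih h
      simp

theorem exists_arrs (T : Ty L.Base) : ∃ As b, T = arrs As (.base b) := by
  induction T with
  | base b => exact ⟨[], b, rfl⟩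
  | arr A B _ ih =>
    obtain ⟨As, b, rfl⟩ := ih
    exact ⟨A :: As, b, rfl⟩

theorem HasTy.unique {Γ : Ctx L} {t : Tm L} {A B : Ty L.Base} (h : HasTy Γ t A)
    (h' : HasTy Γ t B) : A = B := by
  induction h using HasTy.induct generalizing B with
  | lam Γ A B t _ ih => cases h' with
    | lam h' => rw [ih h']
  | app Γ h ts As b hh _ _ => cases h' with
    | app h1 h2 =>
      rw [hh, Option.some.injEq] at h1
      rw [(arrs_base_inj h1).2]

/-! ### Renaming -/

theorem upRen_comp (ρ ρ' : ℕ → ℕ) : upRen ρ' ∘ upRen ρ = upRen (ρ' ∘ ρ) := by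
  funext i; cases i <;> rfl

theorem upRen_comp_succ (ρ : ℕ → ℕ) : upRen ρ ∘ Nat.succ = Nat.succ ∘ ρ := by
  funext i; rfl

@[simp] theorem upRen_id : upRen id = id := by
  funext i; cases i <;> rfl

theorem Head.ren_ren (ρ ρ' : ℕ → ℕ) (h : Head L) : (h.ren ρ).ren ρ' = h.ren (ρ' ∘ ρ) := by
  cases h <;> rfl

@[simp] theorem Head.ren_id (h : Head L) : h.ren id = h := by cases h <;> rfl

theorem Tm.ren_ren (t : Tm L) (ρ ρ' : ℕ → ℕ) : (t.ren ρ).ren ρ' = t.ren (ρ' ∘ ρ) := by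
  induction t using Tm.induct generalizing ρ ρ' with
  | lam A t ih => simp [ih, upRen_comp]
  | app h ts ih =>
    simp only [Tm.ren_app, Head.ren_ren, List.map_map, Tm.app.injEq, true_and]
    exact List.map_congr_left fun t ht => ih t ht ρ ρ'

@[simp] theorem Tm.ren_id (t : Tm L) : t.ren id = t := by
  induction t using Tm.induct with
  | lam A t ih => simp [ih]
  | app h ts ih =>
    simp only [Tm.ren_app, Head.ren_id, Tm.app.injEq, true_and]
    exact (List.map_congr_left ih).trans (List.map_id _)

/-- The de Bruijn index `i` is loose in the term. -/
inductive Loose : ℕ → Tm L → Prop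
  | head {i : ℕ} {ts : List (Tm L)} : Loose i (.app (.bvar i) ts)
  | arg {i : ℕ} {h : Head L} {t : Tm L} {ts : List (Tm L)} (ht : t ∈ ts) (hi : Loose i t) :
      Loose i (.app h ts)
  | lam {i : ℕ} {A : Ty L.Base} {t : Tm L} (hi : Loose (i + 1) t) : Loose i (.lam A t)

theorem Loose.ren {i : ℕ} {t : Tm L} (h : Loose i t) (ρ : ℕ → ℕ) : Loose (ρ i) (t.ren ρ) := by
  induction h generalizing ρ with
  | head => simpa [Head.ren] using Loose.head
  | arg ht _ ih => simpa using Loose.arg (List.mem_map_of_mem ht) (ih ρ)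
  | lam _ ih => simpa using Loose.lam (ih (upRen ρ))

theorem Loose.of_ren {i : ℕ} {t : Tm L} {ρ : ℕ → ℕ} (h : Loose i (t.ren ρ)) :
    ∃ j, Loose j t ∧ ρ j = i := by
  induction t using Tm.induct generalizing ρ i with
  | lam A t ih =>
    rw [Tm.ren_lam] at h
    cases h with
    | lam h =>
      obtain ⟨j, hj, e⟩ := ih h
      cases j with
      | zero => simp [upRen] at e
      | succ j => exact ⟨j, .lam hj, by simpa [upRen] using e⟩
  | app h' ts ih =>
    rw [Tm.ren_app] at h
    generalize hh : h'.ren ρ = k at h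
    cases h with
    | head =>
      cases h' <;> simp [Head.ren] at hh
      exact ⟨_, .head, hh⟩
    | arg ht hi =>
      obtain ⟨t, ht', rfl⟩ := List.mem_map.1 ht
      obtain ⟨j, hj, e⟩ := ih t ht' hi
      exact ⟨j, .arg ht' hj, e⟩

/-- Lets identities between renamings be checked only on indices that occur, where typing bounds
them. -/
theorem Tm.ren_congr {t : Tm L} {ρ ρ' : ℕ → ℕ} (h : ∀ i, Loose i t → ρ i = ρ' i) :
    t.ren ρ = t.ren ρ' := by
  induction t using Tm.induct generalizing ρ ρ' with
  | lam A t ih =>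
    simp only [Tm.ren_lam, Tm.lam.injEq, true_and]
    apply ih
    intro i hi
    cases i with
    | zero => rfl
    | succ i => simp [upRen, h i (.lam hi)]
  | app k ts ih =>
    simp only [Tm.ren_app, Tm.app.injEq]
    constructor
    · cases k with
      | bvar i => simp [Head.ren, h i .head]
      | _ => rfl
    · exact List.map_congr_left fun t ht => ih t ht fun i hi => h i (.arg ht hi)

theorem Loose.lt {i : ℕ} {Γ : Ctx L} {t : Tm L} {A : Ty L.Base} (ht : HasTy Γ t A)
    (h : Loose i t) : i < Γ.length := by
  induction ht using HasTy.induct generalizing i with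
  | lam Γ A B t _ ih => cases h with
    | lam h => simpa using ih h
  | app Γ k ts As b hk hts ih => cases h with
    | head =>
      simp only [headTy] at hk
      exact (List.getElem?_eq_some_iff.1 hk).1
    | arg hmem hi =>
      obtain ⟨n, hn, rfl⟩ := List.getElem_of_mem hmem
      exact ((List.forall₂_iff_get.1 ih).2 n hn (by rw [← ih.length_eq]; exact hn)).2 hi

/-- `ρ` respects the types of the bound variables that are loose in `t`. -/
def RenOn (Γ Δ : Ctx L) (ρ : ℕ → ℕ) (t : Tm L) : Prop :=
  ∀ i A, Loose i t → Γ[i]? = some A → Δ[ρ i]? = some A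

theorem RenOn.lam {Γ Δ : Ctx L} {ρ : ℕ → ℕ} {t : Tm L} {A : Ty L.Base}
    (h : RenOn Γ Δ ρ (.lam A t)) : RenOn (A :: Γ) (A :: Δ) (upRen ρ) t := by
  intro i B hi hB
  cases i with
  | zero => simpa [upRen] using hB
  | succ i => simpa [upRen] using h i B (.lam hi) (by simpa using hB)

theorem RenOn.arg {Γ Δ : Ctx L} {ρ : ℕ → ℕ} {h : Head L} {t : Tm L} {ts : List (Tm L)}
    (hr : RenOn Γ Δ ρ (.app h ts)) (ht : t ∈ ts) : RenOn Γ Δ ρ t :=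
  fun i A hi hA => hr i A (.arg ht hi) hA

theorem RenOn.head {Γ Δ : Ctx L} {ρ : ℕ → ℕ} {h : Head L} {ts : List (Tm L)} {A : Ty L.Base}
    (hr : RenOn Γ Δ ρ (.app h ts)) (hh : headTy Γ h = some A) : headTy Δ (h.ren ρ) = some A := by
  cases h with
  | bvar i => exact hr i A .head hh
  | con c => exact hh
  | fvar X => exact hh

theorem forall₂_map_congr {α β γ : Type*} {R : α → β → Prop} {S : γ → β → Prop} {f : α → γ}
    {l : List α} {l' : List β} (h : List.Forall₂ R l l') (hf : ∀ a ∈ l, ∀ b, R a b → S (f a) b) :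
    List.Forall₂ S (l.map f) l' := by
  induction h with
  | nil => exact .nil
  | cons hab _ ih =>
    simp only [List.mem_cons, forall_eq_or_imp] at hf
    exact .cons (hf.1 _ hab) (ih hf.2)

theorem HasTy.ren {Γ Δ : Ctx L} {ρ : ℕ → ℕ} {t : Tm L} {A : Ty L.Base} (ht : HasTy Γ t A)
    (hr : RenOn Γ Δ ρ t) : HasTy Δ (t.ren ρ) A := by
  induction ht using HasTy.induct generalizing Δ ρ with
  | lam Γ A B t _ ih =>
    rw [Tm.ren_lam]
    exact .lam (ih hr.lam)
  | app Γ k ts As b hk hts ih =>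
    rw [Tm.ren_app]
    refine .app (hr.head hk) (.of_forall₂ ?_)
    exact forall₂_map_congr ih fun t ht A h => h.2 (hr.arg ht)

theorem renOn_succ (Γ : Ctx L) (A : Ty L.Base) (t : Tm L) : RenOn Γ (A :: Γ) Nat.succ t :=
  fun i B _ h => by simpa using h

theorem HasTy.weaken {Γ : Ctx L} {t : Tm L} {A : Ty L.Base} (ht : HasTy Γ t A) (B : Ty L.Base) :
    HasTy (B :: Γ) (t.ren Nat.succ) A := ht.ren (renOn_succ Γ B t)

/-! ### η-expansion -/

theorem etaExp_arr (A B : Ty L.Base) (h : Head L) (ts : List (Tm L)) :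
    etaExp (.arr A B) h ts = .lam A (etaExp B (h.ren Nat.succ)
      (ts.map (Tm.ren Nat.succ) ++ [etaExp A (.bvar 0) []])) := by
  simp [etaExp, Tm.renList_eq_map]

@[simp] theorem etaExp_base (b : L.Base) (h : Head L) (ts : List (Tm L)) :
    etaExp (.base b) h ts = .app h ts := by simp [etaExp]

theorem Tm.map_ren_succ_upRen (ts : List (Tm L)) (ρ : ℕ → ℕ) :
    (ts.map (Tm.ren Nat.succ)).map (Tm.ren (upRen ρ)) =
      (ts.map (Tm.ren ρ)).map (Tm.ren Nat.succ) := by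
  simp only [List.map_map]
  exact List.map_congr_left fun t _ => by simp [Tm.ren_ren, upRen_comp_succ]

theorem ren_etaExp (A : Ty L.Base) (h : Head L) (ts : List (Tm L)) (ρ : ℕ → ℕ) :
    (etaExp A h ts).ren ρ = etaExp A (h.ren ρ) (ts.map (Tm.ren ρ)) := by
  induction A generalizing h ts ρ with
  | base b => simp
  | arr A B ihA ihB =>
    simp only [etaExp_arr, Tm.ren_lam, ihB, List.map_append, Tm.map_ren_succ_upRen, Head.ren_ren,
      upRen_comp_succ, List.map_cons, List.map_nil, ihA]
    rfl

theorem hasTy_etaExp {Γ : Ctx L} {A : Ty L.Base} {As : List (Ty L.Base)} {h : Head L}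
    {ts : List (Tm L)} (hh : headTy Γ h = some (arrs As A)) (hts : List.Forall₂ (HasTy Γ) ts As) :
    HasTy Γ (etaExp A h ts) A := by
  induction A generalizing Γ h ts As with
  | base b => simpa using HasTy.app hh (.of_forall₂ hts)
  | arr A B ihA ihB =>
    rw [etaExp_arr]
    refine .lam (ihB (As := As ++ [A]) ?_ ?_)
    · rw [arrs_append]
      cases h with
      | bvar i => simpa [headTy, Head.ren] using hh
      | _ => exact hh
    · refine List.rel_append (forall₂_map_congr hts fun t _ C h => h.weaken A) ?_
      exact .cons (ihA (As := []) (by simp [headTy]) .nil) .nil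

theorem hasTy_etaVar (X : L.Var) : HasTy [] (etaVar X) (L.varTy X) :=
  hasTy_etaExp (As := []) rfl .nil

theorem loose_etaExp {i : ℕ} {A : Ty L.Base} {h : Head L} {ts : List (Tm L)} :
    Loose i (etaExp A h ts) ↔ Loose i (.app h ts) := by
  induction A generalizing i h ts with
  | base b => simp
  | arr A B ihA ihB =>
    rw [etaExp_arr]
    constructor
    · rintro (_ | _ | h')
      rw [ihB] at h'
      generalize hk : h.ren Nat.succ = k at h'
      cases h' with
      | head => cases h <;> simp [Head.ren] at hk; subst hk; exact .head
      | arg ht hi =>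
        simp only [List.mem_append, List.mem_map, List.mem_singleton] at ht
        obtain ⟨t, ht, rfl⟩ | rfl := ht
        · obtain ⟨j, hj, e⟩ := hi.of_ren
          obtain rfl : j = i := by simpa using e
          exact .arg ht hj
        · rw [ihA] at hi
          cases hi with
          | arg h _ => simp at h
    · intro h'
      refine .lam (ihB.2 ?_)
      have := h'.ren Nat.succ
      rw [Tm.ren_app] at this
      generalize hk : h.ren Nat.succ = k at this
      cases this with
      | head => exact .head
      | arg ht hi => exact .arg (List.mem_append_left _ ht) hi

/-! ### Lists of bound variables -/

/-- The η-long forms of the bound variables `xs` of types `As`. -/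
def bvs (xs : List ℕ) (As : List (Ty L.Base)) : List (Tm L) :=
  List.zipWith (fun x A => etaExp A (.bvar x) []) xs As

/-- The bound variables `xs` have the types `As` in the context `Γ`. -/
abbrev BVTys (Γ : Ctx L) (xs : List ℕ) (As : List (Ty L.Base)) : Prop :=
  List.Forall₂ (fun x A => Γ[x]? = some A) xs As

theorem BVTys.hasTys {Γ : Ctx L} {xs : List ℕ} {As : List (Ty L.Base)} (h : BVTys Γ xs As) :
    List.Forall₂ (HasTy Γ) (bvs xs As) As := by
  induction h with
  | nil => exact .nil
  | cons h _ ih => exact .cons (hasTy_etaExp (As := []) h .nil) ih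

theorem BVTys.isBVars {Γ : Ctx L} {xs : List ℕ} {As : List (Ty L.Base)} (h : BVTys Γ xs As) :
    IsBVars Γ xs (bvs xs As) := by
  induction h with
  | nil => exact .nil
  | cons h _ ih => exact .cons ⟨_, h, rfl⟩ ih

theorem IsBVars.exists {Γ : Ctx L} {xs : List ℕ} {us : List (Tm L)} (h : IsBVars Γ xs us) :
    ∃ As, BVTys Γ xs As ∧ us = bvs xs As := by
  induction h with
  | nil => exact ⟨[], .nil, rfl⟩
  | cons h _ ih =>
    obtain ⟨A, hA, rfl⟩ := h
    obtain ⟨As, hAs, rfl⟩ := ih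
    exact ⟨A :: As, .cons hA hAs, rfl⟩

theorem HasTy.forall₂_unique {Γ : Ctx L} {ts : List (Tm L)} {As Bs : List (Ty L.Base)}
    (h : List.Forall₂ (HasTy Γ) ts As) (h' : List.Forall₂ (HasTy Γ) ts Bs) : As = Bs := by
  induction h generalizing Bs with
  | nil => cases h'; rfl
  | cons h _ ih => cases h' with
    | cons h1 h2 => rw [h.unique h1, ih h2]

theorem IsBVars.of_hasTys {Γ : Ctx L} {xs : List ℕ} {us : List (Tm L)} {As : List (Ty L.Base)}
    (h : IsBVars Γ xs us) (h' : List.Forall₂ (HasTy Γ) us As) :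
    BVTys Γ xs As ∧ us = bvs xs As := by
  obtain ⟨Bs, hBs, rfl⟩ := h.exists
  obtain rfl := HasTy.forall₂_unique hBs.hasTys h'
  exact ⟨hBs, rfl⟩

theorem map_ren_bvs (xs : List ℕ) (As : List (Ty L.Base)) (ρ : ℕ → ℕ) :
    (bvs xs As).map (Tm.ren ρ) = bvs (xs.map ρ) As := by
  induction xs generalizing As with
  | nil => rfl
  | cons x xs ih => cases As with
    | nil => rfl
    | cons A As =>
      have := ih As
      simp_all [bvs, ren_etaExp, Head.ren]

theorem bvs_append {xs ys : List ℕ} {As Bs : List (Ty L.Base)} (h : xs.length = As.length) :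
    bvs (xs ++ ys) (As ++ Bs) = bvs xs As ++ bvs ys Bs :=
  List.zipWith_append h

theorem loose_bvs {xs : List ℕ} {As : List (Ty L.Base)} (hl : xs.length = As.length) {i : ℕ} :
    (∃ t ∈ bvs xs As, Loose i t) ↔ i ∈ xs := by
  induction xs generalizing As with
  | nil => simp [bvs]
  | cons x xs ih => cases As with
    | nil => simp at hl
    | cons A As =>
      have := ih (As := As) (by simpa using hl)
      simp only [bvs] at this
      simp only [bvs, List.zipWith_cons_cons, List.mem_cons, exists_eq_or_imp, this]
      rw [loose_etaExp]
      constructor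
      · rintro (h | h)
        · cases h with
          | head => simp
          | arg h _ => simp at h
        · simp [h]
      · rintro (rfl | h)
        · exact .inl .head
        · exact .inr h

-- Free variables under renaming, η-expansion and abstraction.

@[simp] theorem Tm.fv_lam (A : Ty L.Base) (t : Tm L) : (Tm.lam A t).fv = t.fv := by simp [Tm.fv]

theorem Tm.fv_app (h : Head L) (ts : List (Tm L)) :
    (Tm.app h ts).fv = h.fv ∪ {X | ∃ t ∈ ts, X ∈ t.fv} := by
  ext X; simp [Tm.fv, Tm.mem_fvList]

theorem Head.fv_ren (h : Head L) (ρ : ℕ → ℕ) : (h.ren ρ).fv = h.fv := by cases h <;> rfl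

theorem Tm.fv_ren (t : Tm L) (ρ : ℕ → ℕ) : (t.ren ρ).fv = t.fv := by
  induction t using Tm.induct generalizing ρ with
  | lam A t ih => simp [ih]
  | app h ts ih =>
    ext X
    simp only [Tm.ren_app, Tm.fv_app, Head.fv_ren, Set.mem_union, Set.mem_ofPred_eq, List.mem_map,
      exists_exists_and_eq_and]
    refine or_congr_right (exists_congr fun t => and_congr_right fun ht => ?_)
    rw [ih t ht]

theorem Tm.finite_fv (t : Tm L) : t.fv.Finite := by
  induction t using Tm.induct with
  | lam A t ih => simpa
  | app h ts ih =>
    rw [Tm.fv_app]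
    refine Set.Finite.union ?_ ?_
    · cases h <;> simp [Head.fv]
    · have : {X | ∃ t ∈ ts, X ∈ t.fv} = ⋃ t ∈ {t | t ∈ ts}, t.fv := by ext; simp
      rw [this]
      exact (List.finite_toSet ts).biUnion ih

theorem fv_etaExp (A : Ty L.Base) (h : Head L) (ts : List (Tm L)) :
    (etaExp A h ts).fv = (Tm.app h ts).fv := by
  induction A generalizing h ts with
  | base b => simp
  | arr A B ihA ihB =>
    ext X
    simp only [etaExp_arr, Tm.fv_lam, ihB, Tm.fv_app, Head.fv_ren, Set.mem_union, Set.mem_ofPred_eq,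
      List.mem_append, List.mem_map, List.mem_singleton, or_and_right, exists_or,
      exists_exists_and_eq_and, exists_eq_left, Tm.fv_ren, ihA]
    simp [Head.fv]

theorem fv_bvs {xs : List ℕ} {As : List (Ty L.Base)} {t : Tm L} (h : t ∈ bvs xs As) :
    t.fv = ∅ := by
  obtain ⟨i, hi, rfl⟩ := List.getElem_of_mem h
  simp [bvs, fv_etaExp, Tm.fv_app, Head.fv]

theorem fv_flex (F : L.Var) (xs : List ℕ) (As : List (Ty L.Base)) :
    (Tm.app (.fvar F) (bvs xs As)).fv = {F} := by
  rw [Tm.fv_app, Head.fv, Set.union_eq_left]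
  rintro X ⟨t, ht, hX⟩
  simp [fv_bvs ht] at hX

@[simp] theorem fv_lams (As : List (Ty L.Base)) (t : Tm L) : (lams As t).fv = t.fv := by
  induction As with
  | nil => rfl
  | cons A As ih => simp [ih]

@[simp] theorem fv_absVars (As : List (Ty L.Base)) (xs : List ℕ) (t : Tm L) :
    (absVars As xs t).fv = t.fv := by
  simp [absVars, Tm.fv_ren]

@[simp] theorem fv_etaVar (X : L.Var) : (etaVar X).fv = {X} := by
  simp [etaVar, fv_etaExp, Tm.fv_app, Head.fv]

/-! ### Hereditary substitution -/

/-- The effect on the indices `i ≠ k` of the removal of the bound variable `k`. -/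
def decr (k i : ℕ) : ℕ := if k < i then i - 1 else i

theorem Tm.inst_lam (ap : Tm L → List (Tm L) → Tm L) (k : ℕ) (v : Tm L) (A : Ty L.Base)
    (t : Tm L) : Tm.instWith ap k v (.lam A t) = .lam A (Tm.instWith ap (k + 1) (v.ren Nat.succ) t) := by
  simp [Tm.instWith]

theorem Tm.inst_self (ap : Tm L → List (Tm L) → Tm L) (k : ℕ) (v : Tm L) (ts : List (Tm L)) :
    Tm.instWith ap k v (.app (.bvar k) ts) = ap v (ts.map (Tm.instWith ap k v)) := by
  simp [Tm.instWith, Tm.instListWith_eq_map]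

theorem Tm.inst_app (ap : Tm L → List (Tm L) → Tm L) (k : ℕ) (v : Tm L) {h : Head L}
    (hk : h ≠ .bvar k) (ts : List (Tm L)) : Tm.instWith ap k v (.app h ts) =
      .app (h.ren (decr k)) (ts.map (Tm.instWith ap k v)) := by
  cases h with
  | bvar i =>
    have : i ≠ k := fun e => hk (by rw [e])
    simp [Tm.instWith, Tm.instListWith_eq_map, this, Head.ren, decr]
  | _ => simp [Tm.instWith, Tm.instListWith_eq_map, Head.ren]

theorem happ_nil (A : Ty L.Base) (t : Tm L) : happ A t [] = t := by
  cases A <;> simp [happ]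

theorem happ_base (b : L.Base) (t : Tm L) (us : List (Tm L)) : happ (.base b) t us = t := by
  simp [happ]

theorem happ_app (A : Ty L.Base) (h : Head L) (ts us : List (Tm L)) :
    happ A (.app h ts) us = .app h ts := by
  cases A <;> simp [happ]

theorem happ_lam (A B C : Ty L.Base) (t u : Tm L) (us : List (Tm L)) :
    happ (.arr A B) (.lam C t) (u :: us) = happ B (Tm.instWith (happ A) 0 u t) us := by
  simp [happ]

/-- Here `ρ'` acts before the variable is removed and `ρ` afterwards; `hne` is the commuting square
of the two renamings with the index shifts `decr`. It is stated for an arbitrary `ap` commuting with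
renaming, so that the induction on types for `happ` can use it at the argument type. -/
theorem inst_ren {ap : Tm L → List (Tm L) → Tm L}
    (hap : ∀ v us ρ, (ap v us).ren ρ = ap (v.ren ρ) (us.map (Tm.ren ρ)))
    {k k' : ℕ} {ρ ρ' : ℕ → ℕ} (hk : ρ' k = k')
    (hne : ∀ i, i ≠ k → ρ' i ≠ k' ∧ decr k' (ρ' i) = ρ (decr k i)) (v t : Tm L) :
    (Tm.instWith ap k v t).ren ρ = Tm.instWith ap k' (v.ren ρ) (t.ren ρ') := by
  induction t using Tm.induct generalizing k k' ρ ρ' v with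
  | lam A t ih =>
    simp only [Tm.inst_lam, Tm.ren_lam, Tm.lam.injEq, true_and]
    rw [ih (k' := k' + 1) (ρ' := upRen ρ') (by simp [upRen, hk])]
    · simp [Tm.ren_ren, upRen_comp_succ]
    · intro i hi
      cases i with
      | zero => simp [upRen, decr]
      | succ i =>
        obtain ⟨h1, h2⟩ := hne i (by simpa using hi)
        refine ⟨by simpa [upRen] using h1, ?_⟩
        have e : ∀ k j : ℕ, j ≠ k → decr (k + 1) (j + 1) = decr k j + 1 := by
          intro k j hj
          simp only [decr, Nat.add_lt_add_iff_right]
          split <;> omega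
        simp only [upRen, e k i (by simpa using hi), e k' (ρ' i) h1, h2]
  | app h ts ih =>
    have key : (ts.map (Tm.instWith ap k v)).map (Tm.ren ρ) =
        (ts.map (Tm.ren ρ')).map (Tm.instWith ap k' (v.ren ρ)) := by
      simp only [List.map_map]
      exact List.map_congr_left fun t ht => ih t ht hk hne v
    by_cases hh : h = .bvar k
    · subst hh
      rw [Tm.inst_self, hap, Tm.ren_app, Head.ren, hk, Tm.inst_self, key]
    · have hh' : h.ren ρ' ≠ .bvar k' := by
        cases h with
        | bvar i => simpa [Head.ren] using (hne i fun e => hh (by rw [e])).1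
        | _ => simp [Head.ren]
      rw [Tm.inst_app _ _ _ hh, Tm.ren_app, Tm.ren_app, Tm.inst_app _ _ _ hh', key]
      congr 1
      cases h with
      | bvar i => simpa [Head.ren] using (hne i fun e => hh (by rw [e])).2.symm
      | _ => simp [Head.ren]

theorem happ_ren (A : Ty L.Base) (v : Tm L) (us : List (Tm L)) (ρ : ℕ → ℕ) :
    (happ A v us).ren ρ = happ A (v.ren ρ) (us.map (Tm.ren ρ)) := by
  induction A generalizing v us ρ with
  | base b => simp [happ_base]
  | arr A B ihA ihB =>
    cases us with
    | nil => simp [happ_nil]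
    | cons u us => cases v with
      | app h ts => simp [happ_app]
      | lam C t =>
        rw [happ_lam, ihB, Tm.ren_lam, List.map_cons, happ_lam,
          inst_ren ihA (k' := 0) (ρ' := upRen ρ) rfl]
        intro i hi
        obtain ⟨j, rfl⟩ := Nat.exists_eq_succ_of_ne_zero hi
        simp [upRen, decr]

theorem inst_weaken (A : Ty L.Base) (k : ℕ) (v t : Tm L) :
    Tm.instWith (happ A) (k + 1) (v.ren Nat.succ) (t.ren Nat.succ) =
      (Tm.instWith (happ A) k v t).ren Nat.succ := by
  rw [inst_ren (happ_ren A) (k' := k + 1) (ρ' := Nat.succ) rfl]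
  intro i hi
  simp only [decr, Nat.succ_eq_add_one]
  refine ⟨by simpa using hi, ?_⟩
  split <;> split <;> omega

/-- Substitution for a bound variable that does not occur. -/
theorem inst_ren_of_ne (ap : Tm L → List (Tm L) → Tm L) {k : ℕ} {ρ : ℕ → ℕ} (h : ∀ i, ρ i ≠ k)
    (v t : Tm L) : Tm.instWith ap k v (t.ren ρ) = t.ren (decr k ∘ ρ) := by
  induction t using Tm.induct generalizing k ρ v with
  | lam A t ih =>
    rw [Tm.ren_lam, Tm.inst_lam, Tm.ren_lam, ih]
    · congr 2
      funext i
      cases i with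
      | zero => simp [upRen, decr]
      | succ i =>
        have := h i
        simp only [Function.comp, upRen, decr, Nat.add_lt_add_iff_right]
        split <;> omega
    · intro i
      cases i with
      | zero => simp [upRen]
      | succ i => simpa [upRen] using h i
  | app k' ts ih =>
    rw [Tm.ren_app, Tm.inst_app, Tm.ren_app, Head.ren_ren, List.map_map]
    · congr 1
      exact List.map_congr_left fun t ht => ih t ht h v
    · cases k' with
      | bvar i => simpa [Head.ren] using h i
      | _ => simp [Head.ren]

theorem inst_ren_succ (ap : Tm L → List (Tm L) → Tm L) (v t : Tm L) :
    Tm.instWith ap 0 v (t.ren Nat.succ) = t := by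
  rw [inst_ren_of_ne ap (by simp)]
  conv_rhs => rw [← Tm.ren_id t]
  congr 1

/-- As the head is not the instantiated variable, no redex arises, and the variables added by the
expansion are bound inside it. -/
theorem inst_etaExp (A : Ty L.Base) (k : ℕ) (v : Tm L) (B : Ty L.Base) {h : Head L}
    (hk : h ≠ .bvar k) (ts : List (Tm L)) : Tm.instWith (happ A) k v (etaExp B h ts) =
      etaExp B (h.ren (decr k)) (ts.map (Tm.instWith (happ A) k v)) := by
  induction B generalizing k v h ts with
  | base b => simp [Tm.inst_app _ _ _ hk]
  | arr C D ihC ihD =>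
    rw [etaExp_arr, etaExp_arr, Tm.inst_lam, ihD]
    · congr 2
      · cases h with
        | bvar i =>
          have : i ≠ k := fun e => hk (by rw [e])
          simp only [Head.ren, decr, Nat.succ_eq_add_one, Nat.add_lt_add_iff_right]
          congr 1
          split <;> omega
        | _ => rfl
      · rw [List.map_append]
        congr 1
        · simp only [List.map_map]
          exact List.map_congr_left fun t _ => inst_weaken A k v t
        · simp only [List.map_cons, List.map_nil, List.cons.injEq, and_true]
          rw [ihC]
          · simp [Head.ren, decr]
          · simp
    · cases h with
      | bvar i =>
        have : i ≠ k := fun e => hk (by rw [e])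
        simpa [Head.ren] using this
      | _ => simp [Head.ren]

/-- The renaming that instantiates the bound variable `k` by the bound variable `x`. -/
def instRen (k x i : ℕ) : ℕ := if i = k then x else decr k i

theorem upRen_instRen (k x : ℕ) : upRen (instRen k x) = instRen (k + 1) (x + 1) := by
  funext i
  cases i with
  | zero => simp [upRen, instRen, decr]
  | succ i =>
    simp only [upRen, instRen, decr, Nat.add_right_cancel_iff, Nat.add_lt_add_iff_right]
    split
    · rfl
    · split <;> omega

/-- The hereditary substitution of η-expanded bound variables of type `A` is renaming. -/
def InstBVar (A : Ty L.Base) : Prop :=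
  ∀ (Γ Δ : Ctx L) (t : Tm L) (T : Ty L.Base) (k x : ℕ), HasTy Γ t T → Γ[k]? = some A →
    RenOn Γ Δ (instRen k x) t →
      Tm.instWith (happ A) k (etaExp A (.bvar x) []) t = t.ren (instRen k x)

/-- The application of η-expanded terms of type `A`. -/
def HappEta (A : Ty L.Base) : Prop :=
  ∀ (Γ : Ctx L) (As : List (Ty L.Base)) (b : L.Base) (h : Head L) (ts us : List (Tm L)),
    A = arrs As (.base b) → List.Forall₂ (HasTy Γ) us As →
      happ A (etaExp A h ts) us = .app h (ts ++ us)

/-- The only place where more than renaming happens is a subterm headed by `k`; there the η-long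
form of `x` is applied to the renamed arguments, and `HappEta` contracts it to `x` with these
arguments. -/
theorem HappEta.instBVar {A : Ty L.Base} (hA : HappEta A) : InstBVar A := by
  intro Γ Δ t T k x ht
  induction ht using HasTy.induct generalizing Δ k x with
  | lam Γ B C t _ ih =>
    intro hk hr
    have hx := ih (B :: Δ) (k + 1) (x + 1) (by simpa using hk)
      (by rw [← upRen_instRen]; exact hr.lam)
    rw [Tm.inst_lam, ren_etaExp, Tm.ren_lam, upRen_instRen, ← hx]
    rfl
  | app Γ h ts As b hh hts ih =>
    intro hk hr
    have key : ts.map (Tm.instWith (happ A) k (etaExp A (.bvar x) [])) =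
        ts.map (Tm.ren (instRen k x)) := by
      refine List.map_congr_left fun t ht => ?_
      obtain ⟨n, hn, rfl⟩ := List.getElem_of_mem ht
      exact ((List.forall₂_iff_get.1 ih).2 n hn (by rw [← ih.length_eq]; exact hn)).2 Δ k x hk
        (hr.arg ht)
    by_cases hhk : h = .bvar k
    · subst hhk
      have hA' : A = arrs As (.base b) := by
        simpa [headTy, hk] using hh
      rw [Tm.inst_self, key, hA Δ As b (.bvar x) [] _ hA']
      · simp [Head.ren, instRen]
      · exact forall₂_map_congr hts.forall₂ fun t ht B h => h.ren (hr.arg ht)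
    · rw [Tm.inst_app _ _ _ hhk, key, Tm.ren_app]
      congr 1
      cases h with
      | bvar i =>
        have : i ≠ k := fun e => hhk (by rw [e])
        simp [Head.ren, instRen, this]
      | _ => rfl

/-- The renaming that instantiates the last bound variables by the variables in a list, the
outermost one coming first, and renames the others by `ρ`. -/
def listRen : List ℕ → (ℕ → ℕ) → ℕ → ℕ
  | [], ρ => ρ
  | x :: xs, ρ => listRen xs fun | 0 => x | i + 1 => ρ i

theorem listRen_append_singleton (xs : List ℕ) (y : ℕ) (ρ : ℕ → ℕ) :
    listRen (xs ++ [y]) ρ = fun | 0 => y | i + 1 => listRen xs ρ i := by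
  induction xs generalizing ρ with
  | nil => rfl
  | cons x xs ih => exact ih _

theorem listRen_map (xs : List ℕ) (ρ f : ℕ → ℕ) :
    listRen (xs.map f) (f ∘ ρ) = f ∘ listRen xs ρ := by
  induction xs generalizing ρ with
  | nil => rfl
  | cons x xs ih =>
    rw [listRen, ← ih]
    simp only [List.map_cons, listRen]
    congr 1
    funext i
    cases i <;> rfl

theorem upRen_listRen (xs : List ℕ) (ρ : ℕ → ℕ) :
    listRen (xs.map Nat.succ ++ [0]) (Nat.succ ∘ ρ) = upRen (listRen xs ρ) := by
  rw [listRen_append_singleton, listRen_map]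
  funext i
  cases i <;> rfl

theorem renOn_listRen {Γ Δ : Ctx L} {xs : List ℕ} {As : List (Ty L.Base)} {ρ : ℕ → ℕ}
    (hx : BVTys Δ xs As) (hr : ∀ i A, Γ[i]? = some A → Δ[ρ i]? = some A) (i : ℕ) (A : Ty L.Base) :
    (As.reverse ++ Γ)[i]? = some A → Δ[listRen xs ρ i]? = some A := by
  induction hx generalizing Γ ρ i A with
  | nil => exact hr i A
  | @cons x B xs As hxB _ ih =>
    simp only [List.reverse_cons, List.append_assoc, List.singleton_append, listRen]
    apply ih
    intro j C hj
    cases j with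
    | zero =>
      simp only [List.getElem?_cons_zero, Option.some.injEq] at hj
      rw [← hj, hxB]
    | succ j => exact hr j C (by simpa using hj)

/-- Application of an abstraction to bound variables is renaming. -/
theorem happ_lams_of_instBVar {Γ Δ : Ctx L} {As : List (Ty L.Base)} {T : Ty L.Base} {t : Tm L}
    {xs : List ℕ} {ρ : ℕ → ℕ} (hA : ∀ A ∈ As, InstBVar A) (ht : HasTy Γ (lams As t) (arrs As T))
    (hx : BVTys Δ xs As) (hr : ∀ i A, Γ[i]? = some A → Δ[ρ i]? = some A) :
    happ (arrs As T) ((lams As t).ren ρ) (bvs xs As) = t.ren (listRen xs ρ) := by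
  induction hx generalizing Γ ρ with
  | nil => simp [bvs, happ_nil, listRen]
  | @cons x A xs As hxA hx ih =>
    cases ht with
    | lam ht =>
    have ht : HasTy (A :: Γ) (lams As t) (arrs As T) := ht
    have hlr : ∀ i B, (A :: Γ)[i]? = some B →
        Δ[(fun | 0 => x | i + 1 => ρ i : ℕ → ℕ) i]? = some B := by
      intro i B hi
      cases i with
      | zero =>
        simp only [List.getElem?_cons_zero, Option.some.injEq] at hi
        rw [← hi]
        exact hxA
      | succ i => exact hr i B (by simpa using hi)
    -- Contracting the outermost binder with `x` absorbs `x` into the renaming, which is one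
    -- unfolding of `listRen`.
    have e : instRen 0 x ∘ upRen ρ = fun | 0 => x | i + 1 => ρ i := by
      funext i
      cases i <;> simp [instRen, upRen, decr]
    rw [listRen, ← ih (fun B hB => hA B (List.mem_cons_of_mem _ hB)) ht hlr, lams_cons, Tm.ren_lam]
    simp only [bvs, List.zipWith_cons_cons, arrs_cons]
    rw [happ_lam, ← e, ← Tm.ren_ren,
      hA A List.mem_cons_self (A :: Δ) Δ _ (arrs As T) 0 x (ht.ren ?_) (by simp) ?_]
    · intro i B _ hi
      cases i with
      | zero => simpa [upRen] using hi
      | succ i => simpa [upRen] using hr i B (by simpa using hi)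
    · intro i B _ hi
      cases i with
      | zero =>
        simp only [List.getElem?_cons_zero, Option.some.injEq] at hi
        simpa [instRen, ← hi] using hxA
      | succ i => simpa [instRen, decr] using hi

-- Abstractions and η-laws for hereditary substitution.

theorem HasTy.exists_lams {Γ : Ctx L} {As : List (Ty L.Base)} {T : Ty L.Base} {t : Tm L}
    (h : HasTy Γ t (arrs As T)) : ∃ s, t = lams As s ∧ HasTy (As.reverse ++ Γ) s T := by
  induction As generalizing Γ t with
  | nil => exact ⟨t, rfl, h⟩
  | cons A As ih =>
    cases h with
    | lam h =>
      obtain ⟨s, rfl, hs⟩ := ih h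
      exact ⟨s, rfl, by simpa using hs⟩

theorem HasTy.lams {Γ : Ctx L} {As : List (Ty L.Base)} {T : Ty L.Base} {s : Tm L}
    (h : HasTy (As.reverse ++ Γ) s T) : HasTy Γ (lams As s) (arrs As T) := by
  induction As generalizing Γ with
  | nil => exact h
  | cons A As ih => exact .lam (ih (by simpa using h))

/-- An η-long `v` of this type starts with one binder more than there are variables in `xs`. Both
sides are therefore renamings of the same body; on the right the extra binder is opened by the new
variable `0`. -/
theorem happ_eta_of_instBVar {Γ Δ : Ctx L} {As : List (Ty L.Base)} {C D : Ty L.Base} {v : Tm L}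
    {xs : List ℕ} {ρ : ℕ → ℕ} (hA : ∀ A ∈ As ++ [C], InstBVar A)
    (hv : HasTy Γ v (arrs As (.arr C D)))
    (hx : BVTys Δ xs As) (hr : ∀ i A, Γ[i]? = some A → Δ[ρ i]? = some A) :
    happ (arrs As (.arr C D)) (v.ren ρ) (bvs xs As) =
      .lam C (happ (arrs As (.arr C D)) ((v.ren ρ).ren Nat.succ)
        (bvs (xs.map Nat.succ ++ [0]) (As ++ [C]))) := by
  obtain ⟨s, rfl, hs⟩ := hv.exists_lams
  have hx' : BVTys (C :: Δ) (xs.map Nat.succ ++ [0]) (As ++ [C]) :=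
    List.rel_append (forall₂_map_congr hx fun x _ A h => by simpa using h)
      (.cons (by simp) .nil)
  have hv' := hv
  cases hs with
  | @lam _ _ _ t ht =>
    have e : lams As (Tm.lam C t) = lams (As ++ [C]) t := by simp [lams_append]
    have e' : arrs As (.arr C D) = arrs (As ++ [C]) D := by simp [arrs_append]
    rw [happ_lams_of_instBVar (fun A h => hA A (by simp [h])) hv hx hr, e, e', Tm.ren_ren,
      happ_lams_of_instBVar hA (e ▸ e' ▸ hv) hx', upRen_listRen, Tm.ren_lam]
    · intro i A hi
      simpa using hr i A hi

/-- The goal is that the η-expansion of a variable instantiates to the term put for it. The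
induction is on the remaining type `T`, with the already supplied arguments `xs` generalized; each
arrow is crossed by the η-law `happ_eta_of_instBVar`. -/
theorem inst_etaExp_self_of_instBVar {Γ : Ctx L} {A T : Ty L.Base} {As : List (Ty L.Base)}
    {v : Tm L} {xs : List ℕ} {k : ℕ} {ts : List (Tm L)}
    (hA : ∀ Bs U, A = arrs Bs U → ∀ B ∈ Bs, InstBVar B) (hT : A = arrs As T) (hv : HasTy Γ v A)
    (hx : BVTys Γ xs As) (hts : ts.map (Tm.instWith (happ A) k v) = bvs xs As) :
    Tm.instWith (happ A) k v (etaExp T (.bvar k) ts) = happ A v (bvs xs As) := by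
  induction T generalizing Γ As v xs k ts with
  | base b => rw [etaExp_base, Tm.inst_self, hts]
  | arr C D _ ihD =>
    have hx' : BVTys (C :: Γ) (xs.map Nat.succ ++ [0]) (As ++ [C]) :=
      List.rel_append (forall₂_map_congr hx fun x _ A h => by simpa using h)
        (.cons (by simp) .nil)
    have e : A = arrs (As ++ [C]) D := by rw [hT, arrs_append]; rfl
    have heta := happ_eta_of_instBVar (hA _ _ e) (hT ▸ hv) hx (ρ := id) (by simp)
    rw [Tm.ren_id, ← hT] at heta
    rw [heta, etaExp_arr, Tm.inst_lam, Head.ren, Nat.succ_eq_add_one,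
      ihD e (hv.weaken C) hx' ?_]
    have h0 : Tm.instWith (happ A) (k + 1) (v.ren Nat.succ) (etaExp C (.bvar 0) []) =
        etaExp C (.bvar 0) [] := by
      rw [inst_etaExp _ _ _ _ (by simp)]
      simp [Head.ren, decr]
    have hl : (xs.map Nat.succ).length = As.length := by simpa using hx.length_eq
    rw [List.map_append, List.map_map, bvs_append hl, ← map_ren_bvs, ← hts, List.map_map]
    congr 1
    · exact List.map_congr_left fun t _ => inst_weaken A k v t
    · simp [h0, bvs]

theorem inst_etaExp_self_of_instBVar' {Γ : Ctx L} {A : Ty L.Base} {v : Tm L}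
    (hA : ∀ Bs U, A = arrs Bs U → ∀ B ∈ Bs, InstBVar B) (hv : HasTy Γ v A) :
    Tm.instWith (happ A) 0 v (etaExp A (.bvar 0) []) = v := by
  rw [inst_etaExp_self_of_instBVar (As := []) (xs := []) hA rfl hv .nil rfl]
  exact happ_nil _ _

/-- One β-step replaces the last argument, the η-expansion of the new bound variable, by `u`; the
rest is application at type `B`. -/
theorem HappEta.arr {A B : Ty L.Base} (hA : ∀ Bs U, A = arrs Bs U → ∀ B ∈ Bs, InstBVar B)
    (hB : HappEta B) : HappEta (.arr A B) := by
  intro Γ As b h ts us e hus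
  cases hus with
  | nil => simp at e
  | @cons u _ us As hu hus =>
    simp only [arrs_cons, Ty.arr.injEq] at e
    obtain ⟨rfl, e⟩ := e
    have h0 : h.ren Nat.succ ≠ .bvar 0 := by cases h <;> simp [Head.ren]
    have h1 : (h.ren Nat.succ).ren (decr 0) = h := by
      rw [Head.ren_ren]
      cases h <;> simp [Head.ren, decr]
    have h2 : (ts.map (Tm.ren Nat.succ)).map (Tm.instWith (happ A) 0 u) = ts := by
      rw [List.map_map]
      exact (List.map_congr_left fun t _ => inst_ren_succ _ u t).trans (List.map_id _)
    rw [etaExp_arr, happ_lam, inst_etaExp _ _ _ _ h0, h1, List.map_append, h2, List.map_singleton,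
      inst_etaExp_self_of_instBVar' hA hu, hB Γ As b _ _ us e hus]
    simp

/-- `HappEta` at `A → B` needs `HappEta` at `B` and `InstBVar` at the argument types of `A`, not at
`A` itself. Carrying the argument types as a second component closes the induction on types. -/
theorem happEta_and_instBVar (A : Ty L.Base) :
    HappEta A ∧ ∀ Bs U, A = arrs Bs U → ∀ B ∈ Bs, InstBVar B := by
  induction A with
  | base b =>
    constructor
    · intro Γ As b' h ts us e hus
      cases As with
      | nil => cases hus; simp [happ_nil]
      | cons A As => simp at e
    · intro Bs U e B hB
      cases Bs with
      | nil => simp at hB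
      | cons A As => simp at e
  | arr A B ihA ihB =>
    refine ⟨ihB.1.arr ihA.2, ?_⟩
    intro Bs U e C hC
    cases Bs with
    | nil => simp at hC
    | cons A' Bs =>
      simp only [arrs_cons, Ty.arr.injEq] at e
      obtain ⟨rfl, e⟩ := e
      rcases List.mem_cons.1 hC with rfl | hC
      · exact ihA.1.instBVar
      · exact ihB.2 Bs U e C hC

theorem instBVar (A : Ty L.Base) : InstBVar A := (happEta_and_instBVar A).1.instBVar

theorem happ_etaExp {Γ : Ctx L} {As : List (Ty L.Base)} {b : L.Base} (h : Head L)
    {us : List (Tm L)} (hus : List.Forall₂ (HasTy Γ) us As) :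
    happ (arrs As (.base b)) (etaExp (arrs As (.base b)) h []) us = .app h us :=
  (happEta_and_instBVar _).1 Γ As b h [] us rfl hus

/-- Application of a closed abstraction to bound variables is renaming. -/
theorem happ_lams {Δ : Ctx L} {As : List (Ty L.Base)} {T : Ty L.Base} {t : Tm L}
    {xs : List ℕ} (ht : HasTy [] (lams As t) (arrs As T)) (hx : BVTys Δ xs As) :
    happ (arrs As T) (lams As t) (bvs xs As) = t.ren (listRen xs id) := by
  have := happ_lams_of_instBVar (fun A _ => instBVar A) ht hx (ρ := id) (by simp)
  rwa [Tm.ren_id] at this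

/-- The head of the list instantiates the outermost binder, which has the largest de Bruijn index,
so index `i` is counted from the end. -/
theorem listRen_of_lt {xs : List ℕ} {ρ : ℕ → ℕ} {i : ℕ} (hi : i < xs.length) :
    xs[xs.length - 1 - i]? = some (listRen xs ρ i) := by
  induction xs using List.reverseRecOn generalizing i with
  | nil => simp at hi
  | append_singleton xs x ih =>
    rw [listRen_append_singleton]
    cases i with
    | zero => simp
    | succ i =>
      simp only [List.length_append, List.length_singleton, Nat.add_lt_add_iff_right] at hi
      have e : (xs ++ [x]).length - 1 - (i + 1) = xs.length - 1 - i := by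
        simp; omega
      rw [e, List.getElem?_append_left (by omega), ih hi]

theorem listRen_congr {xs : List ℕ} {ρ ρ' : ℕ → ℕ} {i : ℕ} (hi : i < xs.length) :
    listRen xs ρ i = listRen xs ρ' i :=
  Option.some_injective _ ((listRen_of_lt hi).symm.trans (listRen_of_lt hi))

theorem lams_inj {As : List (Ty L.Base)} {s t : Tm L} : lams As s = lams As t ↔ s = t := by
  induction As with
  | nil => rfl
  | cons A As ih => simp [ih]

/-! ### Application of substitutions -/

@[simp] theorem Tm.subst_lam (σ : L.Var → Tm L) (A : Ty L.Base) (t : Tm L) :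
    (Tm.lam A t).subst σ = .lam A (t.subst σ) := by simp [Tm.subst]

theorem Tm.subst_app (σ : L.Var → Tm L) {h : Head L} (hh : ¬ h.IsFree) (ts : List (Tm L)) :
    (Tm.app h ts).subst σ = .app h (ts.map (Tm.subst σ)) := by
  cases h <;> simp_all [Tm.subst, Tm.substList_eq_map, Head.IsFree]

theorem Tm.subst_fvar (σ : L.Var → Tm L) (X : L.Var) (ts : List (Tm L)) :
    (Tm.app (.fvar X) ts).subst σ = happ (L.varTy X) (σ X) (ts.map (Tm.subst σ)) := by
  simp [Tm.subst, Tm.substList_eq_map]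

theorem Tm.subst_congr {t : Tm L} {σ σ' : L.Var → Tm L} (h : ∀ X ∈ t.fv, σ X = σ' X) :
    t.subst σ = t.subst σ' := by
  induction t using Tm.induct with
  | lam A t ih => simpa using ih (by simpa using h)
  | app k ts ih =>
    have key : ts.map (Tm.subst σ) = ts.map (Tm.subst σ') :=
      List.map_congr_left fun t ht => ih t ht fun X hX => h X (by
        rw [Tm.fv_app]
        exact .inr ⟨t, ht, hX⟩)
    cases k with
    | fvar X =>
      rw [Tm.subst_fvar, Tm.subst_fvar, key, h X (by rw [Tm.fv_app]; exact .inl rfl)]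
    | _ => rw [Tm.subst_app _ (by simp [Head.IsFree]), Tm.subst_app _ (by simp [Head.IsFree]), key]

theorem Tm.subst_of_fv_eq_empty {t : Tm L} (h : t.fv = ∅) (σ : L.Var → Tm L) :
    t.subst σ = t := by
  induction t using Tm.induct with
  | lam A t ih => simpa using ih (by simpa using h)
  | app k ts ih =>
    rw [Tm.fv_app, Set.union_empty_iff] at h
    have hk : ¬ k.IsFree := by
      cases k <;> simp_all [Head.fv, Head.IsFree]
    rw [Tm.subst_app _ hk]
    congr 1
    refine (List.map_congr_left fun t ht => ih t ht ?_).trans (List.map_id _)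
    refine Set.eq_empty_of_forall_notMem fun X hX => ?_
    have : X ∈ {X | ∃ t ∈ ts, X ∈ t.fv} := ⟨t, ht, hX⟩
    simp [h.2] at this

theorem map_subst_bvs (xs : List ℕ) (As : List (Ty L.Base)) (σ : L.Var → Tm L) :
    (bvs xs As).map (Tm.subst σ) = bvs xs As :=
  (List.map_congr_left fun _ ht => Tm.subst_of_fv_eq_empty (fv_bvs ht) σ).trans (List.map_id _)

/-- The identity substitution inserts η-long variables as heads, and applying these to the arguments
contracts by `happ_etaExp`. -/
theorem HasTy.subst_etaVar {Γ : Ctx L} {t : Tm L} {A : Ty L.Base} (ht : HasTy Γ t A) :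
    t.subst etaVar = t := by
  induction ht using HasTy.induct with
  | lam Γ A B t _ ih => simp [ih]
  | app Γ h ts As b hh hts ih =>
    have key : ts.map (Tm.subst etaVar) = ts := by
      refine (List.map_congr_left fun t ht => ?_).trans (List.map_id _)
      obtain ⟨n, hn, rfl⟩ := List.getElem_of_mem ht
      exact ((List.forall₂_iff_get.1 ih).2 n hn (by rw [← ih.length_eq]; exact hn)).2
    cases h with
    | fvar X =>
      simp only [headTy, Option.some.injEq] at hh
      rw [Tm.subst_fvar, key, etaVar, hh, happ_etaExp _ hts.forall₂]
    | _ => rw [Tm.subst_app _ (by simp [Head.IsFree]), key]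

/-- Type-preserving maps from variables to closed terms. -/
def TySub (σ : L.Var → Tm L) : Prop := ∀ X, HasTy [] (σ X) (L.varTy X)

theorem tySub_etaVar : TySub (etaVar (L := L)) := hasTy_etaVar

/-- β-reduction of an abstraction against bound variables only renames them. Result types `T` that
are not basic are included because variable elimination produces η-expanded flexible terms; each
arrow of `T` adds one bound variable to the argument list. -/
theorem Tm.subst_flex {Δ : Ctx L} {σ : L.Var → Tm L} (hσ : TySub σ) {F : L.Var} {xs : List ℕ}
    {As : List (Ty L.Base)} {T : Ty L.Base} {s : Tm L} (hF : L.varTy F = arrs As T)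
    (hx : BVTys Δ xs As) (hs : σ F = lams As s) :
    (etaExp T (.fvar F) (bvs xs As)).subst σ = s.ren (listRen xs id) := by
  induction T generalizing Δ xs As s with
  | base b =>
    have hty := hσ F
    rw [hs, hF] at hty
    rw [etaExp_base, Tm.subst_fvar, map_subst_bvs, hF, hs, happ_lams hty hx]
  | arr C D _ ihD =>
    have hx' : BVTys (C :: Δ) (xs.map Nat.succ ++ [0]) (As ++ [C]) :=
      List.rel_append (forall₂_map_congr hx fun x _ A h => by simpa using h)
        (.cons (by simp) .nil)
    have hty := hσ F
    rw [hF] at hty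
    obtain ⟨s', hs', hty'⟩ := hty.exists_lams
    obtain rfl : s = s' := lams_inj.1 (hs.symm.trans hs')
    cases hty' with
    | @lam _ _ _ t ht =>
      have e : lams As (Tm.lam C t) = lams (As ++ [C]) t := by simp [lams_append]
      have hl : (xs.map Nat.succ).length = As.length := by simpa using hx.length_eq
      have hb : bvs (L := L) [0] [C] = [etaExp C (.bvar 0) []] := rfl
      have := ihD (As := As ++ [C]) (by rw [hF, arrs_append]; rfl) hx' (hs.trans e)
      rw [bvs_append hl, ← map_ren_bvs, hb] at this
      rw [etaExp_arr, Tm.subst_lam, Head.ren, this, Tm.ren_lam, ← upRen_listRen]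
      congr 1
      -- The body is typed in the context of its own binders, so the two base renamings `id` and
      -- `Nat.succ ∘ id` are never consulted.
      refine Tm.ren_congr fun i hi => listRen_congr ?_
      have := hi.lt ht
      simpa [hx.length_eq] using this

theorem etaVar_subst {σ : L.Var → Tm L} (hσ : TySub σ) (X : L.Var) :
    (etaVar X).subst σ = σ X := by
  have := Tm.subst_flex hσ (F := X) (xs := []) (As := []) (Δ := []) rfl .nil rfl
  rw [listRen, Tm.ren_id] at this
  exact this

theorem TySub.exists_lams {σ : L.Var → Tm L} (hσ : TySub σ) {F : L.Var} {As : List (Ty L.Base)}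
    {T : Ty L.Base} (hF : L.varTy F = arrs As T) :
    ∃ s, σ F = lams As s ∧ HasTy As.reverse s T := by
  have hty := hσ F
  rw [hF] at hty
  obtain ⟨s, hs, h⟩ := hty.exists_lams
  exact ⟨s, hs, by simpa using h⟩

/-! ### Renamings that instantiate lists of bound variables -/

theorem listRen_mem {xs : List ℕ} {ρ : ℕ → ℕ} {i : ℕ} (hi : i < xs.length) :
    listRen xs ρ i ∈ xs := List.mem_of_getElem? (listRen_of_lt hi)

/-- `absVars` sends a variable to the complement of its position, and `listRen` sends that index
back. Together with `idxOf_listRen` this makes abstraction over `xs` and application to `xs`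
mutually inverse, the second direction requiring distinct variables. -/
theorem listRen_idxOf {xs : List ℕ} {ρ : ℕ → ℕ} {x : ℕ} (hx : x ∈ xs) :
    listRen xs ρ (xs.length - 1 - xs.idxOf x) = x := by
  have hi := List.idxOf_lt_length_of_mem hx
  have := listRen_of_lt (xs := xs) (ρ := ρ) (i := xs.length - 1 - xs.idxOf x) (by omega)
  rw [show xs.length - 1 - (xs.length - 1 - xs.idxOf x) = xs.idxOf x by omega,
    List.getElem?_eq_getElem hi] at this
  simpa using this.symm

theorem idxOf_listRen {xs : List ℕ} (hn : xs.Nodup) {ρ : ℕ → ℕ} {i : ℕ} (hi : i < xs.length) :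
    xs.length - 1 - xs.idxOf (listRen xs ρ i) = i := by
  obtain ⟨h, e⟩ := List.getElem?_eq_some_iff.1 (listRen_of_lt (ρ := ρ) hi)
  rw [← e, hn.idxOf_getElem]
  omega

theorem listRen_inj {xs : List ℕ} (hn : xs.Nodup) {ρ : ℕ → ℕ} {i j : ℕ} (hi : i < xs.length)
    (hj : j < xs.length) (h : listRen xs ρ i = listRen xs ρ j) : i = j := by
  rw [← idxOf_listRen hn hi, h, idxOf_listRen hn hj]

theorem ren_idxOf_listRen {As : List (Ty L.Base)} {xs : List ℕ} {t : Tm L}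
    (hl : xs.length = As.length) (ht : ∀ i, Loose i t → i ∈ xs) :
    (t.ren fun x => As.length - 1 - xs.idxOf x).ren (listRen xs id) = t := by
  rw [Tm.ren_ren]
  conv_rhs => rw [← Tm.ren_id t]
  refine Tm.ren_congr fun i hi => ?_
  simpa [← hl] using listRen_idxOf (ht i hi)

theorem ren_listRen_idxOf {As : List (Ty L.Base)} {xs : List ℕ} {t : Tm L}
    (hl : xs.length = As.length) (hn : xs.Nodup) (ht : ∀ i, Loose i t → i < xs.length) :
    (t.ren (listRen xs id)).ren (fun x => As.length - 1 - xs.idxOf x) = t := by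
  rw [Tm.ren_ren]
  conv_rhs => rw [← Tm.ren_id t]
  refine Tm.ren_congr fun i hi => ?_
  simpa [← hl] using idxOf_listRen hn (ht i hi)

theorem renOn_idxOf {Γ : Ctx L} {As : List (Ty L.Base)} {xs : List ℕ} {t : Tm L}
    (hx : BVTys Γ xs As) (ht : ∀ i, Loose i t → i ∈ xs) :
    RenOn Γ As.reverse (fun x => As.length - 1 - xs.idxOf x) t := by
  intro i A hi hA
  have hlt := List.idxOf_lt_length_of_mem (ht i hi)
  have hlt' : xs.idxOf i < As.length := by rw [← hx.length_eq]; exact hlt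
  have := (List.forall₂_iff_get.1 hx).2 _ hlt hlt'
  simp only [List.get_eq_getElem, List.getElem_idxOf, hA, Option.some.injEq] at this
  dsimp only
  rw [List.getElem?_reverse (by omega),
    show As.length - 1 - (As.length - 1 - xs.idxOf i) = xs.idxOf i by omega,
    List.getElem?_eq_getElem hlt', this]

theorem HasTy.absVars {Γ : Ctx L} {As : List (Ty L.Base)} {T : Ty L.Base} {xs : List ℕ} {t : Tm L}
    (h : HasTy Γ t T) (hx : BVTys Γ xs As) (ht : ∀ i, Loose i t → i ∈ xs) :
    HasTy [] (absVars As xs t) (arrs As T) :=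
  HasTy.lams (by simpa using h.ren (renOn_idxOf hx ht))

/-! ### Typed patterns -/

/-- Typed higher-order patterns. -/
inductive Pat : Ctx L → Tm L → Ty L.Base → Prop
  | lam {Γ : Ctx L} {A B : Ty L.Base} {t : Tm L} (h : Pat (A :: Γ) t B) :
      Pat Γ (.lam A t) (.arr A B)
  | flex {Γ : Ctx L} {F : L.Var} {xs : List ℕ} {As : List (Ty L.Base)} {b : L.Base}
      (hn : xs.Nodup) (hx : BVTys Γ xs As) (hF : L.varTy F = arrs As (.base b)) :
      Pat Γ (.app (.fvar F) (bvs xs As)) (.base b)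
  | app {Γ : Ctx L} {h : Head L} {ts : List (Tm L)} {As : List (Ty L.Base)} {b : L.Base}
      (hh : ¬ h.IsFree) (hT : headTy Γ h = some (arrs As (.base b))) (hl : ts.length = As.length)
      (hts : ∀ {t A}, (t, A) ∈ ts.zip As → Pat Γ t A) : Pat Γ (.app h ts) (.base b)

/-- The constructor `Pat.app` speaks of members of a zip, so that `Pat` is not a nested inductive;
this lemma and `Pat.induct` recover the form with `Forall₂`. -/
theorem Pat.rigid {Γ : Ctx L} {h : Head L} {ts : List (Tm L)} {As : List (Ty L.Base)} {b : L.Base}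
    (hh : ¬ h.IsFree) (hT : headTy Γ h = some (arrs As (.base b)))
    (hts : List.Forall₂ (Pat Γ) ts As) : Pat Γ (.app h ts) (.base b) :=
  .app hh hT hts.length_eq (List.forall₂_iff_zip.1 hts).2

theorem Pat.induct {P : ∀ (Γ : Ctx L) (t : Tm L) (A : Ty L.Base), Pat Γ t A → Prop}
    (lam : ∀ Γ A B t (h : Pat (A :: Γ) t B), P (A :: Γ) t B h → P Γ (.lam A t) (.arr A B) (.lam h))
    (flex : ∀ Γ F xs As b (hn : xs.Nodup) (hx : BVTys Γ xs As)
      (hF : L.varTy F = arrs As (.base b)),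
      P Γ (.app (.fvar F) (bvs xs As)) (.base b) (.flex hn hx hF))
    (rigid : ∀ Γ h ts As b (hh : ¬ h.IsFree) (hT : headTy Γ h = some (arrs As (.base b)))
      (hs : List.Forall₂ (Pat Γ) ts As), List.Forall₂ (fun t A => ∃ h, P Γ t A h) ts As →
      P Γ (.app h ts) (.base b) (.rigid hh hT hs))
    {Γ : Ctx L} {t : Tm L} {A : Ty L.Base} (h : Pat Γ t A) : P Γ t A h :=
  Pat.rec (motive := P) (fun h ih => lam _ _ _ _ h ih)
    (fun hn hx hF => flex _ _ _ _ _ hn hx hF)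
    (fun hh hT hl hs ih => rigid _ _ _ _ _ hh hT (List.forall₂_iff_zip.2 ⟨hl, hs⟩)
      (List.forall₂_iff_zip.2 ⟨hl, fun h => ⟨hs h, ih h⟩⟩)) h

theorem Pat.hasTy {Γ : Ctx L} {t : Tm L} {A : Ty L.Base} (h : Pat Γ t A) : HasTy Γ t A := by
  induction h using Pat.induct with
  | lam Γ A B t _ ih => exact .lam ih
  | flex Γ F xs As b hn hx hF => exact .app (by rw [headTy, hF]) (.of_forall₂ hx.hasTys)
  | rigid Γ h ts As b hh hT hs ih => exact .app hT (.of_forall₂ (ih.imp fun _ _ h => h.2))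

theorem isPatternList_iff {Γ : Ctx L} {ts : List (Tm L)} :
    IsPatternList Γ ts ↔ ∀ t ∈ ts, IsPattern Γ t := by
  induction ts with
  | nil => simp [IsPatternList]
  | cons t ts ih => simp [IsPatternList, ih]

theorem isPattern_lam {Γ : Ctx L} {A : Ty L.Base} {t : Tm L} :
    IsPattern Γ (.lam A t) ↔ IsPattern (A :: Γ) t := by simp [IsPattern]

theorem isPattern_rigid {Γ : Ctx L} {h : Head L} (hh : ¬ h.IsFree) {ts : List (Tm L)} :
    IsPattern Γ (.app h ts) ↔ ∀ t ∈ ts, IsPattern Γ t := by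
  cases h <;> simp_all [IsPattern, isPatternList_iff, Head.IsFree]

theorem isPattern_flex {Γ : Ctx L} {F : L.Var} {ts : List (Tm L)} :
    IsPattern Γ (.app (.fvar F) ts) ↔ ∃ xs : List ℕ, xs.Nodup ∧ IsBVars Γ xs ts := by
  simp [IsPattern]

theorem forall₂_of_mem {α β : Type*} {R : α → β → Prop} {l : List α} {l' : List β}
    (h : List.Forall₂ R l l') {a : α} (ha : a ∈ l) : ∃ b ∈ l', R a b := by
  induction h with
  | nil => simp at ha
  | cons h _ ih =>
    rcases List.mem_cons.1 ha with rfl | ha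
    · exact ⟨_, List.mem_cons_self, h⟩
    · obtain ⟨b, hb, h⟩ := ih ha
      exact ⟨b, List.mem_cons_of_mem _ hb, h⟩

theorem Pat.isPattern {Γ : Ctx L} {t : Tm L} {A : Ty L.Base} (h : Pat Γ t A) :
    IsPattern Γ t := by
  induction h using Pat.induct with
  | lam Γ A B t _ ih => exact isPattern_lam.2 ih
  | flex Γ F xs As b hn hx hF => exact isPattern_flex.2 ⟨xs, hn, hx.isBVars⟩
  | rigid Γ h ts As b hh hT hs ih =>
    refine (isPattern_rigid hh).2 fun t ht => ?_
    obtain ⟨_, _, _, h⟩ := forall₂_of_mem ih ht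
    exact h

theorem HasTy.pat {Γ : Ctx L} {t : Tm L} {A : Ty L.Base} (h : HasTy Γ t A)
    (hp : IsPattern Γ t) : Pat Γ t A := by
  induction h using HasTy.induct with
  | lam Γ A B t _ ih => exact .lam (ih (isPattern_lam.1 hp))
  | app Γ h ts As b hh hts ih =>
    by_cases hf : h.IsFree
    · cases h with
      | fvar F =>
        obtain ⟨xs, hn, hx⟩ := isPattern_flex.1 hp
        obtain ⟨hx', rfl⟩ := hx.of_hasTys hts.forall₂
        exact .flex hn hx' (by simpa [headTy] using hh)
      | _ => simp [Head.IsFree] at hf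
    · rw [isPattern_rigid hf] at hp
      refine .rigid hf hh ?_
      have := forall₂_map_congr (f := id) (S := Pat Γ) ih fun t ht A h => h.2 (hp t ht)
      simpa using this

/-- Injectivity on the loose variables keeps the arguments of free variables distinct. -/
theorem Pat.ren {Γ Δ : Ctx L} {ρ : ℕ → ℕ} {t : Tm L} {A : Ty L.Base} (ht : Pat Γ t A)
    (hr : RenOn Γ Δ ρ t) (hi : ∀ i j, Loose i t → Loose j t → ρ i = ρ j → i = j) :
    Pat Δ (t.ren ρ) A := by
  induction ht using Pat.induct generalizing Δ ρ with
  | lam Γ A B t _ ih =>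
    rw [Tm.ren_lam]
    refine .lam (ih hr.lam ?_)
    rintro (_ | i) (_ | j) h1 h2 e <;> simp only [upRen, Nat.add_right_cancel_iff] at e ⊢
    · simp at e
    · simp at e
    · exact hi i j (.lam h1) (.lam h2) e
  | flex Γ F xs As b hn hx hF =>
    rw [Tm.ren_app, map_ren_bvs]
    have hloose : ∀ x ∈ xs, Loose x (Tm.app (.fvar F) (bvs xs As)) := by
      intro x h
      obtain ⟨t, ht, h⟩ := (loose_bvs hx.length_eq).2 h
      exact .arg ht h
    refine .flex (hn.map_on fun i h1 j h2 e => hi i j (hloose i h1) (hloose j h2) e) ?_ hF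
    exact forall₂_map_congr hx fun x hx A h => hr x A (hloose x hx) h
  | rigid Γ h ts As b hh hT hs ih =>
    rw [Tm.ren_app]
    refine .rigid (by cases h <;> simp_all [Head.ren, Head.IsFree]) (hr.head hT) ?_
    exact forall₂_map_congr ih fun t ht A h => h.2 (hr.arg ht)
      fun i j h1 h2 => hi i j (.arg ht h1) (.arg ht h2)

theorem Pat.lams {Γ : Ctx L} {As : List (Ty L.Base)} {T : Ty L.Base} {s : Tm L}
    (h : Pat (As.reverse ++ Γ) s T) : Pat Γ (lams As s) (arrs As T) := by
  induction As generalizing Γ with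
  | nil => exact h
  | cons A As ih => exact .lam (ih (by simpa using h))

theorem Pat.of_lams {Γ : Ctx L} {As : List (Ty L.Base)} {T : Ty L.Base} {s : Tm L}
    (h : Pat Γ (HOPU.lams As s) (arrs As T)) : Pat (As.reverse ++ Γ) s T := by
  induction As generalizing Γ with
  | nil => exact h
  | cons A As ih =>
    cases h with
    | lam h => simpa using ih h

theorem Pat.absVars {Γ : Ctx L} {As : List (Ty L.Base)} {T : Ty L.Base} {xs : List ℕ} {t : Tm L}
    (h : Pat Γ t T) (hx : BVTys Γ xs As) (ht : ∀ i, Loose i t → i ∈ xs) :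
    Pat [] (absVars As xs t) (arrs As T) := by
  refine Pat.lams ?_
  rw [List.append_nil]
  refine h.ren (renOn_idxOf hx ht) fun i j hi hj e => ?_
  have := congrArg (listRen xs id) e
  rwa [← hx.length_eq, listRen_idxOf (ht i hi), listRen_idxOf (ht j hj)] at this

theorem pat_etaExp_flex {Γ : Ctx L} {F : L.Var} {xs : List ℕ} {As : List (Ty L.Base)}
    {T : Ty L.Base} (hn : xs.Nodup) (hx : BVTys Γ xs As) (hF : L.varTy F = arrs As T) :
    Pat Γ (etaExp T (.fvar F) (bvs xs As)) T := by
  induction T generalizing Γ xs As with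
  | base b => simpa using Pat.flex hn hx hF
  | arr C D _ ihD =>
    have hl : (xs.map Nat.succ).length = As.length := by simpa using hx.length_eq
    have hb : bvs (L := L) [0] [C] = [etaExp C (.bvar 0) []] := rfl
    rw [etaExp_arr, map_ren_bvs, ← hb, ← bvs_append hl]
    refine .lam (ihD ?_ ?_ (by rw [hF, arrs_append]; rfl))
    · rw [List.nodup_append]
      refine ⟨hn.map Nat.succ_injective, by simp, ?_⟩
      simp
    · exact List.rel_append (forall₂_map_congr hx fun x _ A h => by simpa using h)
        (.cons (by simp) .nil)

/-- Substitutions whose values are patterns. -/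
def PSub (σ : L.Var → Tm L) : Prop := ∀ X, Pat [] (σ X) (L.varTy X)

theorem PSub.tySub {σ : L.Var → Tm L} (h : PSub σ) : TySub σ := fun X => (h X).hasTy

theorem pSub_etaVar : PSub (etaVar (L := L)) :=
  fun _ => pat_etaExp_flex (xs := []) (As := []) .nil .nil rfl

theorem renOn_listRen_id {Δ : Ctx L} {xs : List ℕ} {As : List (Ty L.Base)} (hx : BVTys Δ xs As)
    (t : Tm L) : RenOn As.reverse Δ (listRen xs id) t :=
  fun i A _ h => renOn_listRen (Γ := []) hx (by simp) i A (by simpa using h)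

theorem Tm.subst_flex_base {Δ : Ctx L} {σ : L.Var → Tm L} (hσ : TySub σ) {F : L.Var}
    {xs : List ℕ} {As : List (Ty L.Base)} {b : L.Base} {s : Tm L}
    (hF : L.varTy F = arrs As (.base b)) (hx : BVTys Δ xs As) (hs : σ F = lams As s) :
    (Tm.app (.fvar F) (bvs xs As)).subst σ = s.ren (listRen xs id) := by
  simpa using Tm.subst_flex hσ hF hx hs

theorem Pat.subst_hasTy {Γ : Ctx L} {t : Tm L} {A : Ty L.Base} (ht : Pat Γ t A)
    {σ : L.Var → Tm L} (hσ : TySub σ) : HasTy Γ (t.subst σ) A := by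
  induction ht using Pat.induct with
  | lam Γ A B t _ ih =>
    rw [Tm.subst_lam]
    exact .lam ih
  | flex Γ F xs As b hn hx hF =>
    obtain ⟨s, hs, hty⟩ := hσ.exists_lams hF
    rw [Tm.subst_flex_base hσ hF hx hs]
    exact hty.ren (renOn_listRen_id hx s)
  | rigid Γ h ts As b hh hT hs ih =>
    rw [Tm.subst_app _ hh]
    exact .app hT (.of_forall₂ (forall₂_map_congr ih fun t _ A h => h.2))

/-- At a flexible leaf the instance is the body of a pattern value renamed along `xs`; distinctness
of `xs` makes this renaming injective, so the result is again a pattern. -/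
theorem Pat.subst {Γ : Ctx L} {t : Tm L} {A : Ty L.Base} (ht : Pat Γ t A)
    {σ : L.Var → Tm L} (hσ : PSub σ) : Pat Γ (t.subst σ) A := by
  induction ht using Pat.induct with
  | lam Γ A B t _ ih =>
    rw [Tm.subst_lam]
    exact .lam ih
  | flex Γ F xs As b hn hx hF =>
    obtain ⟨s, hs, hty⟩ := hσ.tySub.exists_lams hF
    rw [Tm.subst_flex_base hσ.tySub hF hx hs]
    have hp := hσ F
    rw [hs, hF] at hp
    have hp := hp.of_lams
    rw [List.append_nil] at hp
    refine hp.ren (renOn_listRen_id hx s) fun i j hi hj => listRen_inj hn ?_ ?_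
    · simpa [hx.length_eq] using hi.lt hty
    · simpa [hx.length_eq] using hj.lt hty
  | rigid Γ h ts As b hh hT hs ih =>
    rw [Tm.subst_app _ hh]
    exact .rigid hh hT (forall₂_map_congr ih fun t _ A h => h.2)

theorem loose_flex {F : L.Var} {xs : List ℕ} {As : List (Ty L.Base)} (hl : xs.length = As.length)
    {i : ℕ} : Loose i (Tm.app (.fvar F) (bvs xs As)) ↔ i ∈ xs := by
  rw [← loose_bvs hl]
  constructor
  · rintro (_ | ⟨ht, h⟩ | _)
    exact ⟨_, ht, h⟩
  · rintro ⟨t, ht, h⟩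
    exact .arg ht h

theorem Pat.subst_ren {Γ Δ : Ctx L} {t : Tm L} {A : Ty L.Base} (ht : Pat Γ t A)
    {σ : L.Var → Tm L} (hσ : TySub σ) {ρ : ℕ → ℕ} (hr : RenOn Γ Δ ρ t) :
    (t.ren ρ).subst σ = (t.subst σ).ren ρ := by
  induction ht using Pat.induct generalizing Δ ρ with
  | lam Γ A B t _ ih => simp [ih hr.lam]
  | flex Γ F xs As b hn hx hF =>
    obtain ⟨s, hs, hty⟩ := hσ.exists_lams hF
    have hx' : BVTys Δ (xs.map ρ) As :=
      forall₂_map_congr hx fun x h A hA => hr x A ((loose_flex hx.length_eq).2 h) hA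
    rw [Tm.ren_app, map_ren_bvs, Head.ren, Tm.subst_flex_base hσ hF hx hs,
      Tm.subst_flex_base hσ hF hx' hs, Tm.ren_ren, ← listRen_map]
    refine Tm.ren_congr fun i hi => listRen_congr ?_
    simpa [hx.length_eq] using hi.lt hty
  | rigid Γ h ts As b hh hT hs ih =>
    rw [Tm.ren_app, Tm.subst_app _ hh, Tm.ren_app,
      Tm.subst_app _ (by cases h <;> simp_all [Head.ren, Head.IsFree]), List.map_map, List.map_map]
    congr 1
    refine List.map_congr_left fun t ht => ?_
    obtain ⟨_, _, _, h⟩ := forall₂_of_mem ih ht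
    exact h (hr.arg ht)

@[simp] theorem subst_lams (σ : L.Var → Tm L) (As : List (Ty L.Base)) (t : Tm L) :
    (lams As t).subst σ = lams As (t.subst σ) := by
  induction As with
  | nil => rfl
  | cons A As ih => simp [ih]

/-- At a flexible leaf the first substitution produces a renamed pattern, and substitution commutes
with that renaming by `Pat.subst_ren`. This is where the values of `σ` have to be patterns, while
`ϑ` may be arbitrary. -/
theorem Pat.subst_comp {Γ : Ctx L} {t : Tm L} {A : Ty L.Base} (ht : Pat Γ t A)
    {σ ϑ : L.Var → Tm L} (hσ : PSub σ) (hϑ : TySub ϑ) :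
    (t.subst σ).subst ϑ = t.subst (comp σ ϑ) := by
  have hc : TySub (comp σ ϑ) := fun X => (hσ X).subst_hasTy hϑ
  induction ht using Pat.induct with
  | lam Γ A B t _ ih => simp [ih]
  | flex Γ F xs As b hn hx hF =>
    obtain ⟨s, hs, hty⟩ := hσ.tySub.exists_lams hF
    have hp := hσ F
    rw [hs, hF] at hp
    have hp := hp.of_lams
    rw [List.append_nil] at hp
    rw [Tm.subst_flex_base hσ.tySub hF hx hs, hp.subst_ren hϑ (renOn_listRen_id hx s),
      Tm.subst_flex_base hc hF hx (s := s.subst ϑ) (by simp [comp, hs])]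
  | rigid Γ h ts As b hh hT hs ih =>
    rw [Tm.subst_app _ hh, Tm.subst_app _ hh, Tm.subst_app _ hh, List.map_map]
    congr 1
    refine List.map_congr_left fun t ht => ?_
    obtain ⟨_, _, _, h⟩ := forall₂_of_mem ih ht
    exact h

theorem TySub.comp {σ ϑ : L.Var → Tm L} (hσ : PSub σ) (hϑ : TySub ϑ) : TySub (comp σ ϑ) :=
  fun X => (hσ X).subst_hasTy hϑ

theorem PSub.comp {σ ϑ : L.Var → Tm L} (hσ : PSub σ) (hϑ : PSub ϑ) : PSub (comp σ ϑ) :=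
  fun X => (hσ X).subst hϑ

theorem Pat.fv_subst {Γ : Ctx L} {t : Tm L} {A : Ty L.Base} (ht : Pat Γ t A)
    {σ : L.Var → Tm L} (hσ : TySub σ) {X : L.Var} (hX : X ∈ (t.subst σ).fv) :
    ∃ Y ∈ t.fv, X ∈ (σ Y).fv := by
  induction ht using Pat.induct with
  | lam Γ A B t _ ih => simpa using ih (by simpa using hX)
  | flex Γ F xs As b hn hx hF =>
    obtain ⟨s, hs, hty⟩ := hσ.exists_lams hF
    rw [Tm.subst_flex_base hσ hF hx hs, Tm.fv_ren] at hX
    exact ⟨F, by simp [fv_flex], by simpa [hs] using hX⟩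
  | rigid Γ h ts As b hh hT hs ih =>
    rw [Tm.subst_app _ hh, Tm.fv_app] at hX
    rcases hX with hX | ⟨t, ht, hX⟩
    · cases h <;> simp_all [Head.fv, Head.IsFree]
    · obtain ⟨t, ht', rfl⟩ := List.mem_map.1 ht
      obtain ⟨_, _, _, h⟩ := forall₂_of_mem ih ht'
      obtain ⟨Y, hY, h⟩ := h hX
      exact ⟨Y, by rw [Tm.fv_app]; exact .inr ⟨t, ht', hY⟩, h⟩

/-- The value of a flexible term under a substitution of the form `{F ↦ λ x₁, …, xₙ. t}`. -/
theorem Tm.subst_flex_absVars {Δ : Ctx L} {σ : L.Var → Tm L} (hσ : TySub σ) {F : L.Var}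
    {xs : List ℕ} {As : List (Ty L.Base)} {T : Ty L.Base} {t : Tm L}
    (hF : L.varTy F = arrs As T) (hx : BVTys Δ xs As) (hs : σ F = absVars As xs t)
    (ht : ∀ i, Loose i t → i ∈ xs) :
    (etaExp T (.fvar F) (bvs xs As)).subst σ = t := by
  rw [Tm.subst_flex hσ hF hx hs, ren_idxOf_listRen hx.length_eq ht]

theorem Pat.subst_absVars {Γ : Ctx L} {t : Tm L} {T : Ty L.Base} (h : Pat Γ t T)
    {σ : L.Var → Tm L} (hσ : TySub σ) {xs : List ℕ} {As : List (Ty L.Base)}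
    (hx : BVTys Γ xs As) (ht : ∀ i, Loose i t → i ∈ xs) :
    (HOPU.absVars As xs t).subst σ = HOPU.absVars As xs (t.subst σ) := by
  rw [HOPU.absVars, subst_lams, h.subst_ren hσ (renOn_idxOf hx ht)]
  rfl

/-! ### Similarity of terms at a fixed level -/

/-- Equivalence relations on the constants that relate only constants of the same type. -/
structure ConEquiv (E : L.Con → L.Con → Prop) : Prop where
  equiv : Equivalence E
  ty : ∀ f g, E f g → L.conTy f = L.conTy g

/-- The extension of a relation on the constants to heads. -/
inductive HS (E : L.Con → L.Con → Prop) : Head L → Head L → Prop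
  | con {f g : L.Con} (h : E f g) : HS E (.con f) (.con g)
  | bvar (i : ℕ) : HS E (.bvar i) (.bvar i)
  | fvar (X : L.Var) : HS E (.fvar X) (.fvar X)

/-- The extension of a relation on the constants to terms. -/
inductive Sm (E : L.Con → L.Con → Prop) : Tm L → Tm L → Prop
  | lam {A : Ty L.Base} {t s : Tm L} (h : Sm E t s) : Sm E (.lam A t) (.lam A s)
  | zip {h k : Head L} {ts ss : List (Tm L)} (hh : HS E h k) (hl : ts.length = ss.length)
      (hts : ∀ {t s}, (t, s) ∈ ts.zip ss → Sm E t s) : Sm E (.app h ts) (.app k ss)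


theorem Sm.app {h k : Head L} {ts ss : List (Tm L)} (hh : HS E h k)
    (hts : List.Forall₂ (Sm E) ts ss) : Sm E (.app h ts) (.app k ss) :=
  .zip hh hts.length_eq (List.forall₂_iff_zip.1 hts).2

theorem Sm.induct {P : ∀ (t s : Tm L), Sm E t s → Prop}
    (lam : ∀ A t s (h : Sm E t s), P t s h → P (.lam A t) (.lam A s) (.lam h))
    (app : ∀ h k ts ss (hh : HS E h k) (hs : List.Forall₂ (Sm E) ts ss),
      List.Forall₂ (fun t s => ∃ h, P t s h) ts ss → P (.app h ts) (.app k ss) (.app hh hs))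
    {t s : Tm L} (h : Sm E t s) : P t s h :=
  Sm.rec (motive := P) (fun h ih => lam _ _ _ h ih)
    (fun hh hl hs ih => app _ _ _ _ hh (List.forall₂_iff_zip.2 ⟨hl, hs⟩)
      (List.forall₂_iff_zip.2 ⟨hl, fun h => ⟨hs h, ih h⟩⟩)) h

theorem sm_lam {A B : Ty L.Base} {t s : Tm L} :
    Sm E (.lam A t) (.lam B s) ↔ A = B ∧ Sm E t s :=
  ⟨fun | .lam h => ⟨rfl, h⟩, fun | ⟨rfl, h⟩ => .lam h⟩

theorem sm_app {h k : Head L} {ts ss : List (Tm L)} :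
    Sm E (.app h ts) (.app k ss) ↔ HS E h k ∧ List.Forall₂ (Sm E) ts ss :=
  ⟨fun | .zip hh hl h => ⟨hh, List.forall₂_iff_zip.2 ⟨hl, h⟩⟩, fun | ⟨hh, h⟩ => .app hh h⟩

theorem HS.refl (hE : ConEquiv E) (h : Head L) : HS E h h := by
  cases h with
  | con c => exact .con (hE.equiv.refl c)
  | bvar i => exact .bvar i
  | fvar X => exact .fvar X

theorem HS.symm (hE : ConEquiv E) {h k : Head L} (hh : HS E h k) : HS E k h := by
  cases hh with
  | con h => exact .con (hE.equiv.symm h)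
  | bvar i => exact .bvar i
  | fvar X => exact .fvar X

theorem HS.trans (hE : ConEquiv E) {h k l : Head L} (h1 : HS E h k) (h2 : HS E k l) :
    HS E h l := by
  cases h1 with
  | con h => cases h2 with
    | con h' => exact .con (hE.equiv.trans h h')
  | bvar i => exact h2
  | fvar X => exact h2

theorem HS.headTy_eq (hE : ConEquiv E) {h k : Head L} (hh : HS E h k) (Γ : Ctx L) :
    headTy Γ h = headTy Γ k := by
  cases hh with
  | con h => simp [headTy, hE.ty _ _ h]
  | _ => rfl

theorem HS.ren {h k : Head L} (hh : HS E h k) (ρ : ℕ → ℕ) : HS E (h.ren ρ) (k.ren ρ) := by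
  cases hh with
  | con h => exact .con h
  | bvar i => exact .bvar _
  | fvar X => exact .fvar X

theorem forall₂_map_map {α β γ δ : Type*} {R : α → β → Prop} {S : γ → δ → Prop} {f : α → γ}
    {g : β → δ} {l : List α} {l' : List β} (h : List.Forall₂ R l l')
    (hf : ∀ a ∈ l, ∀ b ∈ l', R a b → S (f a) (g b)) : List.Forall₂ S (l.map f) (l'.map g) := by
  induction h with
  | nil => exact .nil
  | cons hab _ ih =>
    exact .cons (hf _ (by simp) _ (by simp) hab)
      (ih fun a ha b hb => hf a (by simp [ha]) b (by simp [hb]))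

theorem Sm.refl (hE : ConEquiv E) (t : Tm L) : Sm E t t := by
  induction t using Tm.induct with
  | lam A t ih => exact .lam ih
  | app h ts ih => exact .app (HS.refl hE h) (List.forall₂_same.2 ih)

theorem Sm.symm (hE : ConEquiv E) {t s : Tm L} (h : Sm E t s) : Sm E s t := by
  induction h using Sm.induct with
  | lam A t s _ ih => exact .lam ih
  | app h k ts ss hh hs ih => exact .app (hh.symm hE) (ih.flip.imp fun _ _ h => h.2)

theorem Sm.trans (hE : ConEquiv E) {t s r : Tm L} (h : Sm E t s) (h' : Sm E s r) : Sm E t r := by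
  induction h using Sm.induct generalizing r with
  | lam A t s _ ih => cases r with
    | lam B r =>
      obtain ⟨rfl, h2⟩ := sm_lam.1 h'
      exact .lam (ih h2)
    | app k rs => cases h'
  | app h k ts ss hh hs ih => cases r with
    | lam B r => cases h'
    | app k rs =>
      obtain ⟨hh', hs'⟩ := sm_app.1 h'
      refine .app (hh.trans hE hh') ?_
      clear hs hh hh' h'
      induction ih generalizing rs with
      | nil => cases hs'; exact .nil
      | cons h1 _ ih => cases hs' with
        | cons h2 h3 => exact .cons (h1.2 h2) (ih _ h3)

theorem Sm.ren {t s : Tm L} (h : Sm E t s) (ρ : ℕ → ℕ) : Sm E (t.ren ρ) (s.ren ρ) := by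
  induction h using Sm.induct generalizing ρ with
  | lam A t s _ ih =>
    rw [Tm.ren_lam, Tm.ren_lam]
    exact .lam (ih _)
  | app h k ts ss hh hs ih =>
    rw [Tm.ren_app, Tm.ren_app]
    exact .app (hh.ren ρ) (forall₂_map_map ih fun _ _ _ _ h => h.2 ρ)

/-- Bound variables are similar only to themselves, so similarity preserves scope. The head
condition for projections and the intersection in VE2 both rest on this. -/
theorem Sm.loose {t s : Tm L} (h : Sm E t s) {i : ℕ} (hi : Loose i t) : Loose i s := by
  induction h using Sm.induct generalizing i with
  | lam A t s _ ih => cases hi with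
    | lam hi => exact .lam (ih hi)
  | app h k ts ss hh hs ih => cases hi with
    | head => cases hh; exact .head
    | arg ht hi =>
      obtain ⟨s, hs, _, h⟩ := forall₂_of_mem ih ht
      exact .arg hs (h hi)

/-- Since `E` never identifies bound variables, every occurrence of `i` forces its two images to
coincide. Applied to the two argument lists of an SV pair, it shows which positions a unifier can
use. -/
theorem Sm.ren_eq {t : Tm L} {ρ ρ' : ℕ → ℕ} (h : Sm E (t.ren ρ) (t.ren ρ')) {i : ℕ}
    (hi : Loose i t) : ρ i = ρ' i := by
  induction hi generalizing ρ ρ' with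
  | @head i ts =>
    rw [Tm.ren_app, Tm.ren_app] at h
    have := (sm_app.1 h).1
    simp only [Head.ren] at this
    generalize e1 : ρ i = a at this
    generalize e2 : ρ' i = b at this
    cases this
    rfl
  | @arg i h' t ts ht _ ih =>
    rw [Tm.ren_app, Tm.ren_app] at h
    have := (sm_app.1 h).2
    rw [List.forall₂_map_left_iff, List.forall₂_map_right_iff, List.forall₂_same] at this
    exact ih (this t ht)
  | lam _ ih =>
    rw [Tm.ren_lam, Tm.ren_lam] at h
    simpa [upRen] using ih (sm_lam.1 h).2

theorem Sm.ty_eq (hE : ConEquiv E) {Γ : Ctx L} {t s : Tm L} (h : Sm E t s) {A B : Ty L.Base}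
    (ht : HasTy Γ t A) (hs : HasTy Γ s B) : A = B := by
  induction h using Sm.induct generalizing Γ A B with
  | lam A t s _ ih =>
    cases ht with
    | lam ht => cases hs with
      | lam hs => rw [ih ht hs]
  | app h k ts ss hh _ _ =>
    cases ht with
    | app h1 _ => cases hs with
      | app h2 _ =>
        rw [hh.headTy_eq hE, h2, Option.some.injEq] at h1
        rw [(arrs_base_inj h1).2]

theorem sm_lams {As : List (Ty L.Base)} {t s : Tm L} :
    Sm E (lams As t) (lams As s) ↔ Sm E t s := by
  induction As with
  | nil => rfl
  | cons A As ih => simp [sm_lam, ih]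

/-- Similar substitutions have similar effects on patterns. -/
theorem Pat.subst_sm (hE : ConEquiv E) {Γ : Ctx L} {t : Tm L} {A : Ty L.Base} (ht : Pat Γ t A)
    {σ σ' : L.Var → Tm L} (hσ : TySub σ) (hσ' : TySub σ') (h : ∀ X ∈ t.fv, Sm E (σ X) (σ' X)) :
    Sm E (t.subst σ) (t.subst σ') := by
  induction ht using Pat.induct with
  | lam Γ A B t _ ih =>
    rw [Tm.subst_lam, Tm.subst_lam]
    exact .lam (ih (by simpa using h))
  | flex Γ F xs As b hn hx hF =>
    obtain ⟨s, hs, _⟩ := hσ.exists_lams hF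
    obtain ⟨s', hs', _⟩ := hσ'.exists_lams hF
    rw [Tm.subst_flex_base hσ hF hx hs, Tm.subst_flex_base hσ' hF hx hs']
    have := h F (by simp [fv_flex])
    rw [hs, hs', sm_lams] at this
    exact this.ren _
  | rigid Γ h' ts As b hh hT hs ih =>
    rw [Tm.subst_app _ hh, Tm.subst_app _ hh]
    refine .app (HS.refl hE h') ?_
    rw [List.forall₂_map_left_iff, List.forall₂_map_right_iff, List.forall₂_same]
    intro t ht
    obtain ⟨_, _, _, h1⟩ := forall₂_of_mem ih ht
    exact h1 fun X hX => h X (by rw [Tm.fv_app]; exact .inr ⟨t, ht, hX⟩)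

/-! ### Size, occurs check -/

/-- The number of symbols in a term. -/
def Tm.size : Tm L → ℕ
  | .lam _ t => t.size + 1
  | .app _ ts => (ts.map Tm.size).sum + 1

theorem Tm.size_ren (t : Tm L) (ρ : ℕ → ℕ) : (t.ren ρ).size = t.size := by
  induction t using Tm.induct generalizing ρ with
  | lam A t ih => simp [Tm.size, ih]
  | app h ts ih =>
    simp only [Tm.ren_app, Tm.size, List.map_map]
    congr 2
    exact List.map_congr_left fun t ht => ih t ht ρ

theorem Sm.size_eq {t s : Tm L} (h : Sm E t s) : t.size = s.size := by
  induction h using Sm.induct with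
  | lam A t s _ ih => simp [Tm.size, ih]
  | app h k ts ss hh hs ih =>
    simp only [Tm.size]
    congr 1
    clear hs
    induction ih with
    | nil => rfl
    | cons h1 _ ih => simp [h1.2, ih]

theorem Tm.size_lt_of_mem {t : Tm L} {ts : List (Tm L)} (h : t ∈ ts) (k : Head L) :
    t.size < (Tm.app k ts).size := by
  rw [Tm.size, Nat.lt_succ_iff]
  exact List.single_le_sum (by simp) _ (List.mem_map_of_mem h)

/-- Free variables of a pattern occur only at flexible leaves, and each such leaf is replaced by a
full renamed copy of the body of its value. -/
theorem Pat.size_le_subst {Γ : Ctx L} {t : Tm L} {A : Ty L.Base} (ht : Pat Γ t A)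
    {σ : L.Var → Tm L} (hσ : TySub σ) {F : L.Var} (hF : F ∈ t.fv) {As : List (Ty L.Base)}
    {b : L.Base} {s : Tm L} (hFt : L.varTy F = arrs As (.base b)) (hs : σ F = HOPU.lams As s) :
    s.size ≤ (t.subst σ).size := by
  induction ht using Pat.induct with
  | lam Γ A B t _ ih =>
    rw [Tm.subst_lam, Tm.size]
    exact (ih (by simpa using hF)).trans (Nat.le_succ _)
  | flex Γ G xs Bs c hn hx hG =>
    rw [fv_flex, Set.mem_singleton_iff] at hF
    subst hF
    obtain ⟨rfl, rfl⟩ := arrs_base_inj (hFt.symm.trans hG)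
    rw [Tm.subst_flex_base hσ hG hx hs, Tm.size_ren]
  | rigid Γ h ts Bs c hh hT hts ih =>
    rw [Tm.fv_app] at hF
    rcases hF with hF | ⟨t, ht, hF⟩
    · cases h <;> simp_all [Head.fv, Head.IsFree]
    · obtain ⟨_, _, _, h1⟩ := forall₂_of_mem ih ht
      rw [Tm.subst_app _ hh]
      exact (h1 hF).trans (Tm.size_lt_of_mem (List.mem_map_of_mem ht) h).le

/-- A variable cannot be unified with a rigid term in which it occurs. -/
theorem occurs_check {Γ Δ : Ctx L} {F : L.Var} {xs : List ℕ} {As : List (Ty L.Base)} {b : L.Base}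
    {a : Head L} {ss : List (Tm L)} {A : Ty L.Base} {σ : L.Var → Tm L} (hσ : TySub σ)
    (hF : L.varTy F = arrs As (.base b)) (hx : BVTys Δ xs As) (ha : ¬ a.IsFree)
    (hp : Pat Γ (.app a ss) A)
    (h : Sm E ((Tm.app (.fvar F) (bvs xs As)).subst σ) ((Tm.app a ss).subst σ)) :
    F ∉ (Tm.app a ss).fv := by
  intro hmem
  obtain ⟨s, hs, _⟩ := hσ.exists_lams hF
  rw [Tm.subst_flex_base hσ hF hx hs, Tm.subst_app _ ha] at h
  have e := h.size_eq
  rw [Tm.size_ren] at e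
  rw [Tm.fv_app] at hmem
  rcases hmem with hmem | ⟨t, ht, hmem⟩
  · cases a <;> simp_all [Head.fv, Head.IsFree]
  · cases hp with
    | flex => simp [Head.IsFree] at ha
    | app _ _ hl hts =>
      -- The instance of the argument containing `F` is at least as large as `s`, yet strictly
      -- smaller than the whole right-hand side, whose size equals that of `s`.
      obtain ⟨_, _, h1⟩ := forall₂_of_mem (List.forall₂_iff_zip.2 ⟨hl, @hts⟩) ht
      have h2 := h1.size_le_subst hσ hmem hF hs
      have h3 := Tm.size_lt_of_mem (List.mem_map_of_mem (f := Tm.subst σ) ht) a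
      omega

/-! ### Cuts of similarity relations -/

/-- The cut of a fuzzy relation on the alphabet at level `l`, on constants. -/
def cut (R : L.Con ⊕ L.Var → L.Con ⊕ L.Var → ℝ) (l : ℝ) (f g : L.Con) : Prop :=
  l ≤ R (.inl f) (.inl g)

variable {R : L.Con ⊕ L.Var → L.Con ⊕ L.Var → ℝ} {l : ℝ}

/-- Transitivity for the minimum is what makes every cut transitive. `l ≤ 1` gives reflexivity, and
`0 < l` excludes constants of different types. -/
theorem conEquiv_cut (hR : IsAlphabetSimilarity R) (h0 : 0 < l) (h1 : l ≤ 1) :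
    ConEquiv (cut R l) where
  equiv := {
    refl := fun f => by rw [cut, hR.similarity.refl]; exact h1
    symm := fun {f g} h => by rw [cut, hR.similarity.symm]; exact h
    trans := fun {f g k} h h' => (le_min h h').trans (hR.similarity.trans _ _ _) }
  ty := fun f g h => by
    by_contra hne
    rw [cut, hR.con_con f g hne] at h
    exact absurd h (not_le.2 h0)

theorem le_headSim_iff (hR : IsAlphabetSimilarity R) (h0 : 0 < l) (h1 : l ≤ 1) {h k : Head L} :
    l ≤ headSim R h k ↔ HS (cut R l) h k := by
  constructor
  · intro hl
    cases h with
    | con f => cases k with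
      | con g => exact .con hl
      | bvar j => exact absurd hl (by simpa [headSim] using h0)
      | fvar Y => exact absurd hl (by simpa [headSim, hR.con_var] using h0)
    | bvar i => cases k with
      | bvar j =>
        by_cases e : i = j
        · rw [e]; exact .bvar j
        · exact absurd hl (by simpa [headSim, e] using h0)
      | _ => exact absurd hl (by simpa [headSim] using h0)
    | fvar X => cases k with
      | con g => exact absurd hl (by simpa [headSim, hR.var_con] using h0)
      | bvar j => exact absurd hl (by simpa [headSim] using h0)
      | fvar Y =>
        by_cases e : X = Y
        · rw [e]; exact .fvar Y
        · exact absurd hl (by simpa [headSim, hR.var_var X Y e] using h0)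
  · rintro (h | i | X)
    · exact h
    · simpa [headSim] using h1
    · simpa [headSim, hR.similarity.refl] using h1

theorem le_simList_iff (h0 : 0 < l) (h1 : l ≤ 1) {ts ss : List (Tm L)} :
    l ≤ simList R ts ss ↔ List.Forall₂ (fun t s => l ≤ sim R t s) ts ss := by
  induction ts generalizing ss with
  | nil => cases ss with
    | nil => simpa [simList] using h1
    | cons s ss => simpa [simList] using h0
  | cons t ts ih => cases ss with
    | nil => simpa [simList] using h0
    | cons s ss => simp [simList, ih]

/-- A minimum is at least `l` exactly when all its members are, and the default value `0` for
different shapes lies below every admissible level. This is the passage from degrees to crisp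
unification. -/
theorem le_sim_iff (hR : IsAlphabetSimilarity R) (h0 : 0 < l) (h1 : l ≤ 1) {t s : Tm L} :
    l ≤ sim R t s ↔ Sm (cut R l) t s := by
  induction t using Tm.induct generalizing s with
  | lam A t ih => cases s with
    | lam B s =>
      by_cases e : A = B
      · simp [sim, sm_lam, e, ih]
      · simpa [sim, sm_lam, e] using h0
    | app k ss =>
      rw [sim]
      · exact ⟨fun h => absurd h (not_le.2 h0), fun h => by cases h⟩
      all_goals simp
  | app h ts ih => cases s with
    | lam B s =>
      rw [sim]
      · exact ⟨fun h => absurd h (not_le.2 h0), fun h => by cases h⟩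
      all_goals simp
    | app k ss =>
      rw [sim, le_min_iff, le_headSim_iff hR h0 h1, le_simList_iff h0 h1, sm_app]
      refine and_congr_right fun _ => ⟨fun h => ?_, fun h => ?_⟩
      · simpa using forall₂_map_map (f := id) (g := id) (S := Sm (cut R l)) h
          fun t ht s _ h => (ih t ht).1 h
      · simpa using forall₂_map_map (f := id) (g := id) (S := fun t s => l ≤ sim R t s) h
          fun t ht s _ h => (ih t ht).2 h

theorem headSim_le_one (hR : IsAlphabetSimilarity R) (h k : Head L) : headSim R h k ≤ 1 := by
  cases h <;> cases k <;> simp only [headSim, hR.similarity.le_one, zero_le_one]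
  split <;> simp

theorem sim_le_one (hR : IsAlphabetSimilarity R) (t s : Tm L) : sim R t s ≤ 1 := by
  induction t using Tm.induct generalizing s with
  | lam A t ih => cases s with
    | lam B s =>
      rw [sim]
      split
      · exact ih s
      · exact zero_le_one
    | app k ss => rw [sim] <;> simp
  | app h ts ih => cases s with
    | lam B s => rw [sim] <;> simp
    | app k ss =>
      rw [sim]
      exact (min_le_left _ _).trans (headSim_le_one hR h k)

/-! ### Substitutions with finite domain -/

theorem IsSubst.tySub {σ : L.Var → Tm L} (h : IsSubst σ) : TySub σ := h.1

theorem dom_etaVar : dom (etaVar (L := L)) = ∅ := by simp [dom]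

open Classical in
theorem finite_dom_update {σ : L.Var → Tm L} (h : (dom σ).Finite) (F : L.Var) (t : Tm L) :
    (dom (Function.update σ F t)).Finite := by
  refine (h.insert F).subset fun X hX => ?_
  by_cases e : X = F
  · exact .inl e
  · exact .inr (by simpa [dom, Function.update_of_ne e] using hX)

open Classical in
theorem IsSubst.update {σ : L.Var → Tm L} (h : IsSubst σ) {F : L.Var} {t : Tm L}
    (ht : HasTy [] t (L.varTy F)) : IsSubst (Function.update σ F t) := by
  refine ⟨fun X => ?_, finite_dom_update h.2 F t⟩
  by_cases e : X = F
  · subst e; simpa using ht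
  · simpa [Function.update_of_ne e] using h.1 X

open Classical in
theorem PSub.update {σ : L.Var → Tm L} (h : PSub σ) {F : L.Var} {t : Tm L}
    (ht : Pat [] t (L.varTy F)) : PSub (Function.update σ F t) := by
  intro X
  by_cases e : X = F
  · subst e; simpa using ht
  · simpa [Function.update_of_ne e] using h X

theorem dom_comp_subset {σ ϑ : L.Var → Tm L} (hϑ : TySub ϑ) :
    dom (comp σ ϑ) ⊆ dom σ ∪ dom ϑ := by
  intro X hX
  by_contra h
  simp only [Set.mem_union, not_or, dom, Set.mem_ofPred_eq, not_not] at h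
  exact hX (by rw [comp, h.1, etaVar_subst hϑ, h.2])

theorem comp_etaVar_right {σ : L.Var → Tm L} (hσ : TySub σ) : comp σ etaVar = σ :=
  funext fun X => (hσ X).subst_etaVar

theorem comp_etaVar_left {σ : L.Var → Tm L} (hσ : TySub σ) : comp etaVar σ = σ :=
  funext fun X => etaVar_subst hσ X

theorem IsSubst.exists_update {ψ : L.Var → Tm L} (hψ : IsSubst ψ) {Hs : List L.Var}
    {ts : List (Tm L)} (hn : Hs.Nodup)
    (h : List.Forall₂ (fun H t => HasTy [] t (L.varTy H)) Hs ts) :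
    ∃ ψ', IsSubst ψ' ∧ (∀ X, X ∉ Hs → ψ' X = ψ X) ∧ List.Forall₂ (fun H t => ψ' H = t) Hs ts := by
  classical
  induction h with
  | nil => exact ⟨ψ, hψ, fun _ _ => rfl, .nil⟩
  | @cons H t Hs ts ht _ ih =>
    obtain ⟨hH, hn⟩ := List.nodup_cons.1 hn
    obtain ⟨ψ', h1, h2, h3⟩ := ih hn
    refine ⟨Function.update ψ' H t, h1.update ht, ?_, ?_⟩
    · intro X hX
      simp only [List.mem_cons, not_or] at hX
      rw [Function.update_of_ne hX.1, h2 X hX.2]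
    · refine .cons (by simp) ?_
      have := forall₂_map_map (f := id) (g := id)
        (S := fun K t' => Function.update ψ' H t K = t') h3 fun K hK t' _ h => by
          have hne : K ≠ H := fun e => hH (e ▸ hK)
          rw [id, id, Function.update_of_ne hne, h]
      simpa using this

/-! ### Problems and transformations -/

/-- The equations are between well-typed patterns of the same type, with variables in `U`. -/
def WF (U : Set L.Var) (P : Finset (Eqn L)) : Prop :=
  ∀ e ∈ P, (∃ A, Pat e.ctx e.lhs A ∧ Pat e.ctx e.rhs A) ∧ e.lhs.fv ⊆ U ∧ e.rhs.fv ⊆ U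

/-- `ψ` unifies the problem `P` up to `E`. -/
def Unif (E : L.Con → L.Con → Prop) (ψ : L.Var → Tm L) (P : Finset (Eqn L)) : Prop :=
  ∀ e ∈ P, Sm E (e.lhs.subst ψ) (e.rhs.subst ψ)

/-- The problem `P` with used variables `U` is transformed into `P'`, `U'` with the substitution
`σ`, and no unifier gets lost. -/
structure Tr (E : L.Con → L.Con → Prop) (U : Set L.Var) (P : Finset (Eqn L)) (σ : L.Var → Tm L)
    (P' : Finset (Eqn L)) (U' : Set L.Var) : Prop where
  psub : PSub σ
  fin : (dom σ).Finite
  sub : U ⊆ U'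
  finU : U.Finite → U'.Finite
  fv : ∀ X ∈ U, (σ X).fv ⊆ U'
  wf : WF U' P'
  compl : ∀ ψ, IsSubst ψ → Unif E ψ P →
    ∃ ψ', IsSubst ψ' ∧ Unif E ψ' P' ∧ ∀ X ∈ U, Sm E ((σ X).subst ψ') (ψ X)

/-- The transformation of `P` into `P'` with `σ` adds no unifiers. -/
def Snd (E : L.Con → L.Con → Prop) (P : Finset (Eqn L)) (σ : L.Var → Tm L)
    (P' : Finset (Eqn L)) : Prop :=
  ∀ ρ, TySub ρ → Unif E ρ P' → Unif E (comp σ ρ) P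

theorem Tr.refl (hE : ConEquiv E) {U : Set L.Var} {P : Finset (Eqn L)} (h : WF U P) :
    Tr E U P etaVar P U where
  psub := pSub_etaVar
  fin := by simp [dom_etaVar]
  sub := subset_rfl
  finU := id
  fv X hX := by simpa using hX
  wf := h
  compl ψ hψ hu := ⟨ψ, hψ, hu, fun X _ => by rw [etaVar_subst hψ.tySub]; exact Sm.refl hE _⟩

theorem comp_assoc {σ ϑ ρ : L.Var → Tm L} (hσ : PSub σ) (hϑ : PSub ϑ) (hρ : TySub ρ) :
    comp (comp σ ϑ) ρ = comp σ (comp ϑ ρ) :=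
  funext fun X => (hσ X).subst_comp hϑ hρ

/-- The second factorization agrees with the first unifier only on `U'`; the field `fv` guarantees
that the values of `σ` on `U` have no other variables, so the two factorizations compose. -/
theorem Tr.trans (hE : ConEquiv E) {U U' U'' : Set L.Var} {P P' P'' : Finset (Eqn L)}
    {σ σ' : L.Var → Tm L} (h : Tr E U P σ P' U') (h' : Tr E U' P' σ' P'' U'') :
    Tr E U P (comp σ σ') P'' U'' where
  psub := h.psub.comp h'.psub
  fin := (h.fin.union h'.fin).subset (dom_comp_subset h'.psub.tySub)
  sub := h.sub.trans h'.sub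
  finU hU := h'.finU (h.finU hU)
  fv X hX Y hY := by
    obtain ⟨Z, hZ, hY⟩ := (h.psub X).fv_subst h'.psub.tySub hY
    exact h'.fv Z (h.fv X hX hZ) hY
  wf := h'.wf
  compl ψ hψ hu := by
    obtain ⟨ψ', hψ', hu', hs⟩ := h.compl ψ hψ hu
    obtain ⟨ψ'', hψ'', hu'', hs'⟩ := h'.compl ψ' hψ' hu'
    refine ⟨ψ'', hψ'', hu'', fun X hX => ?_⟩
    rw [comp, (h.psub X).subst_comp h'.psub hψ''.tySub]
    exact ((h.psub X).subst_sm hE (TySub.comp h'.psub hψ''.tySub) hψ'.tySub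
      fun Y hY => hs' Y (h.fv X hX hY)).trans hE (hs X hX)

theorem Snd.refl {P : Finset (Eqn L)} : Snd E P etaVar P := by
  intro ρ hρ hu
  rwa [comp_etaVar_left hρ]

theorem Snd.trans {P P' P'' : Finset (Eqn L)} {σ σ' : L.Var → Tm L} (hσ : PSub σ) (hσ' : PSub σ')
    (h : Snd E P σ P') (h' : Snd E P' σ' P'') : Snd E P (comp σ σ') P'' := by
  intro ρ hρ hu
  rw [comp_assoc hσ hσ' hρ]
  exact h _ (TySub.comp hσ' hρ) (h' ρ hρ hu)

theorem mem_substProblem {σ : L.Var → Tm L} {P : Finset (Eqn L)} {e : Eqn L} :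
    e ∈ substProblem σ P ↔ ∃ e' ∈ P, e'.subst σ = e := by
  classical
  exact Finset.mem_image

open Classical in
theorem WF.union {U : Set L.Var} {P Q : Finset (Eqn L)} (h : WF U P) (h' : WF U Q) :
    WF U (P ∪ Q) := fun e he => (Finset.mem_union.1 he).elim (h e) (h' e)

theorem WF.subst {U U' : Set L.Var} {P : Finset (Eqn L)} (h : WF U P) {σ : L.Var → Tm L}
    (hσ : PSub σ) (hU : ∀ X ∈ U, (σ X).fv ⊆ U') : WF U' (substProblem σ P) := by
  intro e he
  obtain ⟨e, he', rfl⟩ := mem_substProblem.1 he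
  obtain ⟨⟨A, h1, h2⟩, h3, h4⟩ := h e he'
  refine ⟨⟨A, h1.subst hσ, h2.subst hσ⟩, ?_, ?_⟩
  · intro X hX
    obtain ⟨Y, hY, hX⟩ := h1.fv_subst hσ.tySub hX
    exact hU Y (h3 hY) hX
  · intro X hX
    obtain ⟨Y, hY, hX⟩ := h2.fv_subst hσ.tySub hX
    exact hU Y (h4 hY) hX

theorem WF.substProblem_of_forall {U : Set L.Var} {P : Finset (Eqn L)} (h : WF U P)
    {σ : L.Var → Tm L}
    (hσ : ∀ e ∈ P, ∀ X ∈ e.lhs.fv ∪ e.rhs.fv, σ X = etaVar X) : substProblem σ P = P := by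
  classical
  refine (Finset.image_congr (g := id) fun e he => ?_).trans Finset.image_id
  obtain ⟨⟨A, h1, h2⟩, -⟩ := h e he
  rw [Eqn.subst, Tm.subst_congr (fun X hX => hσ e he X (.inl hX)),
    Tm.subst_congr (t := e.rhs) (fun X hX => hσ e he X (.inr hX)), h1.hasTy.subst_etaVar,
    h2.hasTy.subst_etaVar]
  rfl

theorem WF.substProblem_etaVar {U : Set L.Var} {P : Finset (Eqn L)} (h : WF U P) :
    substProblem etaVar P = P := h.substProblem_of_forall fun _ _ _ _ => rfl

open Classical in
/-- A transformation of one equation is a transformation of each problem that contains it. -/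
theorem Tr.frame (hE : ConEquiv E) {U U' : Set L.Var} {e : Eqn L} {Q P : Finset (Eqn L)}
    {ϑ : L.Var → Tm L} (h : Tr E U {e} ϑ Q U') (hP : WF U P) :
    Tr E U (insert e P) ϑ (Q ∪ substProblem ϑ P) U' where
  psub := h.psub
  fin := h.fin
  sub := h.sub
  finU := h.finU
  fv := h.fv
  wf := h.wf.union (hP.subst h.psub h.fv)
  compl ψ hψ hu := by
    obtain ⟨ψ', hψ', hu', hs⟩ := h.compl ψ hψ fun e' he' =>
      hu e' (Finset.mem_insert.2 (.inl (Finset.mem_singleton.1 he')))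
    refine ⟨ψ', hψ', fun e' he' => ?_, hs⟩
    rcases Finset.mem_union.1 he' with he' | he'
    · exact hu' e' he'
    · obtain ⟨e', he'', rfl⟩ := mem_substProblem.1 he'
      obtain ⟨⟨A, h1, h2⟩, h3, h4⟩ := hP e' he''
      have hc := TySub.comp h.psub hψ'.tySub
      simp only [Eqn.subst]
      rw [h1.subst_comp h.psub hψ'.tySub, h2.subst_comp h.psub hψ'.tySub]
      -- On the variables of the framed equation, all of them in `U`, the composite `ϑψ'` is similar
      -- to `ψ`. Hence the instances of both sides under `ϑψ'` are similar to those under `ψ`, which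
      -- are similar to each other.
      exact ((h1.subst_sm hE hc hψ.tySub fun X hX => hs X (h3 hX)).trans hE
        (hu e' (Finset.mem_insert_of_mem he''))).trans hE
        ((h2.subst_sm hE hc hψ.tySub fun X hX => hs X (h4 hX)).symm hE)

open Classical in
theorem Snd.frame {U : Set L.Var} {e : Eqn L} {Q P : Finset (Eqn L)} {ϑ : L.Var → Tm L}
    (hϑ : PSub ϑ) (h : Snd E {e} ϑ Q) (hP : WF U P) :
    Snd E (insert e P) ϑ (Q ∪ substProblem ϑ P) := by
  intro ρ hρ hu e' he'
  rcases Finset.mem_insert.1 he' with rfl | he'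
  · exact h ρ hρ (fun e he => hu e (Finset.mem_union_left _ he)) _ (Finset.mem_singleton_self _)
  · obtain ⟨⟨A, h1, h2⟩, -⟩ := hP e' he'
    have := hu _ (Finset.mem_union_right _ (Finset.mem_image_of_mem (Eqn.subst ϑ) he'))
    simp only [Eqn.subst] at this
    rwa [h1.subst_comp hϑ hρ, h2.subst_comp hϑ hρ] at this

/-! ### Transformations of single equations -/

theorem wf_singleton {U : Set L.Var} {e : Eqn L} : WF U {e} ↔
    (∃ A, Pat e.ctx e.lhs A ∧ Pat e.ctx e.rhs A) ∧ e.lhs.fv ⊆ U ∧ e.rhs.fv ⊆ U := by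
  simp [WF]

theorem unif_singleton {ψ : L.Var → Tm L} {e : Eqn L} :
    Unif E ψ {e} ↔ Sm E (e.lhs.subst ψ) (e.rhs.subst ψ) := by
  simp [Unif]

/-- Transformations that do not instantiate variables. -/
theorem Tr.of_unif (hE : ConEquiv E) {U : Set L.Var} {P P' : Finset (Eqn L)} (hwf : WF U P')
    (h : ∀ ψ, TySub ψ → Unif E ψ P → Unif E ψ P') : Tr E U P etaVar P' U :=
  { Tr.refl hE hwf with
    compl := fun ψ hψ hu => (Tr.refl hE hwf).compl ψ hψ (h ψ hψ.tySub hu) }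

theorem Snd.of_unif {P P' : Finset (Eqn L)} (h : ∀ ψ, TySub ψ → Unif E ψ P' → Unif E ψ P) :
    Snd E P etaVar P' := by
  intro ρ hρ hu
  rw [comp_etaVar_left hρ]
  exact h ρ hρ hu

theorem WF.abs {U : Set L.Var} {Γ : Ctx L} {A : Ty L.Base} {t s : Tm L}
    (h : WF U {⟨Γ, .lam A t, .lam A s⟩}) : WF U {⟨A :: Γ, t, s⟩} := by
  rw [wf_singleton] at h ⊢
  obtain ⟨⟨B, h1, h2⟩, h3⟩ := h
  cases h1 with
  | lam h1 => cases h2 with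
    | lam h2 => exact ⟨⟨_, h1, h2⟩, by simpa using h3⟩

theorem Tr.abs (hE : ConEquiv E) {U : Set L.Var} {Γ : Ctx L} {A : Ty L.Base} {t s : Tm L}
    (h : WF U {⟨Γ, .lam A t, .lam A s⟩}) :
    Tr E U {⟨Γ, .lam A t, .lam A s⟩} etaVar {⟨A :: Γ, t, s⟩} U :=
  .of_unif hE h.abs fun ψ _ hu => by simpa [unif_singleton, sm_lam] using hu

theorem Snd.abs {Γ : Ctx L} {A : Ty L.Base} {t s : Tm L} :
    Snd E {⟨Γ, .lam A t, .lam A s⟩} etaVar {⟨A :: Γ, t, s⟩} :=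
  .of_unif fun ψ _ hu => by simpa [unif_singleton, sm_lam] using hu

theorem mem_zipEqns {Γ : Ctx L} {ts ss : List (Tm L)} {e : Eqn L} :
    e ∈ zipEqns Γ ts ss ↔ ∃ t s, (t, s) ∈ ts.zip ss ∧ e = ⟨Γ, t, s⟩ := by
  classical
  rw [zipEqns, List.mem_toFinset, ← List.map_uncurry_zip_eq_zipWith]
  simp only [List.mem_map, Prod.exists, Function.uncurry]
  exact exists_congr fun t => exists_congr fun s => and_congr_right fun _ => eq_comm

theorem unif_zipEqns {ψ : L.Var → Tm L} {Γ : Ctx L} {ts ss : List (Tm L)}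
    (hl : ts.length = ss.length) : Unif E ψ (zipEqns Γ ts ss) ↔
      List.Forall₂ (Sm E) (ts.map (Tm.subst ψ)) (ss.map (Tm.subst ψ)) := by
  rw [List.forall₂_map_left_iff, List.forall₂_map_right_iff, List.forall₂_iff_zip]
  constructor
  · intro h
    exact ⟨hl, fun hm => h _ (mem_zipEqns.2 ⟨_, _, hm, rfl⟩)⟩
  · rintro ⟨-, h⟩ e he
    obtain ⟨t, s, hm, rfl⟩ := mem_zipEqns.1 he
    exact h hm

theorem wf_zipEqns {U : Set L.Var} {Γ : Ctx L} {ts ss : List (Tm L)} {As : List (Ty L.Base)}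
    (ht : List.Forall₂ (Pat Γ) ts As) (hs : List.Forall₂ (Pat Γ) ss As)
    (htU : ∀ t ∈ ts, t.fv ⊆ U) (hsU : ∀ s ∈ ss, s.fv ⊆ U) : WF U (zipEqns Γ ts ss) := by
  intro e he
  obtain ⟨t, s, hm, rfl⟩ := mem_zipEqns.1 he
  have hm' := List.of_mem_zip hm
  refine ⟨?_, htU t hm'.1, hsU s hm'.2⟩
  clear he htU hsU hm'
  induction ht generalizing ss with
  | nil => simp at hm
  | cons h1 _ ih => cases hs with
    | cons h2 h3 =>
      rw [List.zip_cons_cons, List.mem_cons] at hm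
      rcases hm with hm | hm
      · cases hm
        exact ⟨_, h1, h2⟩
      · exact ih h3 hm

theorem Pat.args {Γ : Ctx L} {h : Head L} (hh : ¬ h.IsFree) {ts : List (Tm L)} {A : Ty L.Base}
    (hp : Pat Γ (.app h ts) A) : ∃ As b, A = .base b ∧ headTy Γ h = some (arrs As (.base b)) ∧
      List.Forall₂ (Pat Γ) ts As := by
  cases hp with
  | flex => simp [Head.IsFree] at hh
  | app _ hT hl hts => exact ⟨_, _, rfl, hT, List.forall₂_iff_zip.2 ⟨hl, hts⟩⟩

theorem fv_arg_subset {h : Head L} {ts : List (Tm L)} {U : Set L.Var}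
    (hU : (Tm.app h ts).fv ⊆ U) : ∀ t ∈ ts, t.fv ⊆ U := by
  intro t ht X hX
  apply hU
  rw [Tm.fv_app]
  exact .inr ⟨t, ht, hX⟩

/-- Unifiers at any level `E` survive, even when `f` and `g` are not related by `E`. The second
relation `E'`, later the cut at `μ`, serves only to give `f` and `g` the same type, so that the new
equations are well typed. Soundness in `Snd.dec` does need the heads related by `E`. -/
theorem Tr.dec (hE : ConEquiv E) {U : Set L.Var} {Γ : Ctx L} {f g : Head L} {ts ss : List (Tm L)}
    (hf : ¬ f.IsFree) (hg : ¬ g.IsFree) {E' : L.Con → L.Con → Prop} (hE' : ConEquiv E')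
    (hfg : HS E' f g) (hl : ts.length = ss.length) (h : WF U {⟨Γ, .app f ts, .app g ss⟩}) :
    Tr E U {⟨Γ, .app f ts, .app g ss⟩} etaVar (zipEqns Γ ts ss) U := by
  rw [wf_singleton] at h
  obtain ⟨⟨A, h1, h2⟩, h3, h4⟩ := h
  obtain ⟨As, b, rfl, hT, hts⟩ := h1.args hf
  obtain ⟨Bs, c, e, hT', hss⟩ := h2.args hg
  have := hfg.headTy_eq hE' Γ
  dsimp only at hT hT'
  rw [hT, hT', Option.some.injEq] at this
  obtain ⟨rfl, -⟩ := arrs_base_inj this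
  refine .of_unif hE (wf_zipEqns hts hss (fv_arg_subset h3) (fv_arg_subset h4)) fun ψ _ hu => ?_
  rw [unif_singleton, Tm.subst_app _ hf, Tm.subst_app _ hg, sm_app] at hu
  exact (unif_zipEqns hl).2 hu.2

theorem Snd.dec {Γ : Ctx L} {f g : Head L} {ts ss : List (Tm L)} (hf : ¬ f.IsFree)
    (hg : ¬ g.IsFree) (hfg : HS E f g) (hl : ts.length = ss.length) :
    Snd E {⟨Γ, .app f ts, .app g ss⟩} etaVar (zipEqns Γ ts ss) := by
  refine .of_unif fun ψ _ hu => ?_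
  rw [unif_singleton, Tm.subst_app _ hf, Tm.subst_app _ hg]
  exact .app hfg ((unif_zipEqns hl).1 hu)

theorem Tr.ori (hE : ConEquiv E) {U : Set L.Var} {Γ : Ctx L} {t s : Tm L}
    (h : WF U {⟨Γ, t, s⟩}) : Tr E U {⟨Γ, t, s⟩} etaVar {⟨Γ, s, t⟩} U := by
  refine .of_unif hE ?_ fun ψ _ hu => ?_
  · rw [wf_singleton] at h ⊢
    obtain ⟨⟨A, h1, h2⟩, h3, h4⟩ := h
    exact ⟨⟨A, h2, h1⟩, h4, h3⟩
  · rw [unif_singleton] at hu ⊢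
    exact hu.symm hE

theorem Snd.ori (hE : ConEquiv E) {Γ : Ctx L} {t s : Tm L} :
    Snd E {⟨Γ, t, s⟩} etaVar {⟨Γ, s, t⟩} := by
  refine .of_unif fun ψ _ hu => ?_
  rw [unif_singleton] at hu ⊢
  exact hu.symm hE

/-! ### Elimination of flexible pairs -/

theorem absVars_ren_listRen {Γ : Ctx L} {As : List (Ty L.Base)} {xs : List ℕ} {u : Tm L}
    {T : Ty L.Base} (hn : xs.Nodup) (hx : BVTys Γ xs As) (hu : HasTy As.reverse u T) :
    absVars As xs (u.ren (listRen xs id)) = lams As u := by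
  rw [absVars, ren_listRen_idxOf hx.length_eq hn]
  intro i hi
  simpa [hx.length_eq] using hi.lt hu

theorem loose_ren_listRen {Γ : Ctx L} {As : List (Ty L.Base)} {xs : List ℕ} {u : Tm L}
    {T : Ty L.Base} (hx : BVTys Γ xs As) (hu : HasTy As.reverse u T) {i : ℕ}
    (hi : Loose i (u.ren (listRen xs id))) : i ∈ xs := by
  obtain ⟨j, hj, rfl⟩ := hi.of_ren
  exact listRen_mem (by simpa [hx.length_eq] using hj.lt hu)

/-- A variable can be given a value such that a flexible term gets a prescribed value. -/
theorem exists_flex_value {Γ : Ctx L} {ψ : L.Var → Tm L} (hψ : IsSubst ψ) {H : L.Var}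
    {zs : List ℕ} {Cs : List (Ty L.Base)} {b : L.Base} {r : Tm L}
    (hz : BVTys Γ zs Cs) (hH : L.varTy H = arrs Cs (.base b)) (hr : HasTy Γ r (.base b))
    (hl : ∀ i, Loose i r → i ∈ zs) :
    ∃ ψ', IsSubst ψ' ∧ (∀ X, X ≠ H → ψ' X = ψ X) ∧
      (Tm.app (.fvar H) (bvs zs Cs)).subst ψ' = r := by
  obtain ⟨ψ', h1, h2, h3⟩ := hψ.exists_update (Hs := [H]) (ts := [absVars Cs zs r])
    (List.nodup_singleton _) (.cons (by rw [hH]; exact hr.absVars hz hl) .nil)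
  refine ⟨ψ', h1, fun X hX => h2 X (by simpa using hX), ?_⟩
  have := Tm.subst_flex_absVars h1.tySub hH hz (by simpa using h3) hl
  rwa [etaExp_base] at this

theorem fv_absVars_flex (As : List (Ty L.Base)) (xs : List ℕ) (H : L.Var) (zs : List ℕ)
    (Cs : List (Ty L.Base)) : (absVars As xs (.app (.fvar H) (bvs zs Cs))).fv = {H} := by
  rw [fv_absVars, fv_flex]

theorem pat_absVars_flex {Γ : Ctx L} {As Cs : List (Ty L.Base)} {xs zs : List ℕ} {H : L.Var}
    {b : L.Base} (hx : BVTys Γ xs As) (hzn : zs.Nodup) (hz : BVTys Γ zs Cs)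
    (hH : L.varTy H = arrs Cs (.base b)) (hsub : ∀ z ∈ zs, z ∈ xs) :
    Pat [] (absVars As xs (.app (.fvar H) (bvs zs Cs))) (arrs As (.base b)) :=
  (Pat.flex hzn hz hH).absVars hx fun i hi => hsub i ((loose_flex hz.length_eq).1 hi)

theorem subst_absVars_flex {Γ : Ctx L} {As Cs : List (Ty L.Base)} {xs zs : List ℕ} {H : L.Var}
    {b : L.Base} (hx : BVTys Γ xs As) (hzn : zs.Nodup) (hz : BVTys Γ zs Cs)
    (hH : L.varTy H = arrs Cs (.base b)) (hsub : ∀ z ∈ zs, z ∈ xs) {ψ : L.Var → Tm L}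
    (hψ : TySub ψ) : (absVars As xs (.app (.fvar H) (bvs zs Cs))).subst ψ =
      absVars As xs ((Tm.app (.fvar H) (bvs zs Cs)).subst ψ) :=
  (Pat.flex hzn hz hH).subst_absVars hψ hx fun i hi => hsub i ((loose_flex hz.length_eq).1 hi)

theorem fv_flex_mem {F : L.Var} {us : List (Tm L)} {U : Set L.Var}
    (h : (Tm.app (.fvar F) us).fv ⊆ U) : F ∈ U := h (by rw [Tm.fv_app]; exact .inl rfl)

/-- If `ψ` unifies the pair and `s` is the body of `ψ F`, then `s` renamed along `xs` is similar to
`s` renamed along `ys`, so `s` uses only positions where the lists agree. Its instance along `xs`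
therefore involves only `zs`, and abstracting these gives the value of `H`. -/
theorem Tr.sv (hE : ConEquiv E) {U : Set L.Var} {Γ : Ctx L} {F H : L.Var} {xs ys zs : List ℕ}
    {As Cs : List (Ty L.Base)} {b : L.Base} (hxn : xs.Nodup)
    (hx : BVTys Γ xs As) (hy : BVTys Γ ys As) (hzn : zs.Nodup) (hz : BVTys Γ zs Cs)
    (hmem : ∀ z, z ∈ zs ↔ ∃ i : ℕ, xs[i]? = some z ∧ ys[i]? = some z)
    (hF : L.varTy F = arrs As (.base b)) (hH : L.varTy H = arrs Cs (.base b)) (hFU : F ∈ U)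
    (hfresh : H ∉ U) :
    Tr E U {⟨Γ, .app (.fvar F) (bvs xs As), .app (.fvar F) (bvs ys As)⟩}
      (single F (absVars As xs (.app (.fvar H) (bvs zs Cs)))) ∅ (insert H U) := by
  classical
  have hsub : ∀ z ∈ zs, z ∈ xs := fun z h => by
    obtain ⟨i, h1, -⟩ := (hmem z).1 h
    exact List.mem_of_getElem? h1
  refine ⟨?_, ?_, Set.subset_insert _ _, fun h => h.insert H, ?_, by simp [WF], ?_⟩
  · exact pSub_etaVar.update (by rw [hF]; exact pat_absVars_flex hx hzn hz hH hsub)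
  · exact finite_dom_update (by simp [dom_etaVar]) _ _
  · intro X hX
    by_cases e : X = F
    · subst e
      rw [single, Function.update_self, fv_absVars_flex]
      simp
    · rw [single, Function.update_of_ne e, fv_etaVar]
      simp [hX]
  · intro ψ hψ hu
    obtain ⟨s, hs, hty⟩ := hψ.tySub.exists_lams hF
    rw [unif_singleton, Tm.subst_flex_base hψ.tySub hF hx hs,
      Tm.subst_flex_base hψ.tySub hF hy hs] at hu
    have hloose : ∀ i, Loose i (s.ren (listRen xs id)) → i ∈ zs := by
      intro i hi
      obtain ⟨j, hj, rfl⟩ := hi.of_ren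
      have hlt : j < As.length := by simpa using hj.lt hty
      -- The de Bruijn index `j` of the body corresponds to this list position, counted from the
      -- outermost binder.
      refine (hmem _).2 ⟨As.length - 1 - j, ?_, ?_⟩
      · rw [← hx.length_eq]
        exact listRen_of_lt (by rwa [hx.length_eq])
      · rw [hu.ren_eq hj, ← hy.length_eq]
        exact listRen_of_lt (by rwa [hy.length_eq])
    obtain ⟨ψ', h1, h2, h3⟩ := exists_flex_value hψ hz hH
      (hty.ren (renOn_listRen_id hx s)) hloose
    refine ⟨ψ', h1, by simp [Unif], fun X hX => ?_⟩
    by_cases e : X = F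
    · subst e
      rw [single, Function.update_self, subst_absVars_flex hx hzn hz hH hsub h1.tySub, h3,
        absVars_ren_listRen hxn hx hty, hs]
      exact Sm.refl hE _
    · rw [single, Function.update_of_ne e, etaVar_subst h1.tySub,
        h2 X fun e => hfresh (e ▸ hX)]
      exact Sm.refl hE _

/-- Both sides become `H(zs)`: a common variable stands at the same position in `xs` and `ys`, so
abstracting it along `xs` and reapplying along `ys` gives it back. -/
theorem Snd.sv (hE : ConEquiv E) {Γ : Ctx L} {F H : L.Var} {xs ys zs : List ℕ}
    {As Cs : List (Ty L.Base)} {b : L.Base} (hxn : xs.Nodup) (hyn : ys.Nodup)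
    (hx : BVTys Γ xs As) (hy : BVTys Γ ys As) (hzn : zs.Nodup) (hz : BVTys Γ zs Cs)
    (hmem : ∀ z, z ∈ zs ↔ ∃ i : ℕ, xs[i]? = some z ∧ ys[i]? = some z)
    (hF : L.varTy F = arrs As (.base b)) (hH : L.varTy H = arrs Cs (.base b)) :
    Snd E {⟨Γ, .app (.fvar F) (bvs xs As), .app (.fvar F) (bvs ys As)⟩}
      (single F (absVars As xs (.app (.fvar H) (bvs zs Cs)))) ∅ := by
  classical
  have hsub : ∀ z ∈ zs, z ∈ xs := fun z h => by
    obtain ⟨i, h1, -⟩ := (hmem z).1 h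
    exact List.mem_of_getElem? h1
  have hps : PSub (single F (absVars As xs (.app (.fvar H) (bvs zs Cs)))) :=
    pSub_etaVar.update (by rw [hF]; exact pat_absVars_flex hx hzn hz hH hsub)
  intro ρ hρ _
  rw [unif_singleton, ← (Pat.flex hxn hx hF).subst_comp hps hρ,
    ← (Pat.flex hyn hy hF).subst_comp hps hρ]
  have e1 : ∀ zs' : List ℕ, BVTys Γ zs' As →
      (Tm.app (.fvar F) (bvs zs' As)).subst
        (single F (absVars As xs (.app (.fvar H) (bvs zs Cs)))) =
      ((Tm.app (.fvar H) (bvs zs Cs)).ren fun x => As.length - 1 - xs.idxOf x).ren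
        (listRen zs' id) := fun zs' h =>
    Tm.subst_flex_base hps.tySub hF h (by rw [single, Function.update_self]; rfl)
  rw [e1 xs hx, e1 ys hy, Tm.ren_ren, Tm.ren_ren]
  rw [Tm.ren_congr (ρ' := listRen ys id ∘ fun x => As.length - 1 - xs.idxOf x)]
  · exact Sm.refl hE _
  · intro z hzl
    obtain ⟨i, h1, h2⟩ := (hmem z).1 ((loose_flex hz.length_eq).1 hzl)
    obtain ⟨hi, hiz⟩ := List.getElem?_eq_some_iff.1 h1
    obtain ⟨hi', hiz'⟩ := List.getElem?_eq_some_iff.1 h2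
    have e2 : xs.idxOf z = i := by rw [← hiz, hxn.idxOf_getElem]
    have e3 : ys.idxOf z = i := by rw [← hiz', hyn.idxOf_getElem]
    have hx1 := listRen_idxOf (ρ := id) (List.mem_of_getElem? h1)
    have hy1 := listRen_idxOf (ρ := id) (List.mem_of_getElem? h2)
    simp only [Function.comp, e2]
    rw [e2, hx.length_eq] at hx1
    rw [e3, hy.length_eq] at hy1
    rw [hx1, hy1]

theorem pSub_pair {F G : L.Var} {t s : Tm L} (ht : Pat [] t (L.varTy F))
    (hs : Pat [] s (L.varTy G)) : PSub (pair F t G s) :=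
  (pSub_etaVar.update ht).update hs

theorem pair_left {F G : L.Var} (hFG : F ≠ G) (t s : Tm L) : pair F t G s F = t := by
  classical
  simp [pair, single, Function.update_of_ne hFG]

theorem pair_right (F G : L.Var) (t s : Tm L) : pair F t G s G = s := by simp [pair]

theorem pair_of_ne {F G X : L.Var} (hF : X ≠ F) (hG : X ≠ G) (t s : Tm L) :
    pair F t G s X = etaVar X := by
  classical
  simp [pair, single, Function.update_of_ne hG, Function.update_of_ne hF]

/-- The common instance can use only variables from `xs`, seen from `F`, and from `ys`, seen from
`G` through similarity. So it is a term over `zs`, and `H` receives its abstraction. -/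
theorem Tr.ve2 (hE : ConEquiv E) {U : Set L.Var} {Γ : Ctx L} {F G H : L.Var}
    {xs ys zs : List ℕ} {As Bs Cs : List (Ty L.Base)} {b : L.Base} (hFG : F ≠ G)
    (hxn : xs.Nodup) (hyn : ys.Nodup) (hx : BVTys Γ xs As) (hy : BVTys Γ ys Bs) (hzn : zs.Nodup)
    (hz : BVTys Γ zs Cs) (hmem : ∀ z, z ∈ zs ↔ z ∈ xs ∧ z ∈ ys)
    (hF : L.varTy F = arrs As (.base b)) (hG : L.varTy G = arrs Bs (.base b))
    (hH : L.varTy H = arrs Cs (.base b)) (hfresh : H ∉ U) :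
    Tr E U {⟨Γ, .app (.fvar F) (bvs xs As), .app (.fvar G) (bvs ys Bs)⟩}
      (pair F (absVars As xs (.app (.fvar H) (bvs zs Cs)))
        G (absVars Bs ys (.app (.fvar H) (bvs zs Cs)))) ∅ (insert H U) := by
  classical
  have hsub : ∀ z ∈ zs, z ∈ xs := fun z h => ((hmem z).1 h).1
  have hsub' : ∀ z ∈ zs, z ∈ ys := fun z h => ((hmem z).1 h).2
  refine ⟨?_, ?_, Set.subset_insert _ _, fun h => h.insert H, ?_, by simp [WF], ?_⟩
  · exact pSub_pair (by rw [hF]; exact pat_absVars_flex hx hzn hz hH hsub)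
      (by rw [hG]; exact pat_absVars_flex hy hzn hz hH hsub')
  · exact finite_dom_update (finite_dom_update (by simp [dom_etaVar]) _ _) _ _
  · intro X hX
    by_cases e : X = G
    · subst e
      rw [pair_right, fv_absVars_flex]
      simp
    by_cases e' : X = F
    · subst e'
      rw [pair_left hFG, fv_absVars_flex]
      simp
    · rw [pair_of_ne e' e, fv_etaVar]
      simp [hX]
  · intro ψ hψ hu
    obtain ⟨s, hs, hty⟩ := hψ.tySub.exists_lams hF
    obtain ⟨r, hr, hty'⟩ := hψ.tySub.exists_lams hG
    rw [unif_singleton, Tm.subst_flex_base hψ.tySub hF hx hs,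
      Tm.subst_flex_base hψ.tySub hG hy hr] at hu
    have hloose : ∀ i, Loose i (s.ren (listRen xs id)) → i ∈ zs := fun i hi =>
      (hmem i).2 ⟨loose_ren_listRen hx hty hi, loose_ren_listRen hy hty' (hu.loose hi)⟩
    obtain ⟨ψ', h1, h2, h3⟩ := exists_flex_value hψ hz hH
      (hty.ren (renOn_listRen_id hx s)) hloose
    refine ⟨ψ', h1, by simp [Unif], fun X hX => ?_⟩
    by_cases e : X = G
    · subst e
      rw [pair_right, subst_absVars_flex hy hzn hz hH hsub' h1.tySub, h3, hr,
        ← absVars_ren_listRen hyn hy hty', absVars, absVars, sm_lams]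
      -- `H` was built from the value of `F`; that of `G` is recovered only up to `E`.
      exact hu.ren _
    by_cases e' : X = F
    · subst e'
      rw [pair_left hFG, subst_absVars_flex hx hzn hz hH hsub h1.tySub, h3,
        absVars_ren_listRen hxn hx hty, hs]
      exact Sm.refl hE _
    · rw [pair_of_ne e' e, etaVar_subst h1.tySub, h2 X fun e => hfresh (e ▸ hX)]
      exact Sm.refl hE _

theorem Snd.ve2 (hE : ConEquiv E) {Γ : Ctx L} {F G H : L.Var}
    {xs ys zs : List ℕ} {As Bs Cs : List (Ty L.Base)} {b : L.Base} (hFG : F ≠ G)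
    (hxn : xs.Nodup) (hyn : ys.Nodup) (hx : BVTys Γ xs As) (hy : BVTys Γ ys Bs) (hzn : zs.Nodup)
    (hz : BVTys Γ zs Cs) (hmem : ∀ z, z ∈ zs ↔ z ∈ xs ∧ z ∈ ys)
    (hF : L.varTy F = arrs As (.base b)) (hG : L.varTy G = arrs Bs (.base b))
    (hH : L.varTy H = arrs Cs (.base b)) :
    Snd E {⟨Γ, .app (.fvar F) (bvs xs As), .app (.fvar G) (bvs ys Bs)⟩}
      (pair F (absVars As xs (.app (.fvar H) (bvs zs Cs)))
        G (absVars Bs ys (.app (.fvar H) (bvs zs Cs)))) ∅ := by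
  classical
  have hsub : ∀ z ∈ zs, z ∈ xs := fun z h => ((hmem z).1 h).1
  have hsub' : ∀ z ∈ zs, z ∈ ys := fun z h => ((hmem z).1 h).2
  have hps : PSub (pair F (absVars As xs (.app (.fvar H) (bvs zs Cs)))
        G (absVars Bs ys (.app (.fvar H) (bvs zs Cs)))) :=
    pSub_pair (by rw [hF]; exact pat_absVars_flex hx hzn hz hH hsub)
      (by rw [hG]; exact pat_absVars_flex hy hzn hz hH hsub')
  intro ρ hρ _
  rw [unif_singleton, ← (Pat.flex hxn hx hF).subst_comp hps hρ,
    ← (Pat.flex hyn hy hG).subst_comp hps hρ]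
  have e1 := Tm.subst_flex_absVars hps.tySub hF hx (pair_left hFG _ _)
    fun i hi => hsub i ((loose_flex hz.length_eq).1 hi)
  have e2 := Tm.subst_flex_absVars hps.tySub hG hy (pair_right _ _ _ _)
    fun i hi => hsub' i ((loose_flex hz.length_eq).1 hi)
  rw [etaExp_base] at e1 e2
  rw [e1, e2]
  exact Sm.refl hE _

/-- Substitution erases nothing here: the arguments of a free variable in a pattern contain no free
variables, and its value survives as a renamed copy. -/
theorem Pat.mem_fv_subst {Γ : Ctx L} {t : Tm L} {A : Ty L.Base} (ht : Pat Γ t A)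
    {σ : L.Var → Tm L} (hσ : TySub σ) {X Y : L.Var} (hY : Y ∈ t.fv) (hX : X ∈ (σ Y).fv) :
    X ∈ (t.subst σ).fv := by
  induction ht using Pat.induct with
  | lam Γ A B t _ ih => simpa using ih (by simpa using hY)
  | flex Γ F xs As b hn hx hF =>
    obtain ⟨s, hs, hty⟩ := hσ.exists_lams hF
    rw [fv_flex, Set.mem_singleton_iff] at hY
    subst hY
    rw [Tm.subst_flex_base hσ hF hx hs, Tm.fv_ren]
    simpa [hs] using hX
  | rigid Γ h ts As b hh hT hs ih =>
    rw [Tm.subst_app _ hh, Tm.fv_app]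
    rw [Tm.fv_app] at hY
    rcases hY with hY | ⟨t, ht, hY⟩
    · cases h <;> simp_all [Head.fv, Head.IsFree]
    · obtain ⟨_, _, _, h1⟩ := forall₂_of_mem ih ht
      exact .inr ⟨_, List.mem_map_of_mem ht, h1 hY⟩

/-! ### Imitation and projection -/

theorem ConOrMem.not_isFree {xs : List ℕ} {a : Head L} (h : ConOrMem xs a) : ¬ a.IsFree := by
  cases a <;> simp_all [ConOrMem, Head.IsFree]

/-- The terms `H₁(us), …, Hₘ(us)`. -/
abbrev flexArgs (Hs : List L.Var) (Bs : List (Ty L.Base)) (us : List (Tm L)) : List (Tm L) :=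
  List.zipWith (fun H B => etaExp B (.fvar H) us) Hs Bs

theorem mem_flexArgs {As Bs : List (Ty L.Base)} {Hs : List L.Var} {us : List (Tm L)}
    (hHs : List.Forall₂ (fun H B => L.varTy H = arrs As B) Hs Bs) {t : Tm L} :
    t ∈ flexArgs Hs Bs us ↔ ∃ H ∈ Hs, ∃ B, L.varTy H = arrs As B ∧ (H, B) ∈ Hs.zip Bs ∧
      t = etaExp B (.fvar H) us := by
  rw [flexArgs, ← List.map_uncurry_zip_eq_zipWith]
  simp only [List.mem_map, Prod.exists, Function.uncurry]
  constructor
  · rintro ⟨H, B, hm, rfl⟩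
    exact ⟨H, (List.of_mem_zip hm).1, B, (List.forall₂_iff_zip.1 hHs).2 hm, hm, rfl⟩
  · rintro ⟨H, -, B, -, hm, rfl⟩
    exact ⟨H, B, hm, rfl⟩

theorem pat_flexArgs {Γ : Ctx L} {As Bs : List (Ty L.Base)} {Hs : List L.Var} {xs : List ℕ}
    (hn : xs.Nodup) (hx : BVTys Γ xs As)
    (hHs : List.Forall₂ (fun H B => L.varTy H = arrs As B) Hs Bs) :
    List.Forall₂ (Pat Γ) (flexArgs Hs Bs (bvs xs As)) Bs := by
  induction hHs with
  | nil => exact .nil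
  | cons h _ ih => exact .cons (pat_etaExp_flex hn hx h) ih

theorem subst_flexArgs {Γ : Ctx L} {As Bs : List (Ty L.Base)} {Hs : List L.Var} {xs : List ℕ}
    (hx : BVTys Γ xs As) (hHs : List.Forall₂ (fun H B => L.varTy H = arrs As B) Hs Bs)
    {ψ : L.Var → Tm L} (hψ : TySub ψ) {ss : List (Tm L)}
    (h : List.Forall₂ (fun H s => ψ H = lams As s) Hs ss) :
    (flexArgs Hs Bs (bvs xs As)).map (Tm.subst ψ) = ss.map (Tm.ren (listRen xs id)) := by
  induction hHs generalizing ss with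
  | nil => cases h; rfl
  | cons h1 _ ih => cases h with
    | cons h2 h3 =>
      simp only [flexArgs, List.zipWith_cons_cons, List.map_cons]
      rw [Tm.subst_flex hψ h1 hx h2]
      congr 1
      exact ih h3

theorem fv_etaExp_flex (H : L.Var) (B : Ty L.Base) (xs : List ℕ) (As : List (Ty L.Base)) :
    (etaExp B (.fvar H) (bvs xs As)).fv = {H} := by
  rw [fv_etaExp, fv_flex]

theorem length_flexArgs {As Bs : List (Ty L.Base)} {Hs : List L.Var} {us : List (Tm L)}
    (hHs : List.Forall₂ (fun H B => L.varTy H = arrs As B) Hs Bs) :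
    (flexArgs Hs Bs us).length = Bs.length := by
  simp [hHs.length_eq]

section VE1

variable {U : Set L.Var} {Γ : Ctx L} {F : L.Var} {xs : List ℕ} {a : Head L} {ss : List (Tm L)}
  {As Bs : List (Ty L.Base)} {b : L.Base} {Hs : List L.Var}

theorem loose_imitation (hx : BVTys Γ xs As) (ha : ConOrMem xs a)
    (hHs : List.Forall₂ (fun H B => L.varTy H = arrs As B) Hs Bs) (i : ℕ)
    (hi : Loose i (Tm.app a (flexArgs Hs Bs (bvs xs As)))) : i ∈ xs := by
  cases hi with
  | head => exact ha
  | arg ht hi =>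
    obtain ⟨H, -, B, -, -, rfl⟩ := (mem_flexArgs hHs).1 ht
    rwa [loose_etaExp, loose_flex hx.length_eq] at hi

theorem pSub_imitation (hn : xs.Nodup) (hx : BVTys Γ xs As) (ha : ConOrMem xs a)
    (hF : L.varTy F = arrs As (.base b)) (haT : headTy Γ a = some (arrs Bs (.base b)))
    (hHs : List.Forall₂ (fun H B => L.varTy H = arrs As B) Hs Bs) :
    PSub (single F (absVars As xs (.app a (flexArgs Hs Bs (bvs xs As))))) := by
  refine pSub_etaVar.update ?_
  rw [hF]
  exact (Pat.rigid ha.not_isFree haT (pat_flexArgs hn hx hHs)).absVars hx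
    (loose_imitation hx ha hHs)

theorem fv_imitation (ha : ConOrMem xs a)
    (hHs : List.Forall₂ (fun H B => L.varTy H = arrs As B) Hs Bs) :
    (absVars As xs (.app a (flexArgs Hs Bs (bvs xs As)))).fv ⊆ {H | H ∈ Hs} := by
  intro X hX
  rw [fv_absVars, Tm.fv_app] at hX
  rcases hX with hX | ⟨t, ht, hX⟩
  · cases a <;> simp_all [Head.fv, ConOrMem]
  · obtain ⟨H, hH, B, -, -, rfl⟩ := (mem_flexArgs hHs).1 ht
    rw [fv_etaExp_flex, Set.mem_singleton_iff] at hX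
    subst hX
    exact hH

/-- The value of `F` under a unifier must have a head similar to `a`; the abstractions of its
arguments are the values for the fresh variables. The imitation uses `a` itself where the unifier
may use a similar constant, so `F` is recovered only up to `E`. -/
theorem Tr.ve1 (hE : ConEquiv E) (hn : xs.Nodup) (hx : BVTys Γ xs As) (ha : ConOrMem xs a)
    (hF : L.varTy F = arrs As (.base b)) (haT : headTy Γ a = some (arrs Bs (.base b)))
    (hHs : List.Forall₂ (fun H B => L.varTy H = arrs As B) Hs Bs) (hnodup : Hs.Nodup)
    (hfresh : ∀ H ∈ Hs, H ∉ U) (hss : List.Forall₂ (Pat Γ) ss Bs)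
    (hU : (Tm.app a ss).fv ⊆ U) :
    Tr E U {⟨Γ, .app (.fvar F) (bvs xs As), .app a ss⟩}
      (single F (absVars As xs (.app a (flexArgs Hs Bs (bvs xs As)))))
      (zipEqns Γ (flexArgs Hs Bs (bvs xs As)) ss) (U ∪ {H | H ∈ Hs}) := by
  classical
  have hp := pSub_imitation hn hx ha hF haT hHs
  refine ⟨hp, ?_, Set.subset_union_left, fun h => h.union (List.finite_toSet Hs), ?_, ?_, ?_⟩
  · exact finite_dom_update (by simp [dom_etaVar]) _ _
  · intro X hX
    by_cases e : X = F
    · subst e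
      rw [single, Function.update_self]
      exact (fv_imitation ha hHs).trans Set.subset_union_right
    · rw [single, Function.update_of_ne e, fv_etaVar]
      simp [hX]
  · refine wf_zipEqns (pat_flexArgs hn hx hHs) hss ?_ fun s hs =>
      (fv_arg_subset hU s hs).trans Set.subset_union_left
    intro t ht
    obtain ⟨H, hH, B, -, -, rfl⟩ := (mem_flexArgs hHs).1 ht
    rw [fv_etaExp_flex]
    simp [hH]
  · intro ψ hψ hu
    obtain ⟨u, hu0, hty⟩ := hψ.tySub.exists_lams hF
    rw [unif_singleton, Tm.subst_flex_base hψ.tySub hF hx hu0, Tm.subst_app _ ha.not_isFree] at hu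
    cases hty with
    | @app _ a0 us0 Bs0 _ hT0 hts0 =>
    rw [Tm.ren_app, sm_app] at hu
    obtain ⟨hh, hs⟩ := hu
    have hty : HasTy As.reverse (Tm.app a0 us0) (.base b) := .app hT0 hts0
    -- Similar heads have the same type, so the unifier's head takes arguments of the types that the
    -- fresh variables were given.
    obtain rfl : Bs0 = Bs := by
      have h1 := (renOn_listRen_id hx (Tm.app a0 us0)).head hT0
      rw [hh.headTy_eq hE, haT, Option.some.injEq] at h1
      exact (arrs_base_inj h1.symm).1
    have hvals : List.Forall₂ (fun H t => HasTy [] t (L.varTy H)) Hs (us0.map (lams As)) := by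
      have := hts0.forall₂
      clear hT0 hts0 hs hty hnodup hfresh hp haT hss hu0
      induction hHs generalizing us0 with
      | nil => cases this; exact .nil
      | cons h1 _ ih => cases this with
        | cons h2 h3 =>
          refine .cons ?_ (ih h3)
          rw [h1]
          exact HasTy.lams (by simpa using h2)
    obtain ⟨ψ', h1, h2, h3⟩ := hψ.exists_update hnodup hvals
    rw [List.forall₂_map_right_iff] at h3
    have hargs := subst_flexArgs hx hHs h1.tySub h3
    refine ⟨ψ', h1, ?_, fun X hX => ?_⟩
    · have hl : (flexArgs Hs Bs0 (bvs xs As)).length = ss.length := by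
        rw [length_flexArgs hHs, hss.length_eq]
      rw [unif_zipEqns hl, hargs]
      convert hs using 1
      -- Setting the fresh variables does not disturb the right-hand arguments, whose variables are
      -- all used ones.
      refine List.map_congr_left fun s hs => Tm.subst_congr fun X hX => h2 X fun hX' => ?_
      exact hfresh X hX' (fv_arg_subset hU s hs hX)
    · by_cases e : X = F
      · subst e
        rw [single, Function.update_self, (Pat.rigid ha.not_isFree haT
          (pat_flexArgs hn hx hHs)).subst_absVars h1.tySub hx (loose_imitation hx ha hHs),
          Tm.subst_app _ ha.not_isFree, hargs, hu0, ← absVars_ren_listRen hn hx hty, absVars,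
          absVars, sm_lams]
        refine Sm.ren ?_ _
        rw [Tm.ren_app]
        exact .app (hh.symm hE) (List.forall₂_same.2 fun t _ => Sm.refl hE t)
      · rw [single, Function.update_of_ne e, etaVar_subst h1.tySub, h2 X fun h => hfresh X h hX]
        exact Sm.refl hE _

/-- The new equations keep `ss` uninstantiated, which is sound because `F` does not occur there. -/
theorem Snd.ve1 (hE : ConEquiv E) (hn : xs.Nodup) (hx : BVTys Γ xs As) (ha : ConOrMem xs a)
    (hF : L.varTy F = arrs As (.base b)) (haT : headTy Γ a = some (arrs Bs (.base b)))
    (hHs : List.Forall₂ (fun H B => L.varTy H = arrs As B) Hs Bs)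
    (hss : List.Forall₂ (Pat Γ) ss Bs) (hFs : F ∉ (Tm.app a ss).fv) :
    Snd E {⟨Γ, .app (.fvar F) (bvs xs As), .app a ss⟩}
      (single F (absVars As xs (.app a (flexArgs Hs Bs (bvs xs As)))))
      (zipEqns Γ (flexArgs Hs Bs (bvs xs As)) ss) := by
  classical
  have hp := pSub_imitation hn hx ha hF haT hHs
  intro ρ hρ hu
  have hl : (flexArgs Hs Bs (bvs xs As)).length = ss.length := by
    rw [length_flexArgs hHs, hss.length_eq]
  rw [unif_zipEqns hl] at hu
  have e1 := Tm.subst_flex_absVars hp.tySub hF hx (by rw [single, Function.update_self])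
    (loose_imitation hx ha hHs)
  rw [etaExp_base] at e1
  rw [unif_singleton, ← (Pat.flex hn hx hF).subst_comp hp hρ, e1,
    Tm.subst_congr (t := Tm.app a ss) (σ' := ρ), Tm.subst_app _ ha.not_isFree,
    Tm.subst_app _ ha.not_isFree]
  · exact .app (HS.refl hE a) hu
  · intro X hX
    have e : X ≠ F := fun e => hFs (e ▸ hX)
    rw [comp, single, Function.update_of_ne e, etaVar_subst hρ]

end VE1

/-! ### Invariants of variable elimination -/

/-- The head variable of a flexible term. -/
inductive Flx : L.Var → Tm L → Prop
  | app {H : L.Var} {us : List (Tm L)} : Flx H (.app (.fvar H) us)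
  | lam {H : L.Var} {A : Ty L.Base} {t : Tm L} (h : Flx H t) : Flx H (.lam A t)

theorem flx_etaExp (B : Ty L.Base) (H : L.Var) (us : List (Tm L)) :
    Flx H (etaExp B (.fvar H) us) := by
  induction B generalizing us with
  | base b => rw [etaExp_base]; exact .app
  | arr C D _ ih => rw [etaExp_arr]; exact .lam (ih _)

/-- The variables in the values of `σ` on `S`. -/
def valFv (σ : L.Var → Tm L) (S : Set L.Var) : Set L.Var := {X | ∃ Y ∈ S, X ∈ (σ Y).fv}

/-- The variables on the left-hand sides. -/
def lhsFv (P : Finset (Eqn L)) : Set L.Var := {X | ∃ e ∈ P, X ∈ e.lhs.fv}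

/-- The invariant of variable elimination, called for the equation `e₀`. -/
structure VInv (e₀ : Eqn L) (U₀ : Set L.Var) (C : VCfg L) : Prop where
  flx : ∀ e ∈ C.prob, ∃ H, Flx H e.lhs
  sep : ∀ e ∈ C.prob, ∀ e' ∈ C.prob, ∀ X ∈ e.lhs.fv, X ∈ e'.lhs.fv → e = e'
  lhs_rhs : ∀ e ∈ C.prob, ∀ e' ∈ C.prob, ∀ X ∈ e.lhs.fv, X ∉ e'.rhs.fv
  out : ∀ X ∈ U₀, X ∉ e₀.lhs.fv ∪ e₀.rhs.fv → C.sub X = etaVar X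
  prob : ∀ e ∈ C.prob, ∀ X ∈ e.lhs.fv ∪ e.rhs.fv, X ∈ U₀ → X ∈ e₀.lhs.fv ∪ e₀.rhs.fv
  card : (valFv C.sub (e₀.lhs.fv ∪ e₀.rhs.fv) \ lhsFv C.prob).ncard ≤ e₀.rhs.fv.ncard
  rhs : ∀ e ∈ C.prob, e.rhs.fv ⊆ valFv C.sub (e₀.lhs.fv ∪ e₀.rhs.fv)

theorem finite_valFv {σ : L.Var → Tm L} {S : Set L.Var} (h : S.Finite) : (valFv σ S).Finite := by
  have : valFv σ S = ⋃ Y ∈ S, (σ Y).fv := by ext; simp [valFv]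
  rw [this]
  exact h.biUnion fun Y _ => (σ Y).finite_fv

theorem Eqn.finite_fv (e : Eqn L) : (e.lhs.fv ∪ e.rhs.fv).Finite :=
  e.lhs.finite_fv.union e.rhs.finite_fv

theorem valFv_etaVar (S : Set L.Var) : valFv etaVar S = S := by
  ext X; simp [valFv]

/-- The field `card` is the one that pays for termination of the main algorithm. It counts variables
of the computed values that are not awaiting elimination on a left-hand side; initially these lie on
the right of the equation. -/
theorem VInv.init {e : Eqn L} {U : Set L.Var} {F : L.Var} (hF : Flx F e.lhs)
    (h : ∀ X ∈ e.lhs.fv, X ∉ e.rhs.fv) : VInv e U (vInit e U) where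
  flx := by simpa [vInit] using ⟨F, hF⟩
  sep := by simp [vInit]
  lhs_rhs := by simpa [vInit] using h
  out _ _ _ := rfl
  prob := by
    simp only [vInit, Finset.mem_singleton, forall_eq]
    exact fun X hX _ => hX
  card := by
    simp only [vInit, valFv_etaVar]
    refine Set.ncard_le_ncard ?_ e.rhs.finite_fv
    rintro X ⟨hX | hX, hX'⟩
    · exact absurd ⟨e, by simp, hX⟩ hX'
    · exact hX
  rhs := by simp [vInit, valFv_etaVar]

theorem valFv_comp {σ ϑ : L.Var → Tm L} (hσ : PSub σ) (hϑ : TySub ϑ) {S : Set L.Var} {X : L.Var} :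
    X ∈ valFv (comp σ ϑ) S ↔ ∃ Z ∈ valFv σ S, X ∈ (ϑ Z).fv := by
  constructor
  · rintro ⟨Y, hY, hX⟩
    obtain ⟨Z, hZ, hX⟩ := (hσ Y).fv_subst hϑ hX
    exact ⟨Z, ⟨Y, hY, hZ⟩, hX⟩
  · rintro ⟨Z, ⟨Y, hY, hZ⟩, hX⟩
    exact ⟨Y, hY, (hσ Y).mem_fv_subst hϑ hZ hX⟩

theorem VInv.abs {e₀ : Eqn L} {U₀ U : Set L.Var} {Q : Finset (Eqn L)} {P : Finset (Eqn L)}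
    [DecidableEq (Eqn L)] {σ : L.Var → Tm L} {Γ : Ctx L} {A : Ty L.Base} {t s : Tm L}
    (hQ : ∀ e, e ∈ Q ↔ e = ⟨Γ, .lam A t, .lam A s⟩ ∨ e ∈ P) (hne : ⟨Γ, .lam A t, .lam A s⟩ ∉ P)
    (h : VInv e₀ U₀ ⟨Q, σ, U⟩) : VInv e₀ U₀ ⟨insert ⟨A :: Γ, t, s⟩ P, σ, U⟩ := by
  -- Every new equation has a parent in `Q` with the same free variables.
  have hpar : ∀ e ∈ insert (⟨A :: Γ, t, s⟩ : Eqn L) P, ∃ e' ∈ Q, e'.lhs.fv = e.lhs.fv ∧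
      e'.rhs.fv = e.rhs.fv ∧ ((e' = ⟨Γ, .lam A t, .lam A s⟩ ∧ e = ⟨A :: Γ, t, s⟩) ∨
        (e' = e ∧ e ∈ P)) := by
    intro e he
    rcases Finset.mem_insert.1 he with rfl | he
    · exact ⟨_, (hQ _).2 (.inl rfl), by simp, by simp, .inl ⟨rfl, rfl⟩⟩
    · exact ⟨e, (hQ _).2 (.inr he), rfl, rfl, .inr ⟨rfl, he⟩⟩
  constructor
  · intro e he
    obtain ⟨e', he', -, -, ⟨rfl, rfl⟩ | ⟨rfl, h'⟩⟩ := hpar e he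
    · obtain ⟨H, hH⟩ := h.flx _ he'
      cases hH with
      | lam hH => exact ⟨H, hH⟩
    · exact h.flx _ he'
  · intro e1 he1 e2 he2 X h1 h2
    obtain ⟨e1', he1', hl1, -, hc1⟩ := hpar e1 he1
    obtain ⟨e2', he2', hl2, -, hc2⟩ := hpar e2 he2
    have e := h.sep e1' he1' e2' he2' X (hl1 ▸ h1) (hl2 ▸ h2)
    rcases hc1 with ⟨ha, hb⟩ | ⟨ha, hb⟩ <;> rcases hc2 with ⟨hc, hd⟩ | ⟨hc, hd⟩
    · rw [hb, hd]
    · exact absurd hd (by rw [← hc, ← e, ha]; exact hne)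
    · exact absurd hb (by rw [← ha, e, hc]; exact hne)
    · rw [← ha, ← hc, e]
  · intro e1 he1 e2 he2 X h1 h2
    obtain ⟨e1', he1', hl1, -, -⟩ := hpar e1 he1
    obtain ⟨e2', he2', -, hr2, -⟩ := hpar e2 he2
    exact h.lhs_rhs e1' he1' e2' he2' X (hl1 ▸ h1) (hr2 ▸ h2)
  · exact h.out
  · intro e he X hX
    obtain ⟨e', he', hl, hr, -⟩ := hpar e he
    exact h.prob e' he' X (hl ▸ hr ▸ hX)
  · refine (Set.ncard_le_ncard ?_ ((finite_valFv e₀.finite_fv).sdiff)).trans h.card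
    rintro X ⟨hX, hX'⟩
    refine ⟨hX, ?_⟩
    rintro ⟨e, he, hXe⟩
    apply hX'
    rcases (hQ e).1 he with rfl | he
    · exact ⟨_, Finset.mem_insert_self _ _, by simpa using hXe⟩
    · exact ⟨_, Finset.mem_insert_of_mem he, hXe⟩
  · intro e he
    obtain ⟨e', he', -, hr, -⟩ := hpar e he
    exact hr ▸ h.rhs e' he'

theorem mem_zip_flexArgs {Hs : List L.Var} {Bs : List (Ty L.Base)} {us ss : List (Tm L)}
    {t s : Tm L} : (t, s) ∈ (flexArgs Hs Bs us).zip ss ↔ ∃ (i : ℕ) (H : L.Var) (B : Ty L.Base),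
      Hs[i]? = some H ∧ Bs[i]? = some B ∧ ss[i]? = some s ∧ t = etaExp B (.fvar H) us := by
  rw [List.mem_iff_getElem?]
  refine exists_congr fun i => ?_
  rw [List.getElem?_zip_eq_some, List.getElem?_zipWith_eq_some]
  constructor
  · rintro ⟨⟨H, B, h1, h2, h3⟩, h4⟩
    exact ⟨H, B, h1, h2, h4, h3.symm⟩
  · rintro ⟨H, B, h1, h2, h3, h4⟩
    exact ⟨⟨H, B, h1, h2, h4.symm⟩, h3⟩

theorem mem_lhsFv_of_insert {P Q : Finset (Eqn L)} {e : Eqn L} (hQ : ∀ e', e' ∈ Q ↔ e' = e ∨ e' ∈ P)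
    {X : L.Var} : X ∈ lhsFv Q ↔ X ∈ e.lhs.fv ∨ X ∈ lhsFv P := by
  constructor
  · rintro ⟨e', he', hX⟩
    rcases (hQ e').1 he' with rfl | he'
    · exact .inl hX
    · exact .inr ⟨e', he', hX⟩
  · rintro (hX | ⟨e', he', hX⟩)
    · exact ⟨e, (hQ e).2 (.inl rfl), hX⟩
    · exact ⟨e', (hQ e').2 (.inr he'), hX⟩

open Classical in
-- `F` gives way to distinct fresh variables, each on the left of its own new equation. So left-hand
-- variables stay separated and disjoint from the right-hand sides, and none of the new ones enters
-- the count in `card`.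
theorem VInv.ve1 {e₀ : Eqn L} {U₀ U : Set L.Var} {Q P : Finset (Eqn L)} {σ : L.Var → Tm L}
    {Γ : Ctx L} {F : L.Var} {xs : List ℕ} {a : Head L} {ss : List (Tm L)}
    {As Bs : List (Ty L.Base)} {b : L.Base} {Hs : List L.Var}
    (hQ : ∀ e, e ∈ Q ↔ e = ⟨Γ, .app (.fvar F) (bvs xs As), .app a ss⟩ ∨ e ∈ P)
    (hne : ⟨Γ, .app (.fvar F) (bvs xs As), .app a ss⟩ ∉ P) (h : VInv e₀ U₀ ⟨Q, σ, U⟩)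
    (hU : U₀ ⊆ U) (hwf : WF U Q) (hσ : PSub σ) (hn : xs.Nodup) (hx : BVTys Γ xs As)
    (ha : ConOrMem xs a) (hF : L.varTy F = arrs As (.base b))
    (haT : headTy Γ a = some (arrs Bs (.base b)))
    (hHs : List.Forall₂ (fun H B => L.varTy H = arrs As B) Hs Bs) (hnodup : Hs.Nodup)
    (hfresh : ∀ H ∈ Hs, H ∉ U) (hss : List.Forall₂ (Pat Γ) ss Bs) :
    VInv e₀ U₀ ⟨zipEqns Γ (flexArgs Hs Bs (bvs xs As)) ss ∪ P,
      comp σ (single F (absVars As xs (.app a (flexArgs Hs Bs (bvs xs As))))),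
      U ∪ {H | H ∈ Hs}⟩ := by
  set e₁ : Eqn L := ⟨Γ, .app (.fvar F) (bvs xs As), .app a ss⟩ with he₁
  set ϑ := single F (absVars As xs (.app a (flexArgs Hs Bs (bvs xs As)))) with hϑ
  have hp : PSub ϑ := pSub_imitation hn hx ha hF haT hHs
  have he₁Q : e₁ ∈ Q := (hQ _).2 (.inl rfl)
  have hlhs : e₁.lhs.fv = {F} := fv_flex F xs As
  have hϑF : ϑ F = absVars As xs (.app a (flexArgs Hs Bs (bvs xs As))) := by
    rw [hϑ, single, Function.update_self]
  have hϑne : ∀ X, X ≠ F → ϑ X = etaVar X := fun X e => by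
    rw [hϑ, single, Function.update_of_ne e]
  have hFU : F ∈ U := (hwf e₁ he₁Q).2.1 (by rw [hlhs]; rfl)
  have hpar : ∀ e ∈ zipEqns Γ (flexArgs Hs Bs (bvs xs As)) ss ∪ P,
      (∃ (i : ℕ) (H : L.Var) (B : Ty L.Base) (s : Tm L), Hs[i]? = some H ∧ Bs[i]? = some B ∧
        ss[i]? = some s ∧ e = ⟨Γ, etaExp B (.fvar H) (bvs xs As), s⟩) ∨ e ∈ P := by
    intro e he
    refine (Finset.mem_union.1 he).imp_left fun he => ?_
    obtain ⟨t, s, hm, rfl⟩ := mem_zipEqns.1 he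
    obtain ⟨i, H, B, h1, h2, h3, rfl⟩ := mem_zip_flexArgs.1 hm
    exact ⟨i, H, B, s, h1, h2, h3, rfl⟩
  have hlhsU : ∀ e ∈ P, ∀ X ∈ e.lhs.fv, X ∈ U := fun e he X hX =>
    (hwf e ((hQ e).2 (.inr he))).2.1 hX
  have hrhsU : ∀ e ∈ P, ∀ X ∈ e.rhs.fv, X ∈ U := fun e he X hX =>
    (hwf e ((hQ e).2 (.inr he))).2.2 hX
  have hrhs₁ : ∀ s ∈ ss, ∀ X ∈ s.fv, X ∈ e₁.rhs.fv := fun s hs X hX =>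
    fv_arg_subset subset_rfl s hs hX
  have hval : ∀ X ∈ valFv σ (e₀.lhs.fv ∪ e₀.rhs.fv), X ≠ F →
      X ∈ valFv (comp σ ϑ) (e₀.lhs.fv ∪ e₀.rhs.fv) := fun X hX e =>
    (valFv_comp hσ hp.tySub).2 ⟨X, hX, by rw [hϑne X e]; simp⟩
  have hrhsne : ∀ e ∈ Q, ∀ X ∈ e.rhs.fv, X ≠ F := by
    rintro e he X hX rfl
    exact h.lhs_rhs e₁ he₁Q e he X (by rw [hlhs]; rfl) hX
  constructor
  · intro e he
    rcases hpar e he with ⟨i, H, B, s, -, -, -, rfl⟩ | he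
    · exact ⟨H, flx_etaExp B H _⟩
    · exact h.flx e ((hQ e).2 (.inr he))
  · intro e he e' he' X hX hX'
    rcases hpar e he with ⟨i, H, B, s, h1, h2, h3, rfl⟩ | he <;>
      rcases hpar e' he' with ⟨j, K, C, r, h1', h2', h3', rfl⟩ | he'
    · simp only [fv_etaExp_flex, Set.mem_singleton_iff] at hX hX'
      subst hX
      subst hX'
      obtain rfl : i = j := (List.getElem?_inj (List.getElem?_eq_some_iff.1 h1).1 hnodup).1
        (h1.trans h1'.symm)
      rw [h2, Option.some.injEq] at h2'
      rw [h3, Option.some.injEq] at h3'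
      rw [h2', h3']
    · simp only [fv_etaExp_flex, Set.mem_singleton_iff] at hX
      subst hX
      exact absurd (hlhsU _ he' _ hX') (hfresh _ (List.mem_of_getElem? h1))
    · simp only [fv_etaExp_flex, Set.mem_singleton_iff] at hX'
      subst hX'
      exact absurd (hlhsU _ he _ hX) (hfresh _ (List.mem_of_getElem? h1'))
    · exact h.sep e ((hQ e).2 (.inr he)) e' ((hQ e').2 (.inr he')) X hX hX'
  · intro e he e' he' X hX hX'
    rcases hpar e he with ⟨i, H, B, s, h1, h2, h3, rfl⟩ | he <;>
      rcases hpar e' he' with ⟨j, K, C, r, h1', h2', h3', rfl⟩ | he'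
    · simp only [fv_etaExp_flex, Set.mem_singleton_iff] at hX
      subst hX
      exact hfresh _ (List.mem_of_getElem? h1)
        ((hwf e₁ he₁Q).2.2 (hrhs₁ _ (List.mem_of_getElem? h3') _ hX'))
    · simp only [fv_etaExp_flex, Set.mem_singleton_iff] at hX
      subst hX
      exact hfresh _ (List.mem_of_getElem? h1) (hrhsU _ he' _ hX')
    · exact h.lhs_rhs e ((hQ e).2 (.inr he)) e₁ he₁Q X hX
        (hrhs₁ _ (List.mem_of_getElem? h3') _ hX')
    · exact h.lhs_rhs e ((hQ e).2 (.inr he)) e' ((hQ e').2 (.inr he')) X hX hX'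
  · intro X hX hXS
    have e : X ≠ F := by
      rintro rfl
      exact hXS (h.prob e₁ he₁Q X (.inl (by rw [hlhs]; rfl)) hX)
    have h1 : σ X = etaVar X := h.out X hX hXS
    change (σ X).subst ϑ = _
    rw [h1, etaVar_subst hp.tySub, hϑne X e]
  · intro e he X hX hXU
    rcases hpar e he with ⟨i, H, B, s, h1, h2, h3, rfl⟩ | he
    · rcases hX with hX | hX
      · simp only [fv_etaExp_flex, Set.mem_singleton_iff] at hX
        subst hX
        exact absurd (hU hXU) (hfresh _ (List.mem_of_getElem? h1))
      · exact h.prob e₁ he₁Q X (.inr (hrhs₁ _ (List.mem_of_getElem? h3) _ hX)) hXU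
    · exact h.prob e ((hQ e).2 (.inr he)) X hX hXU
  · refine (Set.ncard_le_ncard ?_ ((finite_valFv e₀.finite_fv).sdiff)).trans h.card
    rintro X ⟨hX, hX'⟩
    obtain ⟨Z, hZ, hXZ⟩ := (valFv_comp hσ hp.tySub).1 hX
    by_cases e : Z = F
    -- A variable in the new value of `F` is some fresh `Hᵢ`, the left-hand variable of the `i`-th
    -- new equation, so it is not counted.
    · exfalso
      rw [e, hϑF] at hXZ
      have hXH : X ∈ Hs := fv_imitation ha hHs hXZ
      obtain ⟨i, hi⟩ := List.mem_iff_getElem?.1 hXH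
      have hi1 := (List.getElem?_eq_some_iff.1 hi).1
      have hi2 : i < Bs.length := by rwa [← hHs.length_eq]
      have hi3 : i < ss.length := by rwa [hss.length_eq]
      refine hX' ⟨⟨Γ, etaExp Bs[i] (.fvar X) (bvs xs As), ss[i]⟩, ?_, by simp [fv_etaExp_flex]⟩
      exact Finset.mem_union_left _ (mem_zipEqns.2 ⟨_, _, mem_zip_flexArgs.2
        ⟨i, X, Bs[i], hi, List.getElem?_eq_getElem hi2, List.getElem?_eq_getElem hi3, rfl⟩, rfl⟩)
    · rw [hϑne Z e, fv_etaVar, Set.mem_singleton_iff] at hXZ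
      subst hXZ
      refine ⟨hZ, fun hXQ => ?_⟩
      rcases (mem_lhsFv_of_insert hQ).1 hXQ with hXQ | ⟨e', he', hXe⟩
      · rw [hlhs] at hXQ
        exact e hXQ
      · exact hX' ⟨e', Finset.mem_union_right _ he', hXe⟩
  · intro e he X hX
    rcases hpar e he with ⟨i, H, B, s, h1, h2, h3, rfl⟩ | he
    · have hX₁ := hrhs₁ _ (List.mem_of_getElem? h3) _ hX
      exact hval X (h.rhs e₁ he₁Q hX₁) (hrhsne e₁ he₁Q X hX₁)
    · have heQ := (hQ e).2 (.inr he)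
      exact hval X (h.rhs e heQ hX) (hrhsne e heQ X hX)

theorem Pat.fv_of_flx {Γ : Ctx L} {t : Tm L} {A : Ty L.Base} (ht : Pat Γ t A) {H : L.Var}
    (h : Flx H t) : t.fv = {H} := by
  induction h generalizing Γ A with
  | app =>
    cases ht with
    | flex => exact fv_flex _ _ _
    | app hh => simp [Head.IsFree] at hh
  | lam _ ih => cases ht with
    | lam ht => simpa using ih ht

open Classical in
-- `F` is uncounted because it stands on a left-hand side, while `G` is counted because it stands on
-- a right-hand side. Replacing both by the single variable `H` exchanges one counted variable for
-- another, so the count does not grow. The other left-hand sides contain neither `F` nor `G` and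
-- remain unchanged.
theorem VInv.ve2 {e₀ : Eqn L} {U₀ U : Set L.Var} {Q P : Finset (Eqn L)} {σ ϑ : L.Var → Tm L}
    {e₁ : Eqn L} {F G H : L.Var} (hQ : ∀ e, e ∈ Q ↔ e = e₁ ∨ e ∈ P) (hne : e₁ ∉ P)
    (h : VInv e₀ U₀ ⟨Q, σ, U⟩) (hU : U₀ ⊆ U) (hwf : WF U Q) (hσ : PSub σ) (hp : PSub ϑ)
    (hlhs : e₁.lhs.fv = {F}) (hrhs : e₁.rhs.fv = {G}) (hfresh : H ∉ U)
    (hϑF : (ϑ F).fv = {H}) (hϑG : (ϑ G).fv = {H}) (hϑ : ∀ X, X ≠ F → X ≠ G → ϑ X = etaVar X) :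
    VInv e₀ U₀ ⟨substProblem ϑ P, comp σ ϑ, insert H U⟩ := by
  have he₁Q : e₁ ∈ Q := (hQ _).2 (.inl rfl)
  have hpar : ∀ e ∈ substProblem ϑ P, ∃ e' ∈ Q, e' ≠ e₁ ∧ e'.subst ϑ = e ∧ e.lhs = e'.lhs := by
    intro e he
    obtain ⟨e', he', rfl⟩ := mem_substProblem.1 he
    have heQ := (hQ e').2 (.inr he')
    have hne' : e' ≠ e₁ := fun h => hne (h ▸ he')
    refine ⟨e', heQ, hne', rfl, ?_⟩
    obtain ⟨⟨A, h1, -⟩, -⟩ := hwf e' heQ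
    rw [Eqn.subst, Tm.subst_congr (σ' := etaVar), h1.hasTy.subst_etaVar]
    intro X hX
    refine hϑ X ?_ ?_
    · rintro rfl
      exact hne' (h.sep e' heQ e₁ he₁Q X hX (by rw [hlhs]; rfl))
    · rintro rfl
      exact h.lhs_rhs e' heQ e₁ he₁Q X hX (by rw [hrhs]; rfl)
  have hcases : ∀ Z X, X ∈ (ϑ Z).fv → X = H ∨ (X = Z ∧ Z ≠ F ∧ Z ≠ G) := by
    intro Z X hX
    by_cases e : Z = F
    · rw [e, hϑF] at hX
      exact .inl hX
    by_cases e' : Z = G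
    · rw [e', hϑG] at hX
      exact .inl hX
    · rw [hϑ Z e e', fv_etaVar] at hX
      exact .inr ⟨hX, e, e'⟩
  have hrhsX : ∀ e ∈ Q, ∀ X ∈ (e.subst ϑ).rhs.fv, ∃ Z ∈ e.rhs.fv, X ∈ (ϑ Z).fv := by
    intro e he X hX
    obtain ⟨⟨A, -, h2⟩, -⟩ := hwf e he
    exact h2.fv_subst hp.tySub hX
  constructor
  · intro e he
    obtain ⟨e', he', -, -, hl⟩ := hpar e he
    rw [hl]
    exact h.flx e' he'
  · intro e he e' he' X hX hX'
    obtain ⟨d, hd, -, rfl, hl⟩ := hpar e he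
    obtain ⟨d', hd', -, rfl, hl'⟩ := hpar e' he'
    rw [h.sep d hd d' hd' X (hl ▸ hX) (hl' ▸ hX')]
  · intro e he e' he' X hX hX'
    obtain ⟨d, hd, -, rfl, hl⟩ := hpar e he
    obtain ⟨d', hd', -, rfl, -⟩ := hpar e' he'
    rw [hl] at hX
    obtain ⟨Z, hZ, hXZ⟩ := hrhsX d' hd' X hX'
    rcases hcases Z X hXZ with rfl | ⟨rfl, -⟩
    · exact hfresh ((hwf d hd).2.1 hX)
    · exact h.lhs_rhs d hd d' hd' X hX hZ
  · intro X hX hXS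
    have h1 : σ X = etaVar X := h.out X hX hXS
    change (σ X).subst ϑ = _
    rw [h1, etaVar_subst hp.tySub]
    refine hϑ X ?_ ?_
    · rintro rfl
      exact hXS (h.prob e₁ he₁Q X (.inl (by rw [hlhs]; rfl)) hX)
    · rintro rfl
      exact hXS (h.prob e₁ he₁Q X (.inr (by rw [hrhs]; rfl)) hX)
  · intro e he X hX hXU
    obtain ⟨d, hd, -, rfl, hl⟩ := hpar e he
    rcases hX with hX | hX
    · rw [hl] at hX
      exact h.prob d hd X (.inl hX) hXU
    · obtain ⟨Z, hZ, hXZ⟩ := hrhsX d hd X hX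
      rcases hcases Z X hXZ with rfl | ⟨rfl, -⟩
      · exact absurd (hU hXU) hfresh
      · exact h.prob d hd X (.inr hZ) hXU
  · have hfin : (valFv σ (e₀.lhs.fv ∪ e₀.rhs.fv) \ lhsFv Q).Finite :=
      (finite_valFv e₀.finite_fv).sdiff
    have hG : G ∈ valFv σ (e₀.lhs.fv ∪ e₀.rhs.fv) \ lhsFv Q := by
      refine ⟨h.rhs e₁ he₁Q (by rw [hrhs]; rfl), ?_⟩
      rintro ⟨e, he, hX⟩
      exact h.lhs_rhs e he e₁ he₁Q G hX (by rw [hrhs]; rfl)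
    have hsub : valFv (comp σ ϑ) (e₀.lhs.fv ∪ e₀.rhs.fv) \ lhsFv (substProblem ϑ P) ⊆
        insert H ((valFv σ (e₀.lhs.fv ∪ e₀.rhs.fv) \ lhsFv Q) \ {G}) := by
      rintro X ⟨hX, hX'⟩
      obtain ⟨Z, hZ, hXZ⟩ := (valFv_comp hσ hp.tySub).1 hX
      rcases hcases Z X hXZ with rfl | ⟨rfl, hXF, hXG⟩
      · exact .inl rfl
      · refine .inr ⟨⟨hZ, fun hXQ => ?_⟩, hXG⟩
        rcases (mem_lhsFv_of_insert hQ).1 hXQ with hXQ | ⟨e', he', hXe⟩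
        · rw [hlhs] at hXQ
          exact hXF hXQ
        · have hm := (mem_substProblem (σ := ϑ)).2 ⟨e', he', rfl⟩
          refine hX' ⟨e'.subst ϑ, hm, ?_⟩
          obtain ⟨⟨A, h1, -⟩, -⟩ := hwf e' ((hQ e').2 (.inr he'))
          exact h1.mem_fv_subst hp.tySub hXe hXZ
    calc _ ≤ _ := Set.ncard_le_ncard hsub (hfin.sdiff.insert H)
      _ ≤ _ := Set.ncard_insert_le _ _
      _ = _ := Set.ncard_sdiff_singleton_add_one hG hfin
      _ ≤ _ := h.card
  · intro e he X hX
    obtain ⟨d, hd, -, rfl, -⟩ := hpar e he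
    obtain ⟨Z, hZ, hXZ⟩ := hrhsX d hd X hX
    exact (valFv_comp hσ hp.tySub).2 ⟨Z, h.rhs d hd hZ, hXZ⟩

/-! ### Weights -/

/-- The weight of a term; flexible subterms count as leaves. -/
def Tm.wt : Tm L → ℕ
  | .lam _ t => t.wt + 1
  | .app (.fvar _) _ => 1
  | .app (.con _) ts => (ts.map Tm.wt).sum + 2
  | .app (.bvar _) ts => (ts.map Tm.wt).sum + 2

theorem Tm.wt_rigid {h : Head L} (hh : ¬ h.IsFree) (ts : List (Tm L)) :
    (Tm.app h ts).wt = (ts.map Tm.wt).sum + 2 := by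
  cases h <;> simp_all [Tm.wt, Head.IsFree]

theorem Tm.wt_pos (t : Tm L) : 0 < t.wt := by
  cases t with
  | lam A t => simp [Tm.wt]
  | app h ts => cases h <;> simp [Tm.wt]

/-- The value of the variable is flexible. -/
def FlexVal (σ : L.Var → Tm L) (X : L.Var) : Prop :=
  ∃ As b K us, L.varTy X = arrs As (.base b) ∧ σ X = lams As (.app (.fvar K) us)

theorem etaExp_eq_lams (As : List (Ty L.Base)) (b : L.Base) (X : L.Var) (ts : List (Tm L)) :
    ∃ us, etaExp (arrs As (.base b)) (.fvar X) ts = lams As (.app (.fvar X) us) := by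
  induction As generalizing ts with
  | nil => exact ⟨ts, by simp⟩
  | cons A As ih =>
    obtain ⟨us, h⟩ := ih (ts.map (Tm.ren Nat.succ) ++ [etaExp A (.bvar 0) []])
    exact ⟨us, by rw [arrs_cons, etaExp_arr, Head.ren, h, lams_cons]⟩

theorem flexVal_etaVar {σ : L.Var → Tm L} {X : L.Var} (h : σ X = etaVar X) : FlexVal σ X := by
  obtain ⟨As, b, e⟩ := exists_arrs (L.varTy X)
  obtain ⟨us, hu⟩ := etaExp_eq_lams As b X []
  exact ⟨As, b, X, us, e, by rw [h, etaVar, e, hu]⟩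

theorem flexVal_absVars {σ : L.Var → Tm L} {X H : L.Var} {As : List (Ty L.Base)} {b : L.Base}
    {xs : List ℕ} {ws : List (Tm L)} (hX : L.varTy X = arrs As (.base b))
    (h : σ X = absVars As xs (.app (.fvar H) ws)) : FlexVal σ X :=
  ⟨As, b, H, _, hX, by rw [h, absVars, Tm.ren_app, Head.ren]⟩

/-- A flexible leaf weighs `1` whatever its arguments, and a flexible value turns it into another
flexible leaf. Thus SV and VE2 do not increase the weight of the rest. -/
theorem Pat.wt_subst {Γ : Ctx L} {t : Tm L} {A : Ty L.Base} (ht : Pat Γ t A) {σ : L.Var → Tm L}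
    (hσ : TySub σ) (h : ∀ X ∈ t.fv, FlexVal σ X) : (t.subst σ).wt = t.wt := by
  induction ht using Pat.induct with
  | lam Γ A B t _ ih => simp [Tm.wt, ih (by simpa using h)]
  | flex Γ F xs As b hn hx hF =>
    obtain ⟨Bs, c, K, us, hT, hs⟩ := h F (by simp [fv_flex])
    obtain ⟨rfl, -⟩ := arrs_base_inj (hF.symm.trans hT)
    rw [Tm.subst_flex_base hσ hF hx hs, Tm.ren_app, Head.ren]
    simp [Tm.wt]
  | rigid Γ k ts As b hh hT hs ih =>
    rw [Tm.subst_app _ hh, Tm.wt_rigid hh, Tm.wt_rigid hh, List.map_map]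
    congr 2
    refine List.map_congr_left fun t ht => ?_
    obtain ⟨_, _, _, h1⟩ := forall₂_of_mem ih ht
    exact h1 fun X hX => h X (fv_arg_subset subset_rfl t ht hX)

/-- The weight of an equation. -/
def Eqn.wt (c : ℕ) (e : Eqn L) : ℕ := c * e.lhs.wt + e.rhs.wt

theorem sum_insert_le {α : Type*} [DecidableEq α] (f : α → ℕ) (a : α) (s : Finset α) :
    ∑ x ∈ insert a s, f x ≤ f a + ∑ x ∈ s, f x := by
  by_cases h : a ∈ s
  · rw [Finset.insert_eq_of_mem h]; exact Nat.le_add_left _ _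
  · rw [Finset.sum_insert h]

theorem sum_union_le {α : Type*} [DecidableEq α] (f : α → ℕ) (s t : Finset α) :
    ∑ x ∈ s ∪ t, f x ≤ ∑ x ∈ s, f x + ∑ x ∈ t, f x := by
  rw [← Finset.sum_union_inter]; exact Nat.le_add_right _ _

theorem sum_zipEqns_le (c : ℕ) (Γ : Ctx L) (ts ss : List (Tm L)) :
    ∑ e ∈ zipEqns Γ ts ss, e.wt c ≤ c * (ts.map Tm.wt).sum + (ss.map Tm.wt).sum := by
  classical
  induction ts generalizing ss with
  | nil => simp [zipEqns]
  | cons t ts ih => cases ss with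
    | nil => simp [zipEqns]
    | cons s ss =>
      have h1 := ih ss
      have h2 := sum_insert_le (Eqn.wt c) (⟨Γ, t, s⟩ : Eqn L) (zipEqns Γ ts ss)
      have h3 : zipEqns Γ (t :: ts) (s :: ss) = insert ⟨Γ, t, s⟩ (zipEqns Γ ts ss) := by
        simp [zipEqns]
      rw [h3]
      simp only [List.map_cons, List.sum_cons, mul_add]
      simp only [Eqn.wt] at h2 h1 ⊢
      omega

theorem sum_substProblem_le (c : ℕ) {U : Set L.Var} {P : Finset (Eqn L)} (h : WF U P)
    {σ : L.Var → Tm L} (hσ : TySub σ) (hf : ∀ X, FlexVal σ X) :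
    ∑ e ∈ substProblem σ P, e.wt c ≤ ∑ e ∈ P, e.wt c := by
  classical
  refine (Finset.sum_image_le_of_nonneg fun _ _ => Nat.zero_le _).trans
    (Finset.sum_le_sum fun e he => ?_)
  obtain ⟨⟨A, h1, h2⟩, -⟩ := h e he
  rw [Eqn.wt, Eqn.wt, Eqn.subst, h1.wt_subst hσ fun X _ => hf X, h2.wt_subst hσ fun X _ => hf X]

/-! ### Variable elimination -/

theorem IsBVars.eq_bvs {Γ : Ctx L} {xs : List ℕ} {us : List (Tm L)} {As : List (Ty L.Base)}
    (h : IsBVars Γ xs us) (hx : BVTys Γ xs As) : us = bvs xs As := by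
  obtain ⟨Bs, hB, rfl⟩ := h.exists
  congr 1
  clear h
  induction hB generalizing As with
  | nil => cases hx; rfl
  | cons h1 _ ih => cases hx with
    | cons h2 h3 =>
      rw [h1, Option.some.injEq] at h2
      rw [h2, ih h3]

theorem Pat.flex_args {Γ : Ctx L} {F : L.Var} {us : List (Tm L)} {T : Ty L.Base}
    (h : Pat Γ (.app (.fvar F) us) T) {xs : List ℕ} (hus : IsBVars Γ xs us)
    {As : List (Ty L.Base)} {b : L.Base} (hF : L.varTy F = arrs As (.base b)) :
    BVTys Γ xs As ∧ us = bvs xs As ∧ T = .base b := by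
  cases h.hasTy with
  | app h1 h2 =>
    rw [headTy, hF, Option.some.injEq] at h1
    obtain ⟨rfl, rfl⟩ := arrs_base_inj h1
    obtain ⟨h3, h4⟩ := hus.of_hasTys h2.forall₂
    exact ⟨h3, h4, rfl⟩

/-- The state of variable elimination, called for the equation `e₀`. -/
structure VOk (E : L.Con → L.Con → Prop) (e₀ : Eqn L) (U₀ : Set L.Var) (C : VCfg L) : Prop where
  tr : Tr E U₀ {e₀} C.sub C.prob C.used
  snd : Snd E {e₀} C.sub C.prob
  inv : VInv e₀ U₀ C

/-- The measure that decreases in the steps of variable elimination. -/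
def VCfg.wt (C : VCfg L) : ℕ := ∑ e ∈ C.prob, e.wt 0

/-- The measure has factor `0` on the left and counts right-hand sides only: left-hand sides may
grow in number under VE1, while a rigid right-hand side is replaced by its arguments. -/
theorem VOk.step (hE : ConEquiv E) {e₀ : Eqn L} {U₀ : Set L.Var} {C C' : VCfg L}
    (h : VOk E e₀ U₀ C) (hs : VStep C C') : VOk E e₀ U₀ C' ∧ C'.wt < C.wt := by
  classical
  obtain ⟨P, σ, U⟩ := C
  obtain ⟨e, he, hr⟩ := hs
  obtain ⟨htr, hsnd, hinv⟩ := h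
  dsimp only at he hr htr hsnd
  have hwf := htr.wf
  have hQ : ∀ e', e' ∈ P ↔ e' = e ∨ e' ∈ P.erase e := by
    intro e'
    rw [← Finset.mem_insert, Finset.insert_erase he]
  have hne : e ∉ P.erase e := Finset.notMem_erase e P
  have hwf1 : WF U {e} := wf_singleton.2 (hwf e he)
  have hwf2 : WF U (P.erase e) := fun e' he' => hwf e' (Finset.mem_of_mem_erase he')
  have hsum : e.wt 0 + ∑ e' ∈ P.erase e, e'.wt 0 = ∑ e' ∈ P, e'.wt 0 :=
    Finset.add_sum_erase _ _ he
  have hins : insert e (P.erase e) = P := Finset.insert_erase he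
  cases hr with
  | @abs Γ A t s =>
    have h1 := (Tr.abs hE hwf1).frame hE hwf2
    have h2 := (Snd.abs (E := E) (Γ := Γ) (A := A) (t := t) (s := s)).frame pSub_etaVar hwf2
    rw [hwf2.substProblem_etaVar, hins] at h1 h2
    refine ⟨⟨?_, ?_, hinv.abs hQ hne⟩, ?_⟩
    · have := htr.trans hE h1
      rwa [comp_etaVar_right htr.psub.tySub] at this
    · have := hsnd.trans htr.psub pSub_etaVar h2
      rwa [comp_etaVar_right htr.psub.tySub] at this
    · refine (sum_insert_le _ _ _).trans_lt ?_
      have e1 : Eqn.wt 0 (⟨A :: Γ, t, s⟩ : Eqn L) = s.wt := by simp [Eqn.wt]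
      have e2 : Eqn.wt 0 (⟨Γ, .lam A t, .lam A s⟩ : Eqn L) = s.wt + 1 := by
        simp [Eqn.wt, Tm.wt, add_comm]
      simp only [VCfg.wt]
      omega
  | @ve1 Γ F xs us a ss As Bs b Hs hn hus ha hF haT hHs hnodup hfresh =>
    obtain ⟨⟨T, hp1, hp2⟩, hU1, hU2⟩ := hwf _ he
    obtain ⟨hx, rfl, rfl⟩ := hp1.flex_args hus hF
    obtain ⟨Bs', b', e', haT', hss⟩ := hp2.args ha.not_isFree
    dsimp only at haT' hss
    obtain ⟨rfl, -⟩ := arrs_base_inj (Option.some_injective _ (haT.symm.trans haT'))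
    have hlhs : F ∈ (Tm.app (.fvar F) (bvs xs As)).fv := by rw [fv_flex]; rfl
    have hps := pSub_imitation hn hx ha hF haT hHs
    have hinv' := hinv.ve1 hQ hne htr.sub hwf htr.psub hn hx ha hF haT hHs hnodup hfresh hss
    -- VE1 does not instantiate the remaining equations. The frame lemma does, but by the separation
    -- invariants `F` does not occur in them, so nothing changes.
    have hsub : substProblem (single F (absVars As xs (.app a (flexArgs Hs Bs (bvs xs As)))))
        (P.erase ⟨Γ, .app (.fvar F) (bvs xs As), .app a ss⟩) =
        P.erase ⟨Γ, .app (.fvar F) (bvs xs As), .app a ss⟩ := by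
      refine hwf2.substProblem_of_forall fun e' he' X hX => ?_
      have hXF : X ≠ F := by
        rintro rfl
        have heP := Finset.mem_of_mem_erase he'
        rcases hX with hX | hX
        · exact (Finset.mem_erase.1 he').1 (hinv.sep e' heP _ he X hX hlhs)
        · exact hinv.lhs_rhs _ he e' heP X hlhs hX
      rw [single, Function.update_of_ne hXF]
    have h1 := (Tr.ve1 hE hn hx ha hF haT hHs hnodup hfresh hss hU2).frame hE hwf2
    have h2 := (Snd.ve1 hE hn hx ha hF haT hHs hss (hinv.lhs_rhs _ he _ he F hlhs)).frame hps hwf2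
    rw [hsub, hins] at h1 h2
    refine ⟨⟨htr.trans hE h1, hsnd.trans htr.psub hps h2, hinv'⟩, ?_⟩
    refine (sum_union_le _ _ _).trans_lt ?_
    have h3 := sum_zipEqns_le 0 Γ (flexArgs Hs Bs (bvs xs As)) ss
    have e2 : Eqn.wt 0 (⟨Γ, .app (.fvar F) (bvs xs As), .app a ss⟩ : Eqn L) =
        (ss.map Tm.wt).sum + 2 := by simp [Eqn.wt, Tm.wt_rigid ha.not_isFree, add_comm]
    simp only [VCfg.wt]
    simp only [flexArgs, zero_mul, zero_add] at h3
    omega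
  | @ve2 Γ F G xs ys zs us vs ws As Bs Cs b H hFG hn hus hyn hvs hzn hws hz hF hG hCs hH hfresh =>
    obtain ⟨⟨T, hp1, hp2⟩, hU1, hU2⟩ := hwf _ he
    obtain ⟨hx, rfl, rfl⟩ := hp1.flex_args hus hF
    obtain ⟨hy, rfl, -⟩ := hp2.flex_args hvs hG
    obtain rfl := hws.eq_bvs hCs
    have t1 := Tr.ve2 hE hFG hn hyn hx hy hzn hCs hz hF hG hH hfresh
    have h1 := t1.frame hE hwf2
    have h2 := (Snd.ve2 hE hFG hn hyn hx hy hzn hCs hz hF hG hH).frame t1.psub hwf2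
    rw [hins, Finset.empty_union] at h1 h2
    refine ⟨⟨htr.trans hE h1, hsnd.trans htr.psub t1.psub h2, ?_⟩, ?_⟩
    · refine hinv.ve2 hQ hne htr.sub hwf htr.psub t1.psub (fv_flex F xs As) (fv_flex G ys Bs)
        hfresh ?_ ?_ fun X h1 h2 => pair_of_ne h1 h2 _ _
      · rw [pair_left hFG, fv_absVars_flex]
      · rw [pair_right, fv_absVars_flex]
    · refine (sum_substProblem_le 0 hwf2 t1.psub.tySub fun X => ?_).trans_lt ?_
      · by_cases e : X = G
        · subst e
          exact flexVal_absVars hG (pair_right _ _ _ _)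
        by_cases e' : X = F
        · subst e'
          exact flexVal_absVars hF (pair_left hFG _ _)
        · exact flexVal_etaVar (pair_of_ne e' e _ _)
      · simp only [VCfg.wt, ← hsum]
        have := Tm.wt_pos (Tm.app (.fvar G) (bvs ys Bs))
        simp only [Eqn.wt]
        omega

theorem VOk.acc (hE : ConEquiv E) {e₀ : Eqn L} {U₀ : Set L.Var} {C : VCfg L}
    (h : VOk E e₀ U₀ C) : Acc (fun C' C => VStep C C') C := by
  induction hn : C.wt using Nat.strong_induction_on generalizing C with
  | _ n ih =>
    refine ⟨_, fun C' hs => ?_⟩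
    obtain ⟨h1, h2⟩ := h.step hE hs
    exact ih _ (hn ▸ h2) h1 rfl

theorem VOk.reaches (hE : ConEquiv E) {e₀ : Eqn L} {U₀ : Set L.Var} {C C' : VCfg L}
    (h : VOk E e₀ U₀ C) (hs : Relation.ReflTransGen VStep C C') : VOk E e₀ U₀ C' := by
  induction hs with
  | refl => exact h
  | tail _ h1 ih => exact (ih.step hE h1).1

-- Fresh variables, and success of variable elimination on unifiable equations.

theorem exists_fresh {U : Set L.Var} (hU : U.Finite) (T : Ty L.Base) :
    ∃ H, L.varTy H = T ∧ H ∉ U := by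
  obtain ⟨H, h1, h2⟩ := ((L.infinite_var T).sdiff hU).nonempty
  exact ⟨H, h1, h2⟩

theorem exists_fresh_list {U : Set L.Var} (hU : U.Finite) (As Bs : List (Ty L.Base)) :
    ∃ Hs : List L.Var, List.Forall₂ (fun H B => L.varTy H = arrs As B) Hs Bs ∧ Hs.Nodup ∧
      ∀ H ∈ Hs, H ∉ U := by
  induction Bs with
  | nil => exact ⟨[], .nil, List.nodup_nil, by simp⟩
  | cons B Bs ih =>
    obtain ⟨Hs, h1, h2, h3⟩ := ih
    obtain ⟨H, h4, h5⟩ := exists_fresh (hU.union (List.finite_toSet Hs)) (arrs As B)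
    simp only [Set.mem_union, Set.mem_ofPred_eq, not_or] at h5
    refine ⟨H :: Hs, .cons h4 h1, List.nodup_cons.2 ⟨h5.2, h2⟩, ?_⟩
    simpa using ⟨h5.1, h3⟩

theorem BVTys.exists_of_subset {Γ : Ctx L} {xs zs : List ℕ} {As : List (Ty L.Base)}
    (hx : BVTys Γ xs As) (h : ∀ z ∈ zs, z ∈ xs) : ∃ Cs, BVTys Γ zs Cs := by
  induction zs with
  | nil => exact ⟨[], .nil⟩
  | cons z zs ih =>
    obtain ⟨Cs, hCs⟩ := ih fun z hz => h z (List.mem_cons_of_mem _ hz)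
    obtain ⟨C, -, hC⟩ := forall₂_of_mem hx (h z List.mem_cons_self)
    exact ⟨C :: Cs, .cons hC hCs⟩

/-- The head of a rigid term that is unifiable with `F(x₁, …, xₙ)`. -/
theorem conOrMem_of_sm (hE : ConEquiv E) {Γ : Ctx L} {F : L.Var} {xs : List ℕ}
    {As : List (Ty L.Base)} {b : L.Base} {a : Head L} {ss : List (Tm L)} {σ : L.Var → Tm L}
    (hσ : TySub σ) (hF : L.varTy F = arrs As (.base b)) (hx : BVTys Γ xs As) (ha : ¬ a.IsFree)
    (h : Sm E ((Tm.app (.fvar F) (bvs xs As)).subst σ) ((Tm.app a ss).subst σ)) :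
    ConOrMem xs a := by
  cases a with
  | con c => trivial
  | fvar X => simp [Head.IsFree] at ha
  | bvar i =>
    obtain ⟨s, hs, hty⟩ := hσ.exists_lams hF
    rw [Tm.subst_flex_base hσ hF hx hs, Tm.subst_app _ ha] at h
    exact loose_ren_listRen hx hty ((h.symm hE).loose .head)

/-- The given unifier is transported to the current problem. It forces a rigid right-hand head to be
a constant or one of the arguments; typing matches binders, and separation of the sides excludes the
pair with equal head variables, for which there is no rule. -/
theorem VOk.progress (hE : ConEquiv E) {e₀ : Eqn L} {U₀ : Set L.Var} {C : VCfg L}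
    (h : VOk E e₀ U₀ C) (hU : U₀.Finite) {ψ : L.Var → Tm L} (hψ : IsSubst ψ)
    (hu : Unif E ψ {e₀}) (hne : C.prob.Nonempty) : ∃ C', VStep C C' := by
  classical
  obtain ⟨ψ', hψ', hu', -⟩ := h.tr.compl ψ hψ hu
  have hUf := h.tr.finU hU
  obtain ⟨e, he⟩ := hne
  obtain ⟨⟨T, h1, h2⟩, -⟩ := h.tr.wf e he
  obtain ⟨F, hF⟩ := h.inv.flx e he
  have hsm := hu' e he
  have hlr := h.inv.lhs_rhs e he e he
  obtain ⟨Γ, l, r⟩ := e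
  dsimp only at h1 h2 hF hsm hlr
  suffices ∃ C', VRule (C.prob.erase ⟨Γ, l, r⟩) C.sub C.used ⟨Γ, l, r⟩ C' by
    obtain ⟨C', hC⟩ := this
    exact ⟨C', _, he, hC⟩
  cases hF with
  | lam hF =>
    cases h1 with
    | lam h1 => cases h2 with
      | lam h2 => exact ⟨_, .abs⟩
  | app =>
    cases h1 with
    | app hh => simp [Head.IsFree] at hh
    | @flex _ _ xs As b hxn hx hFt =>
      cases h2 with
      | @flex _ G ys Bs _ hyn hy hG =>
        have hFG : F ≠ G := by
          rintro rfl
          exact hlr F (by rw [fv_flex]; rfl) (by rw [fv_flex]; rfl)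
        have hz : ∀ z, z ∈ xs.filter (· ∈ ys) ↔ z ∈ xs ∧ z ∈ ys := fun z => by simp
        obtain ⟨Cs, hCs⟩ := hx.exists_of_subset (zs := xs.filter (· ∈ ys)) fun z h => ((hz z).1 h).1
        obtain ⟨H, hH, hfresh⟩ := exists_fresh hUf (arrs Cs (.base b))
        exact ⟨_, .ve2 hFG hxn hx.isBVars hyn hy.isBVars (hxn.filter _) hCs.isBVars hz hFt hG hCs
          hH hfresh⟩
      | @app _ a ss Bs _ ha haT hl hts =>
        have ha' := conOrMem_of_sm hE hψ'.tySub hFt hx ha hsm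
        obtain ⟨Hs, h3, h4, h5⟩ := exists_fresh_list hUf As Bs
        exact ⟨_, .ve1 hxn hx.isBVars ha' hFt haT h3 h4 h5⟩

theorem VOk.exists_success (hE : ConEquiv E) {e₀ : Eqn L} {U₀ : Set L.Var} {C : VCfg L}
    (h : VOk E e₀ U₀ C) (hU : U₀.Finite) {ψ : L.Var → Tm L} (hψ : IsSubst ψ)
    (hu : Unif E ψ {e₀}) : ∃ φ U', Relation.ReflTransGen VStep C ⟨∅, φ, U'⟩ := by
  induction h.acc hE with
  | intro C _ ih =>
    by_cases hne : C.prob.Nonempty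
    · obtain ⟨C', hs⟩ := h.progress hE hU hψ hu hne
      obtain ⟨φ, U', h'⟩ := ih C' hs (h.step hE hs).1
      exact ⟨φ, U', .head hs h'⟩
    · rw [Finset.not_nonempty_iff_eq_empty] at hne
      obtain ⟨P, σ, U⟩ := C
      dsimp only at hne
      subst hne
      exact ⟨σ, U, .refl⟩

theorem VOk.init (hE : ConEquiv E) {Γ : Ctx L} {F : L.Var} {us : List (Tm L)} {a : Head L}
    {ss : List (Tm L)} {U : Set L.Var} (hwf : WF U {⟨Γ, .app (.fvar F) us, .app a ss⟩})
    (hF : F ∉ (Tm.app a ss).fv) :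
    VOk E ⟨Γ, .app (.fvar F) us, .app a ss⟩ U (vInit ⟨Γ, .app (.fvar F) us, .app a ss⟩ U) where
  tr := Tr.refl hE hwf
  snd := Snd.refl
  inv := by
    obtain ⟨⟨T, h1, -⟩, -⟩ := wf_singleton.1 hwf
    refine .init .app fun X hX => ?_
    dsimp only at h1 hX
    rw [h1.fv_of_flx .app, Set.mem_singleton_iff] at hX
    subst hX
    exact hF

/-- Factorization is tested only on used variables, so bindings of the auxiliary variables of
variable elimination may be dropped by restriction. -/
theorem Tr.congr {U U' : Set L.Var} {P P' : Finset (Eqn L)} {σ ϑ : L.Var → Tm L}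
    (h : Tr E U P σ P' U') (hϑ : PSub ϑ) (hfin : (dom ϑ).Finite) (he : ∀ X ∈ U, ϑ X = σ X) :
    Tr E U P ϑ P' U' where
  psub := hϑ
  fin := hfin
  sub := h.sub
  finU := h.finU
  fv X hX := by rw [he X hX]; exact h.fv X hX
  wf := h.wf
  compl ψ hψ hu := by
    obtain ⟨ψ', h1, h2, h3⟩ := h.compl ψ hψ hu
    exact ⟨ψ', h1, h2, fun X hX => by rw [he X hX]; exact h3 X hX⟩

theorem Snd.congr {U : Set L.Var} {P P' : Finset (Eqn L)} {σ ϑ : L.Var → Tm L}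
    (h : Snd E P σ P') (hP : WF U P) (he : ∀ X ∈ U, ϑ X = σ X) : Snd E P ϑ P' := by
  intro ρ hρ hu e heP
  obtain ⟨-, h1, h2⟩ := hP e heP
  have := h ρ hρ hu e heP
  rwa [Tm.subst_congr (σ' := comp ϑ ρ) fun X hX => by rw [comp, comp, he X (h1 hX)],
    Tm.subst_congr (t := e.rhs) (σ' := comp ϑ ρ) fun X hX => by rw [comp, comp, he X (h2 hX)]]
    at this

/-- The effect of a successful call of variable elimination. -/
theorem varElim_spec (hE : ConEquiv E) {Γ : Ctx L} {F : L.Var} {us : List (Tm L)} {a : Head L}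
    {ss : List (Tm L)} {U U' : Set L.Var} {φ : L.Var → Tm L}
    (hwf : WF U {⟨Γ, .app (.fvar F) us, .app a ss⟩}) (hF : F ∉ (Tm.app a ss).fv)
    (h : VarElim ⟨Γ, .app (.fvar F) us, .app a ss⟩ U φ U') :
    Tr E U {⟨Γ, .app (.fvar F) us, .app a ss⟩} (restrict φ ({F} ∪ (Tm.app a ss).fv)) ∅ U' ∧
      Snd E {⟨Γ, .app (.fvar F) us, .app a ss⟩} (restrict φ ({F} ∪ (Tm.app a ss).fv)) ∅ ∧
      (valFv (restrict φ ({F} ∪ (Tm.app a ss).fv)) ({F} ∪ (Tm.app a ss).fv)).ncard ≤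
        (Tm.app a ss).fv.ncard := by
  obtain ⟨htr, hsnd, hinv⟩ := (VOk.init hE hwf hF).reaches hE h
  dsimp only at htr hsnd
  obtain ⟨⟨T, h1, -⟩, -⟩ := wf_singleton.1 hwf
  have hfv : (Tm.app (.fvar F) us).fv = {F} := h1.fv_of_flx .app
  have hmem : ∀ X ∈ ({F} ∪ (Tm.app a ss).fv : Set L.Var),
      restrict φ ({F} ∪ (Tm.app a ss).fv) X = φ X := fun X hX => by rw [restrict, if_pos hX]
  have hnmem : ∀ X ∉ ({F} ∪ (Tm.app a ss).fv : Set L.Var),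
      restrict φ ({F} ∪ (Tm.app a ss).fv) X = etaVar X := fun X hX => by rw [restrict, if_neg hX]
  have hU : ∀ X ∈ U, restrict φ ({F} ∪ (Tm.app a ss).fv) X = φ X := by
    intro X hX
    by_cases hXS : X ∈ ({F} ∪ (Tm.app a ss).fv : Set L.Var)
    · exact hmem X hXS
    · rw [hnmem X hXS]
      exact (hinv.out X hX (by simpa [hfv] using hXS)).symm
  refine ⟨htr.congr ?_ ?_ hU, hsnd.congr hwf hU, ?_⟩
  · intro X
    by_cases hXS : X ∈ ({F} ∪ (Tm.app a ss).fv : Set L.Var)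
    · rw [hmem X hXS]; exact htr.psub X
    · rw [hnmem X hXS]; exact pSub_etaVar X
  · refine htr.fin.subset fun X hX => ?_
    by_cases hXS : X ∈ ({F} ∪ (Tm.app a ss).fv : Set L.Var)
    · rw [dom, Set.mem_ofPred_eq, hmem X hXS] at hX
      exact hX
    · exact absurd (hnmem X hXS) hX
  -- On the empty problem there are no left-hand variables to subtract, so `card` bounds all
  -- variables of the returned values.
  · have := hinv.card
    simp only [hfv] at this
    convert this using 2
    ext X
    simp only [valFv, lhsFv, Finset.notMem_empty, false_and, exists_false, Set.mem_sdiff,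
      Set.mem_ofPred_eq, not_false_eq_true, and_true]
    exact exists_congr fun Y => and_congr_right fun hY => by rw [hmem Y hY]

/-! ### Steps of the algorithm -/

/-- The free variables of a problem. -/
def problemFv (P : Finset (Eqn L)) : Set L.Var := {X | ∃ e ∈ P, X ∈ e.lhs.fv ∪ e.rhs.fv}

theorem finite_problemFv (P : Finset (Eqn L)) : (problemFv P).Finite := by
  have : problemFv P = ⋃ e ∈ P, (e.lhs.fv ∪ e.rhs.fv) := by ext; simp [problemFv]
  rw [this]
  exact P.finite_toSet.biUnion fun e _ => e.finite_fv

open Classical in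
theorem mem_problemFv_union {P Q : Finset (Eqn L)} {X : L.Var} :
    X ∈ problemFv (P ∪ Q) ↔ X ∈ problemFv P ∨ X ∈ problemFv Q := by
  simp only [problemFv, Set.mem_ofPred_eq, Finset.mem_union, or_and_right, exists_or]

theorem mem_problemFv_singleton {e : Eqn L} {X : L.Var} :
    X ∈ problemFv {e} ↔ X ∈ e.lhs.fv ∪ e.rhs.fv := by simp [problemFv]

/-- The equation `e` is transformed into the problem `Q` with the substitution `ϑ`, the degree
being changed from `d` to `d'`. -/
structure LocalStep (R : L.Con ⊕ L.Var → L.Con ⊕ L.Var → ℝ) (U : Set L.Var) (e : Eqn L)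
    (ϑ : L.Var → Tm L) (Q : Finset (Eqn L)) (U' : Set L.Var) (d d' : ℝ) : Prop where
  tr : ∀ l, 0 < l → l ≤ 1 → Tr (cut R l) U {e} ϑ Q U'
  snd : ∀ l, 0 < l → l ≤ 1 → l ≤ d' → Snd (cut R l) {e} ϑ Q
  le : d' ≤ d
  compl : ∀ l, 0 < l → l ≤ 1 → l ≤ d → ∀ ψ, Unif (cut R l) ψ {e} → l ≤ d'
  out : ∀ X ∉ e.lhs.fv ∪ e.rhs.fv, ϑ X = etaVar X
  fv : problemFv Q ⊆ valFv ϑ (e.lhs.fv ∪ e.rhs.fv)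
  card : (valFv ϑ (e.lhs.fv ∪ e.rhs.fv)).ncard ≤ (e.lhs.fv ∪ e.rhs.fv).ncard
  decr : (valFv ϑ (e.lhs.fv ∪ e.rhs.fv)).ncard < (e.lhs.fv ∪ e.rhs.fv).ncard ∨
    (∀ X, FlexVal ϑ X) ∧ ∑ e' ∈ Q, e'.wt 2 < e.wt 2

theorem LocalStep.of_etaVar {R : L.Con ⊕ L.Var → L.Con ⊕ L.Var → ℝ} {U : Set L.Var} {e : Eqn L}
    {Q : Finset (Eqn L)} {d d' : ℝ} (tr : ∀ l, 0 < l → l ≤ 1 → Tr (cut R l) U {e} etaVar Q U)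
    (snd : ∀ l, 0 < l → l ≤ 1 → l ≤ d' → Snd (cut R l) {e} etaVar Q) (le : d' ≤ d)
    (compl : ∀ l, 0 < l → l ≤ 1 → l ≤ d → ∀ ψ, Unif (cut R l) ψ {e} → l ≤ d')
    (fv : problemFv Q ⊆ e.lhs.fv ∪ e.rhs.fv) (hwt : ∑ e' ∈ Q, e'.wt 2 < e.wt 2) :
    LocalStep R U e etaVar Q U d d' where
  tr := tr
  snd := snd
  le := le
  compl := compl
  out _ _ := rfl
  fv := by rwa [valFv_etaVar]
  card := by rw [valFv_etaVar]
  decr := .inr ⟨fun _ => flexVal_etaVar rfl, hwt⟩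

open Classical in
-- All rules share one form: a single equation is replaced by `Q`, and the substitution acts on the
-- rest. For rules without instantiation it is the identity, which leaves well-typed equations
-- unchanged.
theorem Rule.localStep {R : L.Con ⊕ L.Var → L.Con ⊕ L.Var → ℝ} (hR : IsAlphabetSimilarity R)
    {μ : ℝ} (hμ0 : 0 < μ) (hμ1 : μ ≤ 1) {P : Finset (Eqn L)} {σ : L.Var → Tm L} {d : ℝ}
    {U : Set L.Var} {e : Eqn L} {C : Cfg L} (hσ : TySub σ) (hP : WF U P) (he : WF U {e})
    (hd : μ ≤ d) (h : Rule R μ P σ d U e C) :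
    ∃ ϑ Q d' U', C = .run (Q ∪ substProblem ϑ P) (comp σ ϑ) d' U' ∧ μ ≤ d' ∧
      LocalStep R U e ϑ Q U' d d' := by
  cases h with
  | @abs Γ A t s =>
    refine ⟨etaVar, {⟨A :: Γ, t, s⟩}, d, U, ?_, hd, .of_etaVar
      (fun l h0 h1 => Tr.abs (conEquiv_cut hR h0 h1) he) (fun l h0 h1 _ => Snd.abs) le_rfl
      (fun _ _ _ h _ _ => h) (fun X hX => by simpa [mem_problemFv_singleton] using hX) ?_⟩
    · rw [hP.substProblem_etaVar, comp_etaVar_right hσ, Finset.insert_eq]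
    · rw [Finset.sum_singleton]
      simp only [Eqn.wt, Tm.wt]
      omega
  | @dec Γ f g ts ss hf hg hlen hd' =>
    obtain ⟨h1, h2⟩ := le_min_iff.1 hd'
    have hfg := (le_headSim_iff hR hμ0 hμ1).1 h2
    refine ⟨etaVar, zipEqns Γ ts ss, _, U, ?_, hd', .of_etaVar
      (fun l h0 h1 => Tr.dec (conEquiv_cut hR h0 h1) hf hg (conEquiv_cut hR hμ0 hμ1) hfg hlen he)
      (fun l h0 h1 h => Snd.dec hf hg
        ((le_headSim_iff hR h0 h1).1 (h.trans (min_le_right _ _))) hlen)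
      (min_le_left _ _) (fun l h0 h1 h ψ hu => ?_) ?_ ?_⟩
    · rw [hP.substProblem_etaVar, comp_etaVar_right hσ]
    · rw [unif_singleton, Tm.subst_app _ hf, Tm.subst_app _ hg, sm_app] at hu
      exact le_min h ((le_headSim_iff hR h0 h1).2 hu.1)
    · rintro X ⟨e, he, hX⟩
      obtain ⟨t, s, hm, rfl⟩ := mem_zipEqns.1 he
      obtain ⟨ht, hs⟩ := List.of_mem_zip hm
      exact hX.imp (fun h => fv_arg_subset subset_rfl t ht h)
        fun h => fv_arg_subset subset_rfl s hs h
    · have := sum_zipEqns_le 2 Γ ts ss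
      refine this.trans_lt ?_
      simp only [Eqn.wt, Tm.wt_rigid hf, Tm.wt_rigid hg]
      omega
  | @sv Γ F xs ys zs us vs ws As Cs b H hxn hus hyn hvs hlen hzn hws hz hF hCs hH hfresh =>
    obtain ⟨⟨T, hp1, hp2⟩, hU1, hU2⟩ := wf_singleton.1 he
    obtain ⟨hx, rfl, rfl⟩ := hp1.flex_args hus hF
    obtain ⟨hy, rfl, -⟩ := hp2.flex_args hvs hF
    obtain rfl := hws.eq_bvs hCs
    have hne : ∀ X, X ≠ F →
        single F (absVars As xs (.app (.fvar H) (bvs zs Cs))) X = etaVar X := fun X h => by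
      rw [single, Function.update_of_ne h]
    have hself : single F (absVars As xs (.app (.fvar H) (bvs zs Cs))) F =
        absVars As xs (.app (.fvar H) (bvs zs Cs)) := by rw [single, Function.update_self]
    have hfv : (Tm.app (.fvar F) (bvs xs As)).fv ∪ (Tm.app (.fvar F) (bvs ys As)).fv = {F} := by
      rw [fv_flex, fv_flex, Set.union_self]
    have hval : valFv (single F (absVars As xs (.app (.fvar H) (bvs zs Cs)))) {F} = {H} := by
      simp only [valFv, Set.mem_singleton_iff, exists_eq_left, hself, fv_absVars_flex]
      rfl
    refine ⟨_, ∅, d, _, by rw [Finset.empty_union], hd,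
      fun l h0 h1 => Tr.sv (conEquiv_cut hR h0 h1) hxn hx hy hzn hCs hz hF hH (fv_flex_mem hU1)
        hfresh,
      fun l h0 h1 _ => Snd.sv (conEquiv_cut hR h0 h1) hxn hyn hx hy hzn hCs hz hF hH, le_rfl,
      fun _ _ _ h _ _ => h, ?_, ?_, ?_, .inr ⟨?_, ?_⟩⟩
    · intro X hX
      rw [hfv] at hX
      exact hne X hX
    · simp [problemFv]
    · rw [hfv, hval, Set.ncard_singleton, Set.ncard_singleton]
    · intro X
      by_cases hX : X = F
      · subst hX
        exact flexVal_absVars hF hself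
      · exact flexVal_etaVar (hne X hX)
    · simp [Eqn.wt, Tm.wt]
  | @ori Γ F xs us a ss hxn hus ha =>
    refine ⟨etaVar, {⟨Γ, .app (.fvar F) us, .app a ss⟩}, d, U, ?_, hd, .of_etaVar
      (fun l h0 h1 => Tr.ori (conEquiv_cut hR h0 h1) he)
      (fun l h0 h1 _ => Snd.ori (conEquiv_cut hR h0 h1)) le_rfl
      (fun _ _ _ h _ _ => h) (fun X hX => ?_) ?_⟩
    · rw [hP.substProblem_etaVar, comp_etaVar_right hσ, Finset.insert_eq]
    · rw [mem_problemFv_singleton] at hX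
      exact hX.symm
    · rw [Finset.sum_singleton]
      -- With left-hand sides counted twice, orientation moves the heavier side to the cheaper
      -- place: a rigid term weighs at least `2`, a flexible one `1`.
      simp only [Eqn.wt, Tm.wt_rigid ha.not_isFree]
      simp only [Tm.wt]
      omega
  | @lf Γ F us a ss φ U' hcall hφ =>
    obtain ⟨xs, hxn, hus, hF, -⟩ := hcall
    obtain ⟨⟨T, hp1, -⟩, -⟩ := wf_singleton.1 he
    have hfv : (Tm.app (.fvar F) us).fv = {F} := hp1.fv_of_flx .app
    -- Variable elimination does not refer to `R`, so the same call is complete and sound at every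
    -- level.
    have key := fun l h0 h1 => varElim_spec (E := cut R l) (conEquiv_cut hR h0 h1) he hF hφ
    -- Since `F` is not on the right, the equation has one variable more than its right-hand side,
    -- whereas the values have at most as many as the right-hand side.
    have hlt : (valFv (restrict φ ({F} ∪ (Tm.app a ss).fv)) ({F} ∪ (Tm.app a ss).fv)).ncard <
        ({F} ∪ (Tm.app a ss).fv).ncard := by
      rw [← Set.insert_eq F, Set.ncard_insert_of_notMem hF (Tm.finite_fv _), Set.insert_eq F]
      exact Nat.lt_succ_of_le (key μ hμ0 hμ1).2.2
    refine ⟨_, ∅, d, U', by rw [Finset.empty_union], hd,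
      fun l h0 h1 => (key l h0 h1).1, fun l h0 h1 _ => (key l h0 h1).2.1, le_rfl,
      fun _ _ _ h _ _ => h, ?_, ?_, ?_, ?_⟩
    · intro X hX
      dsimp only at hX
      rw [hfv] at hX
      rw [restrict, if_neg hX]
    · simp [problemFv]
    · dsimp only
      rw [hfv]
      exact hlt.le
    · dsimp only
      rw [hfv]
      exact .inl hlt

/-- The measure of problems. -/
noncomputable def lexWt (P : Finset (Eqn L)) : ℕ ×ₗ ℕ := toLex ((problemFv P).ncard, ∑ e ∈ P, e.wt 2)

open Classical in
theorem LocalStep.lexWt_lt {R : L.Con ⊕ L.Var → L.Con ⊕ L.Var → ℝ} {U U' : Set L.Var} {e : Eqn L}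
    {ϑ : L.Var → Tm L} {Q P : Finset (Eqn L)} {d d' : ℝ} (h : LocalStep R U e ϑ Q U' d d')
    (he : e ∈ P) (hP : WF U P) : lexWt (Q ∪ substProblem ϑ (P.erase e)) < lexWt P := by
  have hϑ : TySub ϑ := (h.tr 1 one_pos le_rfl).psub.tySub
  have hP' : WF U (P.erase e) := fun e' he' => hP e' (Finset.mem_of_mem_erase he')
  set S := e.lhs.fv ∪ e.rhs.fv with hS
  have hSP : S ⊆ problemFv P := fun X hX => ⟨e, he, hX⟩
  -- The variables of the selected equation are traded for those in their values; all other
  -- variables are fixed by `ϑ`.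
  have hsub : problemFv (Q ∪ substProblem ϑ (P.erase e)) ⊆ (problemFv P \ S) ∪ valFv ϑ S := by
    intro X hX
    rcases mem_problemFv_union.1 hX with hX | ⟨e', he', hX⟩
    · exact .inr (h.fv hX)
    · obtain ⟨e', he'', rfl⟩ := mem_substProblem.1 he'
      obtain ⟨⟨A, h1, h2⟩, -⟩ := hP' e' he''
      obtain ⟨Z, hZ, hX⟩ : ∃ Z ∈ e'.lhs.fv ∪ e'.rhs.fv, X ∈ (ϑ Z).fv := by
        rcases hX with hX | hX
        · obtain ⟨Z, hZ, hX⟩ := h1.fv_subst hϑ hX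
          exact ⟨Z, .inl hZ, hX⟩
        · obtain ⟨Z, hZ, hX⟩ := h2.fv_subst hϑ hX
          exact ⟨Z, .inr hZ, hX⟩
      by_cases hZS : Z ∈ S
      · exact .inr ⟨Z, hZS, hX⟩
      · rw [h.out Z hZS, fv_etaVar, Set.mem_singleton_iff] at hX
        subst hX
        exact .inl ⟨⟨e', Finset.mem_of_mem_erase he'', hZ⟩, hZS⟩
  have hfinS : S.Finite := e.finite_fv
  have h1 := (Set.ncard_le_ncard hsub
    ((finite_problemFv P).sdiff.union (finite_valFv hfinS))).trans (Set.ncard_union_le _ _)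
  have h2 := Set.ncard_sdiff_add_ncard_of_subset hSP (finite_problemFv P)
  rw [lexWt, lexWt, Prod.Lex.toLex_lt_toLex']
  have hcard : (valFv ϑ S).ncard ≤ S.ncard := h.card
  refine ⟨by dsimp only; omega, fun heq => ?_⟩
  dsimp only at heq ⊢
  obtain hlt | ⟨hf, hlt⟩ := h.decr
  · rw [← hS] at hlt
    omega
  · refine (sum_union_le _ _ _).trans_lt ?_
    rw [← Finset.add_sum_erase P _ he]
    exact Nat.add_lt_add_of_lt_of_le hlt (sum_substProblem_le 2 hP' hϑ hf)

/-- The state of the algorithm, started on the equation `e₀`. -/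
structure RunOk (R : L.Con ⊕ L.Var → L.Con ⊕ L.Var → ℝ) (μ : ℝ) (W : Set L.Var) (e₀ : Eqn L)
    (P : Finset (Eqn L)) (σ : L.Var → Tm L) (d : ℝ) (U : Set L.Var) : Prop where
  tr : ∀ l, 0 < l → l ≤ 1 → Tr (cut R l) W {e₀} σ P U
  snd : ∀ l, 0 < l → l ≤ 1 → l ≤ d → Snd (cut R l) {e₀} σ P
  compl : ∀ l, 0 < l → l ≤ 1 → ∀ ψ, IsSubst ψ → Unif (cut R l) ψ {e₀} → l ≤ d
  le : μ ≤ d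
  le_one : d ≤ 1

-- Preservation of the run invariant and termination.

theorem RunOk.init {R : L.Con ⊕ L.Var → L.Con ⊕ L.Var → ℝ} (hR : IsAlphabetSimilarity R)
    {μ : ℝ} (hμ1 : μ ≤ 1) {W : Set L.Var} {e₀ : Eqn L} (h : WF W {e₀}) :
    RunOk R μ W e₀ {e₀} etaVar 1 W where
  tr _ h0 h1 := Tr.refl (conEquiv_cut hR h0 h1) h
  snd _ _ _ _ := Snd.refl
  compl _ _ h1 _ _ _ := h1
  le := hμ1
  le_one := le_rfl

open Classical in
theorem RunOk.rule {R : L.Con ⊕ L.Var → L.Con ⊕ L.Var → ℝ} (hR : IsAlphabetSimilarity R)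
    {μ : ℝ} (hμ0 : 0 < μ) (hμ1 : μ ≤ 1) {W : Set L.Var} {e₀ : Eqn L} {P : Finset (Eqn L)}
    {σ : L.Var → Tm L} {d : ℝ} {U : Set L.Var} (h : RunOk R μ W e₀ P σ d U) {e : Eqn L}
    (he : e ∈ P) {C : Cfg L} (hC : Rule R μ (P.erase e) σ d U e C) :
    ∃ P' σ' d' U', C = .run P' σ' d' U' ∧ RunOk R μ W e₀ P' σ' d' U' ∧ lexWt P' < lexWt P := by
  have h' := h.tr 1 one_pos le_rfl
  have hP' : WF U (P.erase e) := fun e' he' => h'.wf e' (Finset.mem_of_mem_erase he')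
  obtain ⟨ϑ, Q, d', U', rfl, hd', hl⟩ := hC.localStep hR hμ0 hμ1 h'.psub.tySub hP'
    (wf_singleton.2 (h'.wf e he)) h.le
  have hins : insert e (P.erase e) = P := Finset.insert_erase he
  have hϑ : PSub ϑ := (hl.tr 1 one_pos le_rfl).psub
  refine ⟨_, _, _, _, rfl, ⟨fun l h0 h1 => ?_, fun l h0 h1 hle => ?_,
    fun l h0 h1 ψ hψ hu => ?_, hd', hl.le.trans h.le_one⟩, hl.lexWt_lt he h'.wf⟩
  · have := (hl.tr l h0 h1).frame (conEquiv_cut hR h0 h1) hP'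
    rw [hins] at this
    exact (h.tr l h0 h1).trans (conEquiv_cut hR h0 h1) this
  · have := (hl.snd l h0 h1 hle).frame hϑ hP'
    rw [hins] at this
    exact (h.snd l h0 h1 (hle.trans hl.le)).trans h'.psub hϑ this
  -- A unifier of the input at level `l` yields one of the current problem, in particular of the
  -- selected equation, which bounds `l` by the new degree.
  · obtain ⟨ψ', -, h2, -⟩ := (h.tr l h0 h1).compl ψ hψ hu
    exact hl.compl l h0 h1 (h.compl l h0 h1 ψ hψ hu) ψ' (unif_singleton.2 (h2 e he))

theorem RunOk.acc {R : L.Con ⊕ L.Var → L.Con ⊕ L.Var → ℝ} (hR : IsAlphabetSimilarity R)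
    {μ : ℝ} (hμ0 : 0 < μ) (hμ1 : μ ≤ 1) {W : Set L.Var} {e₀ : Eqn L} {P : Finset (Eqn L)}
    {σ : L.Var → Tm L} {d : ℝ} {U : Set L.Var} (h : RunOk R μ W e₀ P σ d U) :
    Acc (fun C' C => Step R μ C C') (.run P σ d U) := by
  induction hn : lexWt P using WellFoundedLT.induction generalizing P σ d U with
  | _ n ih =>
    subst hn
    refine ⟨_, fun C hs => ?_⟩
    cases hs with
    | rule he hC =>
      obtain ⟨P', σ', d', U', rfl, h1, h2⟩ := h.rule hR hμ0 hμ1 he hC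
      exact ih _ h2 h1 rfl
    | fail => exact ⟨_, fun C hs => by cases hs⟩

-- Progress on unifiable problems.

theorem exists_common_positions {xs ys : List ℕ} (hx : xs.Nodup) (hy : ys.Nodup) :
    ∃ zs : List ℕ, zs.Nodup ∧ ∀ z, z ∈ zs ↔ ∃ i : ℕ, xs[i]? = some z ∧ ys[i]? = some z := by
  refine ⟨xs.filter fun z => z ∈ ys ∧ xs.idxOf z = ys.idxOf z, hx.filter _, fun z => ?_⟩
  simp only [List.mem_filter, decide_eq_true_eq]
  constructor
  · rintro ⟨h1, h2, h3⟩
    exact ⟨xs.idxOf z, List.getElem?_idxOf h1, by rw [h3]; exact List.getElem?_idxOf h2⟩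
  · rintro ⟨i, h1, h2⟩
    refine ⟨List.mem_of_getElem? h1, List.mem_of_getElem? h2, ?_⟩
    obtain ⟨hi, rfl⟩ := List.getElem?_eq_some_iff.1 h1
    obtain ⟨hj, e⟩ := List.getElem?_eq_some_iff.1 h2
    rw [hx.idxOf_getElem, ← e, hy.idxOf_getElem]

open Classical in
/-- To each equation of a unifiable problem a rule applies. -/
theorem RunOk.progress {R : L.Con ⊕ L.Var → L.Con ⊕ L.Var → ℝ} (hR : IsAlphabetSimilarity R)
    {μ : ℝ} {W : Set L.Var} (hW : W.Finite) {e₀ : Eqn L}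
    {P : Finset (Eqn L)} {σ : L.Var → Tm L} {d : ℝ} {U : Set L.Var}
    (h : RunOk R μ W e₀ P σ d U) {l : ℝ} (h0 : 0 < l) (h1 : l ≤ 1) (hl : μ ≤ l)
    {ψ : L.Var → Tm L} (hψ : IsSubst ψ) (hu : Unif (cut R l) ψ {e₀}) {e : Eqn L} (he : e ∈ P) :
    ∃ C, Rule R μ (P.erase e) σ d U e C := by
  have hE := conEquiv_cut hR h0 h1
  have htr := h.tr l h0 h1
  have hUf := htr.finU hW
  obtain ⟨ψ', hψ', hu', -⟩ := htr.compl ψ hψ hu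
  have hwf := wf_singleton.2 (htr.wf e he)
  obtain ⟨⟨T, hp1, hp2⟩, -⟩ := htr.wf e he
  have hsm := hu' e he
  obtain ⟨Γ, t, s⟩ := e
  dsimp only at hp1 hp2 hsm
  cases hp1 with
  | lam hp1 => cases hp2 with
    | lam hp2 => exact ⟨_, .abs⟩
  | @flex _ F xs As b hxn hx hF =>
    -- The left-flex rule has a successful call of variable elimination as a premise; the
    -- transported unifier of the selected equation supplies one.
    have left_flex : ∀ {a ss}, WF U {⟨Γ, .app (.fvar F) (bvs xs As), .app a ss⟩} →
        Unif (cut R l) ψ' {⟨Γ, .app (.fvar F) (bvs xs As), .app a ss⟩} → F ∉ (Tm.app a ss).fv →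
        (ConOrMem xs a ∨ a.IsFree) → ∃ C, Rule R μ (P.erase ⟨Γ, .app (.fvar F) (bvs xs As),
          .app a ss⟩) σ d U ⟨Γ, .app (.fvar F) (bvs xs As), .app a ss⟩ C := by
      intro a ss hwf hu hFa ha
      obtain ⟨φ, U', hφ⟩ := (VOk.init hE hwf hFa).exists_success hE hUf hψ' hu
      exact ⟨_, .lf ⟨xs, hxn, hx.isBVars, hFa, ha⟩ hφ⟩
    cases hp2 with
    | @flex _ G ys Bs _ hyn hy hG =>
      by_cases e : F = G
      · subst e
        obtain ⟨rfl, -⟩ := arrs_base_inj (hF.symm.trans hG)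
        obtain ⟨zs, hzn, hz⟩ := exists_common_positions hxn hyn
        obtain ⟨Cs, hCs⟩ := hx.exists_of_subset (zs := zs) fun z h => by
          obtain ⟨i, h1, -⟩ := (hz z).1 h
          exact List.mem_of_getElem? h1
        obtain ⟨H, hH, hfresh⟩ := exists_fresh hUf (arrs Cs (.base b))
        exact ⟨_, .sv hxn hx.isBVars hyn hy.isBVars (hx.length_eq.trans hy.length_eq.symm) hzn
          hCs.isBVars hz hF hCs hH hfresh⟩
      · exact left_flex hwf (unif_singleton.2 hsm) (by rwa [fv_flex, Set.mem_singleton_iff])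
          (.inr trivial)
    | @app _ a ss Bs _ ha haT hlen hts =>
      exact left_flex hwf (unif_singleton.2 hsm)
        (occurs_check hψ'.tySub hF hx ha (.app ha haT hlen hts) hsm)
        (.inl (conOrMem_of_sm hE hψ'.tySub hF hx ha hsm))
  | @app _ f ts As b hf hfT hlen hts =>
    cases hp2 with
    | @flex _ F xs Bs _ hxn hx hF =>
      exact ⟨_, .ori hxn hx.isBVars (conOrMem_of_sm hE hψ'.tySub hF hx hf (hsm.symm hE))⟩
    | @app _ g ss Bs _ hg hgT hlen' hss =>
      rw [Tm.subst_app _ hf, Tm.subst_app _ hg, sm_app] at hsm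
      -- The level `l ≥ μ` of the unifier lies below both the current degree and the degree of the
      -- two heads, so decomposition stays above `μ`.
      refine ⟨_, .dec hf hg (by simpa using hsm.2.length_eq) (hl.trans (le_min ?_ ?_))⟩
      · exact h.compl l h0 h1 ψ hψ hu
      · exact (le_headSim_iff hR h0 h1).2 hsm.1

theorem RunOk.exists_success {R : L.Con ⊕ L.Var → L.Con ⊕ L.Var → ℝ}
    (hR : IsAlphabetSimilarity R) {μ : ℝ} (hμ0 : 0 < μ) (hμ1 : μ ≤ 1) {W : Set L.Var}
    (hW : W.Finite) {e₀ : Eqn L} {P : Finset (Eqn L)} {σ : L.Var → Tm L} {d : ℝ} {U : Set L.Var}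
    (h : RunOk R μ W e₀ P σ d U) {l : ℝ} (h0 : 0 < l) (h1 : l ≤ 1) (hl : μ ≤ l)
    {ψ : L.Var → Tm L} (hψ : IsSubst ψ) (hu : Unif (cut R l) ψ {e₀}) :
    ∃ σ' d' U', Relation.ReflTransGen (Step R μ) (.run P σ d U) (.run ∅ σ' d' U') := by
  induction hn : lexWt P using WellFoundedLT.induction generalizing P σ d U with
  | _ n ih =>
    subst hn
    obtain rfl | ⟨e, he⟩ := P.eq_empty_or_nonempty
    · exact ⟨σ, d, U, .refl⟩
    · obtain ⟨C, hC⟩ := h.progress hR hW h0 h1 hl hψ hu he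
      obtain ⟨P', σ', d', U', rfl, h2, h3⟩ := h.rule hR hμ0 hμ1 he hC
      obtain ⟨σ'', d'', U'', h4⟩ := ih _ h3 h2 rfl
      exact ⟨σ'', d'', U'', .head (.rule he hC) h4⟩

/-- All configurations of the runs on a unifiable problem. -/
theorem Reaches.runOk {R : L.Con ⊕ L.Var → L.Con ⊕ L.Var → ℝ} (hR : IsAlphabetSimilarity R)
    {μ : ℝ} (hμ0 : 0 < μ) (hμ1 : μ ≤ 1) {W : Set L.Var} (hW : W.Finite) {t s : Tm L}
    (hwf : WF W {⟨[], t, s⟩}) {l : ℝ} (h0 : 0 < l) (h1 : l ≤ 1) (hl : μ ≤ l)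
    {ψ : L.Var → Tm L} (hψ : IsSubst ψ) (hu : Unif (cut R l) ψ {⟨[], t, s⟩}) {C : Cfg L}
    (h : Reaches R μ W t s C) :
    ∃ P σ d U, C = .run P σ d U ∧ RunOk R μ W ⟨[], t, s⟩ P σ d U := by
  induction h with
  | refl => exact ⟨_, _, _, _, rfl, .init hR hμ1 hwf⟩
  | tail _ hs ih =>
    obtain ⟨P, σ, d, U, rfl, hok⟩ := ih
    cases hs with
    | rule he hC =>
      obtain ⟨P', σ', d', U', rfl, h2, -⟩ := hok.rule hR hμ0 hμ1 he hC
      exact ⟨_, _, _, _, rfl, h2⟩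
    | fail he hC =>
      obtain ⟨C, h2⟩ := hok.progress hR hW h0 h1 hl hψ hu he
      exact absurd h2 (hC C)

-- Degree, generality and maximality of computed answers.

theorem IsUnifier.unif {R : L.Con ⊕ L.Var → L.Con ⊕ L.Var → ℝ} (hR : IsAlphabetSimilarity R)
    {μ : ℝ} (hμ0 : 0 < μ) {t s : Tm L} {ϑ : L.Var → Tm L} {e : ℝ} (h : IsUnifier R μ t s ϑ e) :
    0 < e ∧ e ≤ 1 ∧ Unif (cut R e) ϑ {⟨[], t, s⟩} := by
  -- The cut is taken at the unifier's own degree, an admissible level because `0 < μ ≤ e ≤ 1`.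
  obtain ⟨-, rfl, hle⟩ := h
  have h0 := hμ0.trans_le hle
  have h1 := sim_le_one hR (t.subst ϑ) (s.subst ϑ)
  exact ⟨h0, h1, unif_singleton.2 ((le_sim_iff hR h0 h1).1 le_rfl)⟩

theorem RunOk.moreGeneral {R : L.Con ⊕ L.Var → L.Con ⊕ L.Var → ℝ} (hR : IsAlphabetSimilarity R)
    {μ : ℝ} (hμ0 : 0 < μ) {W : Set L.Var} {t s : Tm L} {P : Finset (Eqn L)} {σ : L.Var → Tm L}
    {d : ℝ} {U : Set L.Var} (h : RunOk R μ W ⟨[], t, s⟩ P σ d U) {ϑ : L.Var → Tm L} {e : ℝ}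
    (hϑ : IsUnifier R μ t s ϑ e) {V : Set L.Var} (hV : V ⊆ W) : MoreGeneral R μ V σ ϑ := by
  obtain ⟨h0, h1, hu⟩ := hϑ.unif hR hμ0
  obtain ⟨ψ, hψ, -, hs⟩ := (h.tr e h0 h1).compl ϑ hϑ.1 hu
  exact ⟨ψ, hψ, fun X hX => hϑ.2.2.trans ((le_sim_iff hR h0 h1).2 (hs X (hV hX)))⟩

/-- The identity solves the empty problem, so soundness at level `d` gives degree at least `d`.
Conversely `σ` is itself a unifier at the level of its true degree, and `compl` bounds that level by
`d`. -/
theorem RunOk.isUnifier {R : L.Con ⊕ L.Var → L.Con ⊕ L.Var → ℝ} (hR : IsAlphabetSimilarity R)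
    {μ : ℝ} (hμ0 : 0 < μ) {W : Set L.Var} {t s : Tm L} {σ : L.Var → Tm L}
    {d : ℝ} {U : Set L.Var} (h : RunOk R μ W ⟨[], t, s⟩ ∅ σ d U) : IsUnifier R μ t s σ d := by
  have h0 := hμ0.trans_le h.le
  have htr := h.tr d h0 h.le_one
  have hσ : IsSubst σ := ⟨htr.psub.tySub, htr.fin⟩
  have hsm := h.snd d h0 h.le_one le_rfl etaVar tySub_etaVar fun e he => by simp at he
  rw [comp_etaVar_right hσ.tySub, unif_singleton] at hsm
  have hle : d ≤ sim R (t.subst σ) (s.subst σ) := (le_sim_iff hR h0 h.le_one).2 hsm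
  obtain ⟨h2, h3, hu⟩ := IsUnifier.unif hR hμ0 (⟨hσ, rfl, h.le.trans hle⟩ : IsUnifier R μ t s σ _)
  exact ⟨hσ, le_antisymm (h.compl _ h2 h3 σ hσ hu) hle, h.le⟩

end HOPU

theorem mainTheorem1 (L : Lang.{u, v, w})
    (R : L.Con ⊕ L.Var → L.Con ⊕ L.Var → ℝ) (hR : IsAlphabetSimilarity R)
    (μ : ℝ) (hμ0 : 0 < μ) (hμ1 : μ ≤ 1)
    (t s : Tm L) (A B : Ty L.Base) (ht : HasTy [] t A) (hs : HasTy [] s B)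
    (htp : IsPattern [] t) (hsp : IsPattern [] s)
    (W : Set L.Var) (hWfin : W.Finite) (hW : t.fv ∪ s.fv ⊆ W)
    (τ : L.Var → Tm L) (dτ : ℝ) (hτ : IsUnifier R μ t s τ dτ) :
    Terminates R μ W t s ∧ ¬ CanFail R μ W t s ∧
      (∃ σ d, Computes R μ W t s σ d) ∧
      ∀ σ d, Computes R μ W t s σ d →
        IsUnifier R μ t s σ d ∧ (∀ X, IsPattern [] (σ X)) ∧
        (dom τ ⊆ W → MoreGeneral R μ (dom τ) σ τ) ∧ dτ ≤ d ∧
        IsMGU R μ t s σ ∧ ∀ ϑ e, IsUnifier R μ t s ϑ e → e ≤ d := by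
  obtain ⟨h0, h1, hu⟩ := hτ.unif hR hμ0
  have hp := ht.pat htp
  have hp' := hs.pat hsp
  -- Equality of the two types is not assumed: the instances under `τ` keep the types `A` and `B`,
  -- and similar terms have the same type.
  obtain rfl : A = B := (unif_singleton.1 hu).ty_eq (conEquiv_cut hR h0 h1)
    (hp.subst_hasTy hτ.1.tySub) (hp'.subst_hasTy hτ.1.tySub)
  have hwf : WF W {⟨[], t, s⟩} := wf_singleton.2
    ⟨⟨A, hp, hp'⟩, Set.subset_union_left.trans hW, Set.subset_union_right.trans hW⟩
  have hinit : RunOk R μ W ⟨[], t, s⟩ {⟨[], t, s⟩} etaVar 1 W := .init hR hμ1 hwf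
  have hreach : ∀ {P σ d U}, Reaches R μ W t s (.run P σ d U) →
      RunOk R μ W ⟨[], t, s⟩ P σ d U := fun h => by
    obtain ⟨_, _, _, _, e, hok⟩ := h.runOk hR hμ0 hμ1 hWfin hwf h0 h1 hτ.2.2 hτ.1 hu
    cases e
    exact hok
  refine ⟨⟨hinit.acc hR hμ0 hμ1, ?_⟩, ?_, ?_, ?_⟩
  · rintro P σ d U h Γ F us a ss he ⟨xs, -, -, hF, -⟩
    have hE := conEquiv_cut hR h0 h1
    exact (VOk.init hE (wf_singleton.2 (((hreach h).tr dτ h0 h1).wf _ he)) hF).acc hE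
  · intro h
    obtain ⟨_, _, _, _, e, -⟩ := Reaches.runOk hR hμ0 hμ1 hWfin hwf h0 h1 hτ.2.2 hτ.1 hu h
    cases e
  · obtain ⟨σ, d, U, h⟩ := hinit.exists_success hR hμ0 hμ1 hWfin h0 h1 hτ.2.2 hτ.1 hu
    exact ⟨σ, d, U, h⟩
  · rintro σ d ⟨U, h⟩
    have hok := hreach h
    have hmax : ∀ ϑ e, IsUnifier R μ t s ϑ e → e ≤ d := fun ϑ e hϑ => by
      obtain ⟨h2, h3, hu'⟩ := hϑ.unif hR hμ0
      exact hok.compl e h2 h3 ϑ hϑ.1 hu'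
    exact ⟨hok.isUnifier hR hμ0, fun X => ((hok.tr dτ h0 h1).psub X).isPattern,
      fun hV => hok.moreGeneral hR hμ0 hτ hV, hmax τ dτ hτ, ⟨⟨d, hok.isUnifier hR hμ0⟩,
      fun ϑ e hϑ => hok.moreGeneral hR hμ0 hϑ hW⟩, hmax⟩
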